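/- Let $N\in\mathbb{N}$ and $1<p<N$, put $p^*=Np/(N-p)$, and let $\Omega\subset\mathbb{R}^N$ be a nonempty bounded open set. Let $W_0^{1,p}(\Omega)$ be the closure of $C_c^\infty(\Omega)$ in $W^{1,p}(\Omega)$ and $$\lambda_1(\Omega)=\inf\left\{\frac{\int_\Omega|\nabla u|^p\,dx}{\int_\Omega|u|^p\,dx}:\ u\in W_0^{1,p}(\Omega)\setminus\{0\}\right\}.$$ Let $f:\Omega\times\mathbb{R}\to\mathbb{R}$, put $F(x,u)=\int_0^u f(x,t)\,dt$ and $H(x,u)=u f(x,u)-pF(x,u)$, and assume: - (SCPI) $\displaystyle\lim_{s\to+\infty}\frac{f(x,s)}{|s|^{p^*-1}}=0$ uniformly in $x\in\Omega$; - (L1) $f$ is continuous on $\Omega\times\mathbb{R}$, $f(x,u)\ge 0$ for all $x\in\Omega$, $u\ge0$, and $f(x,u)=0$ for all $x\in\Omega$, $u\le 0$; - (L2) $\displaystyle\lim_{u\to+\infty}\frac{F(x,u)}{u^p}=+\infty$ uniformly in $x\in\Omega$; - (L3) there are $C_*\ge0$ and $\theta\ge1$ such that $H(x,t)\le\theta H(x,s)+C_*$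 for all $0<t<s$ and all $x\in\Omega$; - (L4) $\displaystyle\limsup_{u\to0^+}\frac{pF(x,u)}{|u|^p}<\lambda_1(\Omega)$ uniformly in $x\in\Omega$, that is, there are $\mu<\lambda_1(\Omega)$ and $\delta>0$ with $pF(x,u)\le\mu\,|u|^p$ for all $x\in\Omega$ and $0<u<\delta$. Then the problem $-\Delta_p u=-\operatorname{div}(|\nabla u|^{p-2}\nabla u)=f(x,u)$ in $\Omega$ has a nontrivial nonnegative weak solution: there is $u\in W_0^{1,p}(\Omega)\setminus\{0\}$ with $u\ge0$ almost everywhere in $\Omega$ such that, for every $v\in W_0^{1,p}(\Omega)$, the function $f(x,u)v$ is integrable on $\Omega$ and $$\int_\Omega|\nabla u|^{p-2}\nabla u\cdot\nabla v\,dx=\int_\Omega f(x,u)\,v\,dx .$$ -/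

import Mathlib

open MeasureTheory Filter Topology Set
open scoped ContDiff

noncomputable section

namespace PLaplace

/-- Euclidean `N`-space. -/
abbrev E (N : ℕ) := EuclideanSpace ℝ (Fin N)

/-- `φ ∈ C_c^∞(Ω)`. -/
structure IsTestFunction {N : ℕ} (Ω : Set (E N)) (φ : E N → ℝ) : Prop where
  smooth : ContDiff ℝ ∞ φ
  compact : HasCompactSupport φ
  supp : tsupport φ ⊆ Ω

/-- `G` is the weak (distributional) gradient of `u` on `Ω`. -/
structure HasWeakGradient {N : ℕ} (Ω : Set (E N)) (u : E N → ℝ) (G : E N → E N) : Prop where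
  locInt : LocallyIntegrableOn u Ω
  locInt_grad : LocallyIntegrableOn G Ω
  parts : ∀ φ : E N → ℝ, IsTestFunction Ω φ →
    ∫ x in Ω, u x • gradient φ x = - ∫ x in Ω, φ x • G x

/-- `u ∈ W^{1,p}(Ω)`, with weak gradient `G`. -/
structure MemW1p {N : ℕ} (Ω : Set (E N)) (p : ℝ) (u : E N → ℝ) (G : E N → E N) : Prop where
  memLp : MemLp u (ENNReal.ofReal p) (volume.restrict Ω)
  memLp_grad : MemLp G (ENNReal.ofReal p) (volume.restrict Ω)
  weakGrad : HasWeakGradient Ω u G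

/-- `u ∈ W_0^{1,p}(Ω)`, with weak gradient `G`: `u` lies in `W^{1,p}(Ω)` and is a limit of
functions of `C_c^∞(Ω)` in the norm of `W^{1,p}(Ω)`. -/
structure MemW01p {N : ℕ} (Ω : Set (E N)) (p : ℝ) (u : E N → ℝ) (G : E N → E N) : Prop where
  memW1p : MemW1p Ω p u G
  approx : ∃ φ : ℕ → E N → ℝ, (∀ n, IsTestFunction Ω (φ n)) ∧
    Tendsto (fun n => eLpNorm (fun x => u x - φ n x) (ENNReal.ofReal p) (volume.restrict Ω))
      atTop (𝓝 0) ∧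
    Tendsto (fun n => eLpNorm (fun x => G x - gradient (φ n) x) (ENNReal.ofReal p)
      (volume.restrict Ω)) atTop (𝓝 0)

/-- `u` is not the zero element of a space of functions on `Ω` modulo null sets. -/
def Nontrivial {N : ℕ} (Ω : Set (E N)) (u : E N → ℝ) : Prop :=
  ¬ (∀ᵐ x ∂(volume.restrict Ω), u x = 0)

/-- The first eigenvalue of `-Δ_p` with Dirichlet condition: the infimum of
`∫ |∇u|^p / ∫ |u|^p` over the nonzero `u ∈ W_0^{1,p}(Ω)`. -/
def lambda1 {N : ℕ} (Ω : Set (E N)) (p : ℝ) : ℝ :=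
  sInf {r : ℝ | ∃ (u : E N → ℝ) (G : E N → E N), MemW01p Ω p u G ∧ Nontrivial Ω u ∧
    r = (∫ x in Ω, ‖G x‖ ^ p) / (∫ x in Ω, |u x| ^ p)}

/-- The critical Sobolev exponent `p^* = Np/(N-p)`. -/
def pStar (N : ℕ) (p : ℝ) : ℝ := N * p / (N - p)

/-- `F(x,u) = ∫_0^u f(x,t) dt`. -/
def primitiveF {N : ℕ} (f : E N → ℝ → ℝ) (x : E N) (u : ℝ) : ℝ := ∫ t in (0 : ℝ)..u, f x t

/-- `H(x,u) = u f(x,u) - p F(x,u)`. -/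
def funH {N : ℕ} (p : ℝ) (f : E N → ℝ → ℝ) (x : E N) (u : ℝ) : ℝ :=
  u * f x u - p * primitiveF f x u

/-- Improved subcritical polynomial growth:
`f(x,s)/|s|^{p^*-1} → 0` as `s → +∞`, uniformly on `Ω`. -/
def SCPI {N : ℕ} (Ω : Set (E N)) (p : ℝ) (f : E N → ℝ → ℝ) : Prop :=
  TendstoUniformlyOn (fun (s : ℝ) (x : E N) => f x s / |s| ^ (pStar N p - 1))
    (fun _ => 0) atTop Ω

/-- `f` is continuous on `Ω × ℝ`, nonnegative for `u ≥ 0` and zero for `u ≤ 0`. -/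
structure L1 {N : ℕ} (Ω : Set (E N)) (f : E N → ℝ → ℝ) : Prop where
  cont : ContinuousOn (fun q : E N × ℝ => f q.1 q.2) (Ω ×ˢ univ)
  nonneg : ∀ x ∈ Ω, ∀ u : ℝ, 0 ≤ u → 0 ≤ f x u
  zero : ∀ x ∈ Ω, ∀ u : ℝ, u ≤ 0 → f x u = 0

/-- `F(x,u)/u^p → +∞` as `u → +∞`, uniformly on `Ω`. -/
def L2 {N : ℕ} (Ω : Set (E N)) (p : ℝ) (f : E N → ℝ → ℝ) : Prop :=
  ∀ M : ℝ, ∀ᶠ u : ℝ in atTop, ∀ x ∈ Ω, M ≤ primitiveF f x u / u ^ p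

/-- Quasi-monotonicity of `H`. -/
def L3 {N : ℕ} (Ω : Set (E N)) (p : ℝ) (f : E N → ℝ → ℝ) : Prop :=
  ∃ C θ : ℝ, 0 ≤ C ∧ 1 ≤ θ ∧
    ∀ x ∈ Ω, ∀ t s : ℝ, 0 < t → t < s → funH p f x t ≤ θ * funH p f x s + C

/-- `limsup_{u → 0+} p F(x,u)/|u|^p < λ_1(Ω)`, uniformly on `Ω`. -/
def L4 {N : ℕ} (Ω : Set (E N)) (p : ℝ) (f : E N → ℝ → ℝ) : Prop :=
  ∃ μ : ℝ, μ < lambda1 Ω p ∧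
    ∀ᶠ u : ℝ in 𝓝[>] 0, ∀ x ∈ Ω, p * primitiveF f x u / |u| ^ p ≤ μ

/-- `u ∈ W_0^{1,p}(Ω)`, with weak gradient `Du`, is a weak solution of `-Δ_p u = f(x,u)`:
for every `v ∈ W_0^{1,p}(Ω)` the product `f(x,u) v` is integrable and
`∫ |∇u|^{p-2} ∇u · ∇v = ∫ f(x,u) v`. -/
structure IsWeakSolution {N : ℕ} (Ω : Set (E N)) (p : ℝ) (f : E N → ℝ → ℝ)
    (u : E N → ℝ) (Du : E N → E N) : Prop where
  mem : MemW01p Ω p u Du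
  integrable : ∀ (v : E N → ℝ) (Dv : E N → E N), MemW01p Ω p v Dv →
    IntegrableOn (fun x => f x (u x) * v x) Ω
  eqn : ∀ (v : E N → ℝ) (Dv : E N → E N), MemW01p Ω p v Dv →
    ∫ x in Ω, ‖Du x‖ ^ (p - 2) * inner ℝ (Du x) (Dv x) = ∫ x in Ω, f x (u x) * v x

end PLaplace

end

noncomputable section

namespace PLaplace

variable {N : ℕ} {Ω : Set (E N)}

/-! ### Gradients -/

/-! The solution is a mountain pass point of J(φ) = (1/p)∫|∇φ|^p − ∫F(x,φ). (L4), the definition of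
λ₁ and Sobolev's inequality give J ≥ α > 0 on a small level set of the energy ∫|∇φ|^p
(`exists_functional_ge`); (L2) gives J ≤ 0 at a large multiple of a bump
(`exists_functional_nonpos`). The mountain pass principle is applied only on finite-dimensional
spans of test functions, with level bounds independent of the dimension (`exists_galerkin`). The
result is a sequence of test functions u_n with J(u_n) bounded and at least a positive constant,
J'(u_n)u_n → 0, and J'(u_n)d_k → 0 for every d_k of a countable dense family (`exists_palaisSmale`).

Boundedness of the energies (`exists_energy_le`) has no Ambrosetti-Rabinowitz condition to rely on.
If the energies were unbounded, the normalized functions w_n = u_n/R_n would converge almost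
everywhere to some w. Fatou and (L2) force w ≤ 0, so J(M w_n) → M^p/p for every M. But (L3), used at
a maximum of J on the segment from 0 to u_n, bounds J there by a constant independent of n
(`functional_smul_le`). A large M gives a contradiction.

The limit u is obtained almost everywhere by Rellich. Since f is continuous only on the open set Ω ×
ℝ, f(x,t) may blow up at the boundary for bounded t. The hypotheses still bound F and t f(x,t) by K
+ ε|t|^{p*} uniformly in x (`exists_growth`), but f itself only over compact subsets of Ω. Hence
integrability of a v, where a = f(x,u), is part of what has to be proved.

Put Q = ∫ a u, which is also the limit of the energies. Convexity of |·|^p and J'(u_n)d_k → 0 give ∫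
a d_k ≤ (1/p)∫|∇d_k|^p + Q − Q/p. As a ≥ 0, Fatou extends this to nonnegative test functions,
scaling turns it into a norm bound for v ↦ ∫ a v, and continuity extends it to W_0^{1,p}. The
positive part u⁺ has energy at most Q and ∫ a u⁺ = Q, so it minimizes (1/p)∫|Dv|^p − ∫ a v. Its
Euler-Lagrange equation is the weak equation, because f(x,u) = f(x,u⁺). Convergence of the gradients
of u_n is never needed. Finally Q > 0, because J(u_n) stays above a positive constant and F ≥ 0; so
u⁺ is not zero. -/

theorem gradient_eq_toDual_symm (φ : E N → ℝ) (x : E N) :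
    gradient φ x = (InnerProductSpace.toDual ℝ (E N)).symm (fderiv ℝ φ x) := rfl

theorem inner_gradient (φ : E N → ℝ) (x v : E N) : inner ℝ (gradient φ x) v = fderiv ℝ φ x v := by
  rw [gradient_eq_toDual_symm, InnerProductSpace.toDual_symm_apply]

theorem norm_gradient (φ : E N → ℝ) (x : E N) : ‖gradient φ x‖ = ‖fderiv ℝ φ x‖ := by
  rw [gradient_eq_toDual_symm, LinearIsometryEquiv.norm_map]

theorem gradient_add {φ ψ : E N → ℝ} {x : E N} (hφ : DifferentiableAt ℝ φ x)
    (hψ : DifferentiableAt ℝ ψ x) :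
    gradient (fun y => φ y + ψ y) x = gradient φ x + gradient ψ x := by
  simp only [gradient_eq_toDual_symm, fderiv_fun_add hφ hψ, map_add]

theorem gradient_const_mul {φ : E N → ℝ} {x : E N} (hφ : DifferentiableAt ℝ φ x) (c : ℝ) :
    gradient (fun y => c * φ y) x = c • gradient φ x := by
  simp only [gradient_eq_toDual_symm, fderiv_const_mul hφ c, map_smul]

theorem gradient_sum {ι : Type*} {s : Finset ι} {φ : ι → E N → ℝ} {x : E N}
    (hφ : ∀ i ∈ s, DifferentiableAt ℝ (φ i) x) :
    gradient (fun y => ∑ i ∈ s, φ i y) x = ∑ i ∈ s, gradient (φ i) x := by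
  simp only [gradient_eq_toDual_symm, fderiv_fun_sum hφ, map_sum]

/-! ### Test functions -/

namespace IsTestFunction

variable {φ ψ : E N → ℝ}

theorem continuous (hφ : IsTestFunction Ω φ) : Continuous φ := hφ.smooth.continuous

theorem differentiableAt (hφ : IsTestFunction Ω φ) (x : E N) : DifferentiableAt ℝ φ x :=
  hφ.smooth.differentiable (by simp) x

theorem continuous_gradient (hφ : IsTestFunction Ω φ) : Continuous (gradient φ) :=
  (InnerProductSpace.toDual ℝ (E N)).symm.continuous.comp (hφ.smooth.continuous_fderiv (by simp))

theorem gradient_eq_zero_of_notMem {x : E N} (hx : x ∉ tsupport φ) : gradient φ x = 0 := by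
  have : fderiv ℝ φ x = 0 :=
    image_eq_zero_of_notMem_tsupport fun h => hx (tsupport_fderiv_subset ℝ h)
  rw [gradient_eq_toDual_symm, this, map_zero]

theorem hasCompactSupport_gradient (hφ : IsTestFunction Ω φ) : HasCompactSupport (gradient φ) :=
  (hφ.compact.fderiv ℝ).comp_left (g := (InnerProductSpace.toDual ℝ (E N)).symm) (map_zero _)

theorem eq_zero_of_notMem (hφ : IsTestFunction Ω φ) {x : E N} (hx : x ∉ Ω) : φ x = 0 :=
  image_eq_zero_of_notMem_tsupport fun h => hx (hφ.supp h)

theorem gradient_eq_zero (hφ : IsTestFunction Ω φ) {x : E N} (hx : x ∉ Ω) : gradient φ x = 0 :=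
  gradient_eq_zero_of_notMem fun h => hx (hφ.supp h)

theorem memLp (hφ : IsTestFunction Ω φ) (q : ENNReal) : MemLp φ q (volume.restrict Ω) :=
  hφ.continuous.memLp_of_hasCompactSupport hφ.compact

theorem memLp_gradient (hφ : IsTestFunction Ω φ) (q : ENNReal) :
    MemLp (gradient φ) q (volume.restrict Ω) :=
  hφ.continuous_gradient.memLp_of_hasCompactSupport hφ.hasCompactSupport_gradient

theorem comp_left (hφ : IsTestFunction Ω φ) {β : ℝ → ℝ} (hβ : ContDiff ℝ ∞ β) (h0 : β 0 = 0) :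
    IsTestFunction Ω (fun x => β (φ x)) where
  smooth := hβ.comp hφ.smooth
  compact := hφ.compact.comp_left h0
  supp := (tsupport_comp_subset h0 φ).trans hφ.supp

theorem add (hφ : IsTestFunction Ω φ) (hψ : IsTestFunction Ω ψ) :
    IsTestFunction Ω (fun x => φ x + ψ x) where
  smooth := hφ.smooth.add hψ.smooth
  compact := hφ.compact.add hψ.compact
  supp := (tsupport_add φ ψ).trans (union_subset hφ.supp hψ.supp)

theorem const_mul (hφ : IsTestFunction Ω φ) (c : ℝ) : IsTestFunction Ω (fun x => c * φ x) :=
  hφ.comp_left (β := fun t => c * t) (contDiff_const.mul contDiff_id) (mul_zero c)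

theorem zero : IsTestFunction Ω (fun _ => (0 : ℝ)) where
  smooth := contDiff_const
  compact := HasCompactSupport.zero
  supp := by simp [tsupport, Function.support]

theorem sum {ι : Type*} (s : Finset ι) {φ : ι → E N → ℝ} (hφ : ∀ i, IsTestFunction Ω (φ i)) :
    IsTestFunction Ω (fun x => ∑ i ∈ s, φ i x) := by
  classical
  induction s using Finset.induction_on with
  | empty => simpa using zero
  | insert i s hi ih => simpa [Finset.sum_insert hi] using (hφ i).add ih

end IsTestFunction

/-- A smooth approximation of the absolute value that vanishes at `0`. -/
def smoothAbs (ε t : ℝ) : ℝ := √(t ^ 2 + ε ^ 2) - ε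

theorem smoothAbs_zero {ε : ℝ} (hε : 0 < ε) : smoothAbs ε 0 = 0 := by
  simp [smoothAbs, Real.sqrt_sq hε.le]

theorem contDiff_smoothAbs {ε : ℝ} (hε : 0 < ε) : ContDiff ℝ ∞ (smoothAbs ε) := by
  unfold smoothAbs
  refine ContDiff.sub (ContDiff.sqrt (by fun_prop) fun t => ?_) contDiff_const
  positivity

theorem smoothAbs_nonneg (ε t : ℝ) : 0 ≤ smoothAbs ε t := by
  have : ε ≤ √(t ^ 2 + ε ^ 2) := Real.le_sqrt_of_sq_le (by nlinarith [sq_nonneg t])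
  unfold smoothAbs; linarith

theorem abs_smoothAbs_sub_le {ε : ℝ} (hε : 0 < ε) (t : ℝ) : |smoothAbs ε t - (|t|)| ≤ ε := by
  have h1 : |t| ≤ √(t ^ 2 + ε ^ 2) :=
    Real.le_sqrt_of_sq_le (by rw [sq_abs]; nlinarith [sq_nonneg ε])
  have h2 : √(t ^ 2 + ε ^ 2) ≤ |t| + ε :=
    Real.sqrt_le_iff.2 ⟨by positivity, by nlinarith [sq_abs t, abs_nonneg t]⟩
  unfold smoothAbs
  rw [abs_le]; constructor <;> linarith

theorem hasDerivAt_smoothAbs {ε : ℝ} (hε : 0 < ε) (t : ℝ) :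
    HasDerivAt (smoothAbs ε) (t / √(t ^ 2 + ε ^ 2)) t := by
  have h : HasDerivAt (fun t : ℝ => t ^ 2 + ε ^ 2) (2 * t) t := by
    simpa using (hasDerivAt_pow 2 t).add_const (ε ^ 2)
  convert! (h.sqrt (by positivity)).sub_const ε using 1
  ring

theorem abs_div_sqrt_le_one (ε t : ℝ) : |t / √(t ^ 2 + ε ^ 2)| ≤ 1 := by
  have h1 : |t| ≤ √(t ^ 2 + ε ^ 2) :=
    Real.le_sqrt_of_sq_le (by rw [sq_abs]; nlinarith [sq_nonneg ε])
  rw [abs_div, abs_of_nonneg (Real.sqrt_nonneg _)]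
  exact div_le_one_of_le₀ h1 (Real.sqrt_nonneg _)

/-! ### Smooth absolute values and positive parts of test functions. -/

namespace IsTestFunction

variable {φ : E N → ℝ}

theorem smoothAbs (hφ : IsTestFunction Ω φ) {ε : ℝ} (hε : 0 < ε) :
    IsTestFunction Ω (fun x => smoothAbs ε (φ x)) :=
  hφ.comp_left (contDiff_smoothAbs hε) (smoothAbs_zero hε)

/-- `smoothAbs` is 1-Lipschitz, so it does not increase the energy and stays within the test
functions. This replaces the chain rule for |u| and u⁺ in Sobolev spaces. -/
theorem norm_gradient_smoothAbs_le (hφ : IsTestFunction Ω φ) {ε : ℝ} (hε : 0 < ε) (x : E N) :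
    ‖gradient (fun x => PLaplace.smoothAbs ε (φ x)) x‖ ≤ ‖gradient φ x‖ := by
  have h := (hasDerivAt_smoothAbs hε (φ x)).comp_hasFDerivAt x (hφ.differentiableAt x).hasFDerivAt
  have h' : fderiv ℝ (fun x => PLaplace.smoothAbs ε (φ x)) x = _ := h.fderiv
  rw [norm_gradient, norm_gradient, h', norm_smul, Real.norm_eq_abs]
  exact mul_le_of_le_one_left (norm_nonneg _) (abs_div_sqrt_le_one _ _)

/-- A smooth approximation of the positive part. -/
theorem smoothPosPart (hφ : IsTestFunction Ω φ) {ε : ℝ} (hε : 0 < ε) :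
    IsTestFunction Ω (fun x => (1 / 2) * (PLaplace.smoothAbs ε (φ x) + φ x)) :=
  ((hφ.smoothAbs hε).add hφ).const_mul _

theorem norm_gradient_smoothPosPart_le (hφ : IsTestFunction Ω φ) {ε : ℝ} (hε : 0 < ε)
    (x : E N) :
    ‖gradient (fun x => (1 / 2) * (PLaplace.smoothAbs ε (φ x) + φ x)) x‖ ≤ ‖gradient φ x‖ := by
  have h := hφ.smoothAbs hε
  rw [gradient_const_mul ((h.add hφ).differentiableAt x),
    gradient_add (h.differentiableAt x) (hφ.differentiableAt x), norm_smul]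
  have h1 := norm_add_le (gradient (fun x => PLaplace.smoothAbs ε (φ x)) x) (gradient φ x)
  have h2 := hφ.norm_gradient_smoothAbs_le hε x
  norm_num
  linarith

end IsTestFunction

theorem abs_smoothPosPart_sub_le {ε : ℝ} (hε : 0 < ε) (t : ℝ) :
    |(1 / 2) * (smoothAbs ε t + t) - max t 0| ≤ ε := by
  have h := abs_smoothAbs_sub_le hε t
  rw [abs_le] at h ⊢
  rcases le_total t 0 with ht | ht
  · rw [max_eq_right ht]
    rw [abs_of_nonpos ht] at h
    constructor <;> linarith
  · rw [max_eq_left ht]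
    rw [abs_of_nonneg ht] at h
    constructor <;> linarith

/-! ### `L^p` norms as integrals -/

section Lp

variable {α F : Type*} [MeasurableSpace α] {μ : Measure α} [NormedAddCommGroup F]

theorem integrable_norm_rpow_of_memLp {p : ℝ} (hp : 0 < p) {g : α → F}
    (hg : MemLp g (ENNReal.ofReal p) μ) : Integrable (fun x => ‖g x‖ ^ p) μ := by
  have := hg.integrable_norm_rpow (by simpa using hp) ENNReal.ofReal_ne_top
  rwa [ENNReal.toReal_ofReal hp.le] at this

theorem eLpNorm_eq_ofReal_integral {p : ℝ} (hp : 0 < p) {g : α → F}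
    (hg : MemLp g (ENNReal.ofReal p) μ) :
    eLpNorm g (ENNReal.ofReal p) μ = ENNReal.ofReal ((∫ x, ‖g x‖ ^ p ∂μ) ^ p⁻¹) := by
  have := hg.eLpNorm_eq_integral_rpow_norm (by simpa using hp) ENNReal.ofReal_ne_top
  rwa [ENNReal.toReal_ofReal hp.le] at this

theorem tendsto_eLpNorm_zero_iff {ι : Type*} {l : Filter ι} {p : ℝ} (hp : 0 < p) {g : ι → α → F}
    (hg : ∀ i, MemLp (g i) (ENNReal.ofReal p) μ) :
    Tendsto (fun i => eLpNorm (g i) (ENNReal.ofReal p) μ) l (𝓝 0) ↔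
      Tendsto (fun i => ∫ x, ‖g i x‖ ^ p ∂μ) l (𝓝 0) := by
  have h0 : ∀ i, 0 ≤ ∫ x, ‖g i x‖ ^ p ∂μ := fun i => integral_nonneg fun x => by positivity
  simp only [eLpNorm_eq_ofReal_integral hp (hg _)]
  constructor
  · intro h
    have h1 := (ENNReal.tendsto_toReal ENNReal.zero_ne_top).comp h
    have h2 : Tendsto (fun i => (∫ x, ‖g i x‖ ^ p ∂μ) ^ p⁻¹) l (𝓝 0) := by
      refine (h1.congr fun i => ?_)
      simp only [Function.comp_apply]
      rw [ENNReal.toReal_ofReal (Real.rpow_nonneg (h0 i) _)]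
    have h3 := h2.rpow_const (p := p) (Or.inr hp.le)
    rw [Real.zero_rpow hp.ne'] at h3
    exact h3.congr fun i => Real.rpow_inv_rpow (h0 i) hp.ne'
  · intro h
    have h3 := h.rpow_const (p := p⁻¹) (Or.inr (inv_nonneg.2 hp.le))
    rw [Real.zero_rpow (inv_ne_zero hp.ne')] at h3
    simpa [Function.comp_def] using (ENNReal.continuous_ofReal.tendsto 0).comp h3

end Lp

/-! ### Sobolev's inequality -/

theorem pStar_pos {p : ℝ} (hp : 1 < p) (hpN : p < N) : 0 < pStar N p :=
  div_pos (mul_pos (by linarith) (by linarith)) (by linarith)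

theorem lt_pStar {p : ℝ} (hp : 1 < p) (hpN : p < N) : p < pStar N p := by
  rw [pStar, lt_div_iff₀ (by linarith)]
  nlinarith

theorem inv_pStar {p : ℝ} (hp : 1 < p) (hpN : p < N) : (pStar N p)⁻¹ = p⁻¹ - (N : ℝ)⁻¹ := by
  have h1 : (N : ℝ) ≠ 0 := by linarith
  have h2 : p ≠ 0 := by linarith
  have h3 : (N : ℝ) - p ≠ 0 := by linarith
  rw [pStar]
  field_simp

/-- The Gagliardo-Nirenberg-Sobolev inequality raised to the power p*. The constant does not depend
on Ω because test functions vanish outside Ω and can be integrated over the whole space. -/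
theorem exists_sobolev_const {p : ℝ} (hp : 1 < p) (hpN : p < N) :
    ∃ C : ℝ, 0 < C ∧ ∀ (Ω : Set (E N)) (φ : E N → ℝ), IsTestFunction Ω φ →
      ∫ x in Ω, |φ x| ^ pStar N p ≤ C * (∫ x in Ω, ‖gradient φ x‖ ^ p) ^ (pStar N p / p) := by
  have hp0 : 0 < p := by linarith
  have hq0 := pStar_pos hp hpN
  obtain ⟨K, hK⟩ : ∃ K : NNReal, ∀ φ : E N → ℝ, ContDiff ℝ 1 φ → HasCompactSupport φ →
      eLpNorm φ (ENNReal.ofReal (pStar N p)) volume ≤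
        K * eLpNorm (fderiv ℝ φ) (ENNReal.ofReal p) volume := by
    refine ⟨SNormLESNormFDerivOfEqConst ℝ (volume : Measure (E N)) p.toNNReal, fun φ h1 h2 => ?_⟩
    have hfr : Module.finrank ℝ (E N) = N := finrank_euclideanSpace_fin
    refine eLpNorm_le_eLpNorm_fderiv_of_eq volume h1 h2 (p := p.toNNReal)
      (p' := (pStar N p).toNNReal) ?_ ?_ ?_
    · exact Real.one_le_toNNReal.2 hp.le
    · rw [hfr]
      have : (0 : ℝ) < N := by linarith
      exact_mod_cast this
    · rw [hfr, NNReal.coe_inv, Real.coe_toNNReal _ hq0.le, Real.coe_toNNReal _ hp0.le]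
      exact inv_pStar hp hpN
  -- `K + 1` instead of `K` makes the constant strictly positive.
  refine ⟨(K + 1 : ℝ) ^ pStar N p, by positivity, fun Ω φ hφ => ?_⟩
  have e1 : ∫ x in Ω, |φ x| ^ pStar N p = ∫ x, ‖φ x‖ ^ pStar N p :=
    setIntegral_eq_integral_of_forall_compl_eq_zero fun x hx => by
      rw [hφ.eq_zero_of_notMem hx, abs_zero, Real.zero_rpow hq0.ne']
  have e2 : ∫ x in Ω, ‖gradient φ x‖ ^ p = ∫ x, ‖gradient φ x‖ ^ p :=
    setIntegral_eq_integral_of_forall_compl_eq_zero fun x hx => by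
      rw [hφ.gradient_eq_zero hx, norm_zero, Real.zero_rpow hp0.ne']
  have h := hK φ (hφ.smooth.of_le (by simp)) hφ.compact
  have e3 : eLpNorm (fderiv ℝ φ) (ENNReal.ofReal p) volume
      = eLpNorm (gradient φ) (ENNReal.ofReal p) volume :=
    eLpNorm_congr_norm_ae (ae_of_all _ fun x => (norm_gradient φ x).symm)
  rw [e3, eLpNorm_eq_ofReal_integral hq0 (hφ.continuous.memLp_of_hasCompactSupport hφ.compact),
    eLpNorm_eq_ofReal_integral hp0
      (hφ.continuous_gradient.memLp_of_hasCompactSupport hφ.hasCompactSupport_gradient),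
    ← ENNReal.ofReal_coe_nnreal, ← ENNReal.ofReal_mul K.coe_nonneg] at h
  have i1 : 0 ≤ ∫ x, ‖φ x‖ ^ pStar N p := integral_nonneg fun x => by positivity
  have i2 : 0 ≤ ∫ x, ‖gradient φ x‖ ^ p := integral_nonneg fun x => by positivity
  have h' := (ENNReal.ofReal_le_ofReal_iff (by positivity)).1 h
  rw [e1, e2]
  calc ∫ x, ‖φ x‖ ^ pStar N p = ((∫ x, ‖φ x‖ ^ pStar N p) ^ (pStar N p)⁻¹) ^ pStar N p :=
        (Real.rpow_inv_rpow i1 hq0.ne').symm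
    _ ≤ ((K + 1 : ℝ) * (∫ x, ‖gradient φ x‖ ^ p) ^ p⁻¹) ^ pStar N p := by
        refine Real.rpow_le_rpow (by positivity) (h'.trans ?_) hq0.le
        gcongr
        linarith
    _ = _ := by
        rw [Real.mul_rpow (by positivity) (by positivity), ← Real.rpow_mul i2]
        congr 2
        field_simp

/-! ### Compactness of bounded sequences of test functions -/

/-- Integrate the derivative along the segment from x to x − y, exchange the integrals, and use
translation invariance. -/
theorem lintegral_translate_sub_le {φ : E N → ℝ} (hφ : IsTestFunction Ω φ) (y : E N) :
    ∫⁻ x, ‖φ (x - y) - φ x‖ₑ ≤ ‖y‖ₑ * ∫⁻ x, ‖gradient φ x‖ₑ := by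
  have hc : Continuous fun q : E N × ℝ => fderiv ℝ φ (q.1 - q.2 • y) :=
    (hφ.smooth.continuous_fderiv (by simp)).comp (by fun_prop)
  have key : ∀ x, ‖φ (x - y) - φ x‖ₑ ≤
      ∫⁻ s in Ioc (0 : ℝ) 1, ‖gradient φ (x - s • y)‖ₑ * ‖y‖ₑ := by
    intro x
    have hd : ∀ s ∈ uIcc (0 : ℝ) 1, HasDerivAt (fun s : ℝ => φ (x - s • y))
        (fderiv ℝ φ (x - s • y) (-y)) s := by
      intro s _
      have h1 : HasDerivAt (fun s : ℝ => x - s • y) (-y) s := by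
        simpa using ((hasDerivAt_id s).smul_const y).const_sub x
      exact (hφ.differentiableAt _).hasFDerivAt.comp_hasDerivAt s h1
    have hcx : Continuous fun s : ℝ => fderiv ℝ φ (x - s • y) (-y) :=
      (hc.comp (by fun_prop : Continuous fun s : ℝ => (x, s))).clm_apply continuous_const
    have h2 := intervalIntegral.integral_eq_sub_of_hasDerivAt hd (hcx.intervalIntegrable 0 1)
    simp only [one_smul, zero_smul, sub_zero] at h2
    rw [← h2, intervalIntegral.integral_of_le zero_le_one]
    refine (enorm_integral_le_lintegral_enorm _).trans (lintegral_mono fun s => ?_)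
    rw [← ofReal_norm, ← ofReal_norm, ← ofReal_norm, ← ENNReal.ofReal_mul (norm_nonneg _)]
    refine ENNReal.ofReal_le_ofReal ?_
    rw [norm_gradient]
    exact ((fderiv ℝ φ (x - s • y)).le_opNorm (-y)).trans_eq (by rw [norm_neg])
  have hm : Continuous fun q : E N × ℝ => gradient φ (q.1 - q.2 • y) :=
    hφ.continuous_gradient.comp (by fun_prop)
  calc ∫⁻ x, ‖φ (x - y) - φ x‖ₑ
      ≤ ∫⁻ x, ∫⁻ s in Ioc (0 : ℝ) 1, ‖gradient φ (x - s • y)‖ₑ * ‖y‖ₑ := lintegral_mono key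
    _ = ∫⁻ s in Ioc (0 : ℝ) 1, ∫⁻ x, ‖gradient φ (x - s • y)‖ₑ * ‖y‖ₑ := by
        rw [lintegral_lintegral_swap]
        exact (hm.enorm.measurable.mul_const _).aemeasurable
    _ = ∫⁻ s in Ioc (0 : ℝ) 1, ‖y‖ₑ * ∫⁻ x, ‖gradient φ x‖ₑ := by
        refine lintegral_congr fun s => ?_
        have hc' : Continuous fun x => gradient φ (x - s • y) :=
          hφ.continuous_gradient.comp (by fun_prop)
        rw [lintegral_mul_const _ hc'.enorm.measurable,
          lintegral_sub_right_eq_self (fun x => ‖gradient φ x‖ₑ) (s • y), mul_comm]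
    _ = _ := by simp

/-- A mollification averages translates by vectors of length at most δ. The rate depends on φ only
through the L¹ norm of its gradient, which is the source of compactness in Rellich's theorem. -/
theorem lintegral_mollify_sub_le {φ : E N → ℝ} (hφ : IsTestFunction Ω φ) {ρ : E N → ℝ}
    (hρ : Continuous ρ) (hρc : HasCompactSupport ρ) (hρ0 : ∀ y, 0 ≤ ρ y) (hρ1 : ∫ y, ρ y = 1)
    {δ : ℝ} (hρδ : ∀ y, ρ y ≠ 0 → ‖y‖ ≤ δ) :
    ∫⁻ x, ‖(∫ y, φ y * ρ (x - y)) - φ x‖ₑ ≤ ENNReal.ofReal δ * ∫⁻ x, ‖gradient φ x‖ₑ := by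
  have hρi : Integrable ρ := hρ.integrable_of_hasCompactSupport hρc
  have key : ∀ x, ‖(∫ y, φ y * ρ (x - y)) - φ x‖ₑ ≤ ∫⁻ y, ‖φ (x - y) - φ x‖ₑ * ‖ρ y‖ₑ := by
    intro x
    have e1 : ∫ y, φ y * ρ (x - y) = ∫ y, φ (x - y) * ρ y := by
      rw [← integral_sub_left_eq_self (fun y => φ (x - y) * ρ y) volume x]
      simp
    have e2 : φ x = ∫ y, φ x * ρ y := by rw [integral_const_mul, hρ1, mul_one]
    have hi : Integrable fun y => φ (x - y) * ρ y :=
      Continuous.integrable_of_hasCompactSupport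
        ((hφ.continuous.comp (by fun_prop)).mul hρ) hρc.mul_left
    rw [e1]
    conv_lhs => rw [e2]
    rw [← integral_sub hi (hρi.const_mul _)]
    refine (enorm_integral_le_lintegral_enorm _).trans_eq (lintegral_congr fun y => ?_)
    rw [← sub_mul, enorm_mul]
  have hm1 : Continuous fun q : E N × E N => φ (q.1 - q.2) - φ q.1 :=
    (hφ.continuous.comp (by fun_prop)).sub (hφ.continuous.comp continuous_fst)
  have hm2 : Continuous fun q : E N × E N => ρ q.2 := hρ.comp continuous_snd
  calc ∫⁻ x, ‖(∫ y, φ y * ρ (x - y)) - φ x‖ₑ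
      ≤ ∫⁻ x, ∫⁻ y, ‖φ (x - y) - φ x‖ₑ * ‖ρ y‖ₑ := lintegral_mono key
    _ = ∫⁻ y, ∫⁻ x, ‖φ (x - y) - φ x‖ₑ * ‖ρ y‖ₑ := by
        rw [lintegral_lintegral_swap]
        exact (hm1.enorm.measurable.mul hm2.enorm.measurable).aemeasurable
    _ ≤ ∫⁻ y, (ENNReal.ofReal δ * ∫⁻ x, ‖gradient φ x‖ₑ) * ‖ρ y‖ₑ := by
        refine lintegral_mono fun y => ?_
        have hc' : Continuous fun x => φ (x - y) - φ x :=
          (hφ.continuous.comp (by fun_prop)).sub hφ.continuous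
        simp only
        rw [lintegral_mul_const _ hc'.enorm.measurable]
        by_cases hy : ρ y = 0
        · simp [hy]
        · gcongr
          refine (lintegral_translate_sub_le hφ y).trans ?_
          gcongr
          rw [← ofReal_norm]
          exact ENNReal.ofReal_le_ofReal (hρδ y hy)
    _ = _ := by
        rw [lintegral_const_mul _ hρ.enorm.measurable,
          ← ofReal_integral_norm_eq_lintegral_enorm hρi]
        simp only [Real.norm_eq_abs, abs_of_nonneg (hρ0 _), hρ1, ENNReal.ofReal_one, mul_one]

/-- A sequence of mollifiers. -/
theorem exists_mollifier (N : ℕ) : ∃ ρ : ℕ → E N → ℝ, ∀ j, Continuous (ρ j) ∧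
    HasCompactSupport (ρ j) ∧ (∀ y, 0 ≤ ρ j y) ∧ ∫ y, ρ j y = 1 ∧
    (∀ y, ρ j y ≠ 0 → ‖y‖ ≤ 1 / (j + 1 : ℝ)) ∧ ∃ K : NNReal, LipschitzWith K (ρ j) := by
  let b : ∀ j : ℕ, ContDiffBump (0 : E N) := fun j =>
    ⟨1 / (2 * (j + 1 : ℝ)), 1 / (j + 1 : ℝ), by positivity, by
      gcongr
      have : (0 : ℝ) ≤ j := by positivity
      linarith⟩
  refine ⟨fun j => (b j).normed volume, fun j => ⟨(b j).continuous_normed,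
    (b j).hasCompactSupport_normed, (b j).nonneg_normed, (b j).integral_normed, fun y hy => ?_, ?_⟩⟩
  · have h : y ∈ Function.support ((b j).normed volume) := hy
    rw [(b j).support_normed_eq, mem_ball_zero_iff] at h
    exact h.le
  · exact ContDiff.lipschitzWith_of_hasCompactSupport (𝕂 := ℝ) (n := 1)
      (b j).hasCompactSupport_normed ((b j).contDiff_normed (n := 1)) one_ne_zero

/-- A diagonal Arzelà-Ascoli argument for countably many families at once: compactness of a
countable product of intervals gives one subsequence converging at all points of a dense sequence,
and the Lipschitz bounds carry the Cauchy property to every point. -/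
theorem exists_subseq_tendsto_of_equilipschitz {m : ℕ → ℕ → E N → ℝ} {A L : ℕ → ℝ}
    (hA : ∀ j n x, |m j n x| ≤ A j) (hL : ∀ j n x y, |m j n x - m j n y| ≤ L j * ‖x - y‖) :
    ∃ σ : ℕ → ℕ, StrictMono σ ∧
      ∀ j x, ∃ a, Tendsto (fun n => m j (σ n) x) atTop (𝓝 a) := by
  let q := TopologicalSpace.denseSeq (E N)
  have hK : IsCompact (Set.pi univ fun k : ℕ × ℕ => Icc (-A k.1) (A k.1)) :=
    isCompact_univ_pi fun k => isCompact_Icc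
  obtain ⟨a, -, σ, hσ, hlim⟩ := hK.tendsto_subseq (x := fun n k => m k.1 n (q k.2))
    fun n k _ => abs_le.1 (hA k.1 n _)
  rw [tendsto_pi_nhds] at hlim
  refine ⟨σ, hσ, fun j x => cauchySeq_tendsto_of_complete (Metric.cauchySeq_iff.2 fun ε hε => ?_)⟩
  have hL0 : 0 < |L j| + 1 := by positivity
  obtain ⟨i, hi⟩ := (TopologicalSpace.denseRange_denseSeq (E N)).exists_dist_lt x
    (show 0 < ε / 4 / (|L j| + 1) by positivity)
  have hclose : ∀ n, |m j n x - m j n (q i)| ≤ ε / 4 := by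
    intro n
    refine (hL j n x (q i)).trans ?_
    rw [dist_eq_norm, lt_div_iff₀ hL0] at hi
    have := le_abs_self (L j)
    nlinarith [norm_nonneg (x - q i)]
  obtain ⟨n₀, hn₀⟩ := Metric.cauchySeq_iff.1 (hlim (j, i)).cauchySeq (ε / 2) (by positivity)
  refine ⟨n₀, fun n hn k hk => ?_⟩
  have h1 := hn₀ n hn k hk
  have h2 := hclose (σ n)
  have h3 := hclose (σ k)
  simp only [Function.comp_apply, Real.dist_eq] at h1 ⊢
  rw [abs_le] at h2 h3
  rw [abs_lt] at h1 ⊢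
  constructor <;> linarith

theorem cauchySeq_integral_abs_sub {α : Type*} [MeasurableSpace α] {μ : Measure α}
    [IsFiniteMeasure μ] {g : ℕ → α → ℝ} {A : ℝ} (hg : ∀ n, AEStronglyMeasurable (g n) μ)
    (hA : ∀ n x, |g n x| ≤ A) (hlim : ∀ x, ∃ a, Tendsto (fun n => g n x) atTop (𝓝 a))
    {ε : ℝ} (hε : 0 < ε) :
    ∃ n₀, ∀ n ≥ n₀, ∀ k ≥ n₀, ∫ x, |g n x - g k x| ∂μ ≤ ε := by
  choose G hG using hlim
  have hGA : ∀ x, |G x| ≤ A := fun x =>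
    le_of_tendsto (hG x).abs (Eventually.of_forall fun n => hA n x)
  have hGm : AEStronglyMeasurable G μ :=
    aestronglyMeasurable_of_tendsto_ae atTop hg (ae_of_all _ hG)
  have h1 : Tendsto (fun n => ∫ x, |g n x - G x| ∂μ) atTop (𝓝 (∫ _, 0 ∂μ)) := by
    refine tendsto_integral_of_dominated_convergence (fun _ => A + A)
      (fun n => ((hg n).sub hGm).norm) (integrable_const _) (fun n => ae_of_all _ fun x => ?_)
      (ae_of_all _ fun x => ?_)
    · rw [Real.norm_eq_abs, abs_abs]
      exact (abs_sub _ _).trans (add_le_add (hA n x) (hGA x))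
    · simpa using ((hG x).sub_const (G x)).abs
  rw [integral_zero] at h1
  obtain ⟨n₀, hn₀⟩ := eventually_atTop.1 (h1.eventually (gt_mem_nhds (half_pos hε)))
  have hint : ∀ n, Integrable (fun x => |g n x - G x|) μ := fun n =>
    Integrable.of_bound ((hg n).sub hGm).norm (A + A) (ae_of_all _ fun x => by
      rw [Real.norm_eq_abs, abs_abs]
      exact (abs_sub _ _).trans (add_le_add (hA n x) (hGA x)))
  refine ⟨n₀, fun n hn k hk => ?_⟩
  calc ∫ x, |g n x - g k x| ∂μ ≤ ∫ x, (|g n x - G x| + |g k x - G x|) ∂μ := by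
        refine integral_mono_of_nonneg (ae_of_all _ fun x => abs_nonneg _)
          ((hint n).add (hint k)) (ae_of_all _ fun x => ?_)
        simp only
        rw [abs_sub_comm (g k x)]
        exact abs_sub_le _ _ _
    _ = (∫ x, |g n x - G x| ∂μ) + ∫ x, |g k x - G x| ∂μ := integral_add (hint n) (hint k)
    _ ≤ ε := by linarith [hn₀ n hn, hn₀ k hk]

/-- **Rellich's theorem**: a sequence of test functions bounded in `W^{1,1}` has a subsequence
that converges almost everywhere. -/
theorem exists_subseq_tendsto_ae (hΩ : Bornology.IsBounded Ω) {φ : ℕ → E N → ℝ}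
    (hφ : ∀ n, IsTestFunction Ω (φ n)) {A B : ℝ} (hA : ∀ n, ∫ x in Ω, |φ n x| ≤ A)
    (hB : ∀ n, ∫ x in Ω, ‖gradient (φ n) x‖ ≤ B) :
    ∃ σ : ℕ → ℕ, StrictMono σ ∧ ∃ u : E N → ℝ, AEStronglyMeasurable u (volume.restrict Ω) ∧
      ∀ᵐ x ∂(volume.restrict Ω), Tendsto (fun n => φ (σ n) x) atTop (𝓝 (u x)) := by
  have : IsFiniteMeasure (volume.restrict Ω) :=
    ⟨by rw [Measure.restrict_apply_univ]; exact hΩ.measure_lt_top⟩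
  have hA' : ∀ n, ∫ x, |φ n x| ≤ A := fun n => by
    rw [← setIntegral_eq_integral_of_forall_compl_eq_zero (s := Ω)]
    · exact hA n
    · intro x hx; rw [(hφ n).eq_zero_of_notMem hx, abs_zero]
  have hB' : ∀ n, ∫ x, ‖gradient (φ n) x‖ ≤ B := fun n => by
    rw [← setIntegral_eq_integral_of_forall_compl_eq_zero (s := Ω)]
    · exact hB n
    · intro x hx; rw [(hφ n).gradient_eq_zero hx, norm_zero]
  have hi : ∀ n, Integrable (φ n) := fun n =>
    (hφ n).continuous.integrable_of_hasCompactSupport (hφ n).compact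
  have hB0 : 0 ≤ B := (integral_nonneg fun x => norm_nonneg _).trans (hB' 0)
  obtain ⟨ρ, hρ⟩ := exists_mollifier N
  choose hρc hρs hρ0 hρ1 hρδ K hK using hρ
  choose M hM using fun j => (hρs j).exists_bound_of_continuous (hρc j)
  let m : ℕ → ℕ → E N → ℝ := fun j n x => ∫ y, φ n y * ρ j (x - y)
  have hmi : ∀ j n x, Integrable fun y => φ n y * ρ j (x - y) := fun j n x =>
    ((hφ n).continuous.mul ((hρc j).comp (by fun_prop))).integrable_of_hasCompactSupport
      (hφ n).compact.mul_right
  have hmA : ∀ j n x, |m j n x| ≤ A * M j := by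
    intro j n x
    have hM0 : 0 ≤ M j := (norm_nonneg _).trans (hM j 0)
    calc |m j n x| ≤ ∫ y, |φ n y| * M j := by
          refine (abs_integral_le_integral_abs).trans (integral_mono_of_nonneg
            (ae_of_all _ fun y => abs_nonneg _) ((hi n).abs.mul_const _) (ae_of_all _ fun y => ?_))
          simp only [abs_mul]
          gcongr
          exact hM j _
      _ ≤ A * M j := by
          rw [integral_mul_const]
          gcongr
          exact hA' n
  have hmL : ∀ j n x y, |m j n x - m j n y| ≤ (A * K j) * ‖x - y‖ := by
    intro j n x y
    calc |m j n x - m j n y| = |∫ z, (φ n z * ρ j (x - z) - φ n z * ρ j (y - z))| := by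
          rw [integral_sub (hmi j n x) (hmi j n y)]
      _ ≤ ∫ z, |φ n z| * (K j * ‖x - y‖) := by
          refine (abs_integral_le_integral_abs).trans (integral_mono_of_nonneg
            (ae_of_all _ fun y => abs_nonneg _) ((hi n).abs.mul_const _) (ae_of_all _ fun z => ?_))
          simp only [← mul_sub, abs_mul]
          gcongr
          have := (hK j).dist_le_mul (x - z) (y - z)
          rwa [Real.dist_eq, dist_eq_norm, sub_sub_sub_cancel_right] at this
      _ ≤ _ := by
          rw [integral_mul_const, mul_assoc]
          gcongr
          exact hA' n
  have hmc : ∀ j n, Continuous (m j n) := fun j n =>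
    (LipschitzWith.of_dist_le' fun x y => by
      rw [Real.dist_eq, dist_eq_norm]; exact hmL j n x y).continuous
  have hmint : ∀ j n, Integrable (m j n) (volume.restrict Ω) := fun j n =>
    Integrable.of_bound (hmc j n).aestronglyMeasurable _ (ae_of_all _ (hmA j n))
  have hclose : ∀ j n, ∫ x in Ω, |m j n x - φ n x| ≤ 1 / (j + 1 : ℝ) * B := by
    intro j n
    have h1 : ENNReal.ofReal (∫ x in Ω, |m j n x - φ n x|) ≤
        ENNReal.ofReal (1 / (j + 1 : ℝ) * B) := by
      have e := ofReal_integral_norm_eq_lintegral_enorm ((hmint j n).sub (hi n).restrict)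
      simp only [Real.norm_eq_abs, Pi.sub_apply] at e
      rw [e]
      refine (setLIntegral_le_lintegral _ _).trans ((lintegral_mollify_sub_le (hφ n) (hρc j)
        (hρs j) (hρ0 j) (hρ1 j) (hρδ j)).trans ?_)
      rw [← ofReal_integral_norm_eq_lintegral_enorm
        ((hφ n).continuous_gradient.integrable_of_hasCompactSupport
          (hφ n).hasCompactSupport_gradient), ← ENNReal.ofReal_mul (by positivity)]
      refine ENNReal.ofReal_le_ofReal ?_
      gcongr
      exact hB' n
    exact (ENNReal.ofReal_le_ofReal_iff (by positivity)).1 h1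
  obtain ⟨σ, hσ, hlim⟩ := exists_subseq_tendsto_of_equilipschitz hmA hmL
  -- Compare φ_n and φ_k through their mollifications. The scale `j` is fixed first, making both
  -- mollification errors at most ε/4 for all indices; at that scale the subsequence is already
  -- Cauchy in L¹.
  have hcau : CauchySeq fun n => ((hi (σ n)).restrict (s := Ω)).toL1 (φ (σ n)) := by
    refine Metric.cauchySeq_iff.2 fun ε hε => ?_
    obtain ⟨j, hj⟩ := exists_nat_one_div_lt (show 0 < ε / 4 / (B + 1) by positivity)
    have hjB : 1 / (j + 1 : ℝ) * B ≤ ε / 4 := by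
      rw [lt_div_iff₀ (by positivity)] at hj
      have : 0 ≤ 1 / (j + 1 : ℝ) := by positivity
      nlinarith
    obtain ⟨n₀, hn₀⟩ := cauchySeq_integral_abs_sub (μ := volume.restrict Ω)
      (g := fun n => m j (σ n)) (fun n => (hmc j _).aestronglyMeasurable) (fun n x => hmA j _ x)
      (hlim j) (show 0 < ε / 4 by positivity)
    refine ⟨n₀, fun n hn k hk => ?_⟩
    rw [dist_eq_norm, ← Integrable.toL1_sub, L1.norm_of_fun_eq_integral_norm]
    have i1 := ((hmint j (σ n)).sub (hi (σ n)).restrict).abs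
    have i2 := ((hmint j (σ k)).sub (hi (σ k)).restrict).abs
    have i3 := ((hmint j (σ n)).sub (hmint j (σ k))).abs
    simp only [Pi.sub_apply] at i1 i2 i3
    calc ∫ x in Ω, ‖(φ (σ n) - φ (σ k)) x‖
        ≤ ∫ x in Ω, (|m j (σ n) x - φ (σ n) x| + |m j (σ k) x - φ (σ k) x| +
            |m j (σ n) x - m j (σ k) x|) := by
          refine integral_mono_of_nonneg (ae_of_all _ fun x => norm_nonneg _)
            ((i1.add i2).add i3) (ae_of_all _ fun x => ?_)
          simp only [Pi.sub_apply, Real.norm_eq_abs]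
          rw [abs_sub_comm (m j (σ n) x) (φ (σ n) x)]
          calc |φ (σ n) x - φ (σ k) x| = |(φ (σ n) x - m j (σ n) x) +
                (m j (σ k) x - φ (σ k) x) + (m j (σ n) x - m j (σ k) x)| := by congr 1; ring
            _ ≤ _ := abs_add_three _ _ _
      _ = (∫ x in Ω, |m j (σ n) x - φ (σ n) x|) + (∫ x in Ω, |m j (σ k) x - φ (σ k) x|) +
            ∫ x in Ω, |m j (σ n) x - m j (σ k) x| := by
          have e := integral_add (i1.add i2) i3
          simp only [Pi.add_apply] at e
          rw [e, integral_add i1 i2]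
      _ < ε := by linarith [hclose j (σ n), hclose j (σ k), hn₀ n hn k hk]
  obtain ⟨U, hU⟩ := cauchySeq_tendsto_of_complete hcau
  obtain ⟨τ, hτ, hae⟩ := (tendstoInMeasure_of_tendsto_Lp hU).exists_seq_tendsto_ae
  refine ⟨σ ∘ τ, hσ.comp hτ, U, (Lp.aestronglyMeasurable U), ?_⟩
  have hco := ae_all_iff.2 fun n => ((hi (σ n)).restrict (s := Ω)).coeFn_toL1
  filter_upwards [hae, hco] with x hx hx'
  refine hx.congr fun n => ?_
  rw [hx', Function.comp_apply]

/-! ### Uniform convexity of `v ↦ ∫ ‖v‖ ^ p` -/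

section UniformConvexity

theorem norm_sub_rpow_le {V : Type*} [NormedAddCommGroup V] {p : ℝ} (hp : 0 < p) (a b : V) :
    ‖a - b‖ ^ p ≤ 2 ^ p * (‖a‖ ^ p + ‖b‖ ^ p) := by
  have h1 : ‖a - b‖ ≤ 2 * max ‖a‖ ‖b‖ := by
    linarith [norm_sub_le a b, le_max_left ‖a‖ ‖b‖, le_max_right ‖a‖ ‖b‖]
  refine (Real.rpow_le_rpow (norm_nonneg _) h1 hp.le).trans ?_
  rw [Real.mul_rpow (by norm_num) (by positivity)]
  gcongr
  rcases max_cases ‖a‖ ‖b‖ with h | h <;> rw [h.1]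
  · linarith [Real.rpow_nonneg (norm_nonneg b) p]
  · linarith [Real.rpow_nonneg (norm_nonneg a) p]

variable {V : Type*} [NormedAddCommGroup V] [InnerProductSpace ℝ V]

theorem norm_midpoint_rpow_le {p : ℝ} (hp : 1 ≤ p) (a b : V) :
    ‖(1 / 2 : ℝ) • (a + b)‖ ^ p ≤ (‖a‖ ^ p + ‖b‖ ^ p) / 2 := by
  have h := (convexOn_rpow hp).2 (norm_nonneg a) (norm_nonneg b)
    (show (0 : ℝ) ≤ 1 / 2 by norm_num) (show (0 : ℝ) ≤ 1 / 2 by norm_num) (by norm_num)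
  simp only [smul_eq_mul] at h
  refine (Real.rpow_le_rpow (norm_nonneg _) ?_ (by linarith)).trans (h.trans_eq (by ring))
  rw [norm_smul]
  norm_num
  linarith [norm_add_le a b]

/-- If the norms agree, strictness comes from the parallelogram law; otherwise from strict convexity
of t ↦ t^p. -/
theorem norm_midpoint_rpow_lt {p : ℝ} (hp : 1 < p) {a b : V} (hab : a ≠ b) :
    ‖(1 / 2 : ℝ) • (a + b)‖ ^ p < (‖a‖ ^ p + ‖b‖ ^ p) / 2 := by
  have hle : ‖(1 / 2 : ℝ) • (a + b)‖ ≤ 1 / 2 * ‖a‖ + 1 / 2 * ‖b‖ := by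
    rw [norm_smul]
    norm_num
    linarith [norm_add_le a b]
  by_cases h : ‖a‖ = ‖b‖
  · have hpar := parallelogram_law_with_norm ℝ a b
    have hpos : 0 < ‖a - b‖ := norm_pos_iff.2 (sub_ne_zero.2 hab)
    have hlt : ‖(1 / 2 : ℝ) • (a + b)‖ < ‖b‖ := by
      rw [norm_smul]
      norm_num
      rw [h] at hpar
      nlinarith [norm_nonneg (a + b), norm_nonneg b]
    have := Real.rpow_lt_rpow (norm_nonneg _) hlt (by linarith : 0 < p)
    rw [h]
    linarith
  · have h' := (strictConvexOn_rpow hp).2 (norm_nonneg a) (norm_nonneg b) h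
      (show (0 : ℝ) < 1 / 2 by norm_num) (show (0 : ℝ) < 1 / 2 by norm_num) (by norm_num)
    simp only [smul_eq_mul] at h'
    refine (Real.rpow_le_rpow (norm_nonneg _) hle (by linarith)).trans_lt (h'.trans_eq (by ring))

theorem norm_smul_rpow {p : ℝ} {c : ℝ} (hc : 0 ≤ c) (a : V) : ‖c • a‖ ^ p = c ^ p * ‖a‖ ^ p := by
  rw [norm_smul, Real.norm_of_nonneg hc, Real.mul_rpow hc (norm_nonneg a)]

/-- A substitute for Clarkson's inequalities, obtained from compactness. All terms are homogeneous
of degree p, so one may normalize ‖a‖^p + ‖b‖^p = 1; on the compact part where ‖a − b‖^p ≥ ε the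
convexity gap has a positive minimum, and elsewhere the first term suffices. -/
theorem exists_norm_sub_rpow_le [FiniteDimensional ℝ V] {p : ℝ} (hp : 1 < p) {ε : ℝ}
    (hε : 0 < ε) : ∃ C : ℝ, 0 ≤ C ∧ ∀ a b : V, ‖a - b‖ ^ p ≤ ε * (‖a‖ ^ p + ‖b‖ ^ p) +
      C * ((‖a‖ ^ p + ‖b‖ ^ p) / 2 - ‖(1 / 2 : ℝ) • (a + b)‖ ^ p) := by
  have hp0 : 0 < p := by linarith
  let g : V × V → ℝ := fun q => (‖q.1‖ ^ p + ‖q.2‖ ^ p) / 2 - ‖(1 / 2 : ℝ) • (q.1 + q.2)‖ ^ p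
  have hcn : ∀ f : V × V → V, Continuous f → Continuous fun q => ‖f q‖ ^ p := fun f hf =>
    hf.norm.rpow_const fun _ => Or.inr hp0.le
  have hg : Continuous g := (((hcn _ continuous_fst).add (hcn _ continuous_snd)).div_const 2).sub
    (hcn _ (by fun_prop))
  let S : Set (V × V) := {q | ‖q.1‖ ^ p + ‖q.2‖ ^ p = 1 ∧ ε ≤ ‖q.1 - q.2‖ ^ p}
  have hS : IsCompact S := by
    refine Metric.isCompact_of_isClosed_isBounded
      ((isClosed_eq ((hcn _ continuous_fst).add (hcn _ continuous_snd)) continuous_const).inter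
        (isClosed_le continuous_const (hcn _ (by fun_prop)))) ?_
    refine (Metric.isBounded_closedBall (x := (0 : V × V)) (r := 1)).subset fun q hq => ?_
    have h1 := hq.1
    have h2 := Real.rpow_nonneg (norm_nonneg q.1) p
    have h3 := Real.rpow_nonneg (norm_nonneg q.2) p
    rw [mem_closedBall_zero_iff, Prod.norm_def, max_le_iff]
    constructor
    · by_contra h
      linarith [Real.one_lt_rpow (not_le.1 h) hp0]
    · by_contra h
      linarith [Real.one_lt_rpow (not_le.1 h) hp0]
  obtain ⟨δ, hδ, hδS⟩ : ∃ δ > 0, ∀ q ∈ S, δ ≤ g q := by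
    rcases S.eq_empty_or_nonempty with h | h
    · exact ⟨1, one_pos, by simp [h]⟩
    · obtain ⟨q₀, hq₀, hmin⟩ := hS.exists_isMinOn h hg.continuousOn
      refine ⟨g q₀, sub_pos.2 (norm_midpoint_rpow_lt hp fun h => ?_), fun q hq => hmin hq⟩
      have := hq₀.2
      rw [h, sub_self, norm_zero, Real.zero_rpow hp0.ne'] at this
      linarith
  -- Before normalization the gap is at least δ s, where s = ‖a‖^p + ‖b‖^p, while ‖a − b‖^p ≤ 2^p s.
  refine ⟨2 ^ p / δ, by positivity, fun a b => ?_⟩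
  set s := ‖a‖ ^ p + ‖b‖ ^ p with hs
  have hs0 : 0 ≤ s := by positivity
  have hg0 : 0 ≤ s / 2 - ‖(1 / 2 : ℝ) • (a + b)‖ ^ p :=
    sub_nonneg.2 (norm_midpoint_rpow_le hp.le a b)
  by_cases hcase : ‖a - b‖ ^ p ≤ ε * s
  · have : 0 ≤ 2 ^ p / δ * (s / 2 - ‖(1 / 2 : ℝ) • (a + b)‖ ^ p) := by positivity
    linarith
  have hspos : 0 < s := by
    refine hs0.lt_of_ne fun h => hcase ?_
    have := norm_sub_rpow_le hp0 a b
    rw [← hs, ← h] at this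
    rw [← h]
    linarith
  set c := (s⁻¹) ^ p⁻¹ with hc
  have hc0 : 0 ≤ c := by positivity
  have hcp : c ^ p = s⁻¹ := Real.rpow_inv_rpow (by positivity) hp0.ne'
  have hmem : (c • a, c • b) ∈ S := by
    constructor
    · simp only
      rw [norm_smul_rpow hc0, norm_smul_rpow hc0, ← mul_add, ← hs, hcp,
        inv_mul_cancel₀ hspos.ne']
    · simp only
      rw [← smul_sub, norm_smul_rpow hc0, hcp, inv_mul_eq_div, le_div_iff₀ hspos]
      exact (not_le.1 hcase).le
  have h1 := hδS _ hmem
  simp only [g] at h1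
  rw [← smul_add, smul_comm, norm_smul_rpow hc0, norm_smul_rpow hc0, norm_smul_rpow hc0,
    ← mul_add, ← hs, hcp, mul_div_assoc, ← mul_sub, inv_mul_eq_div, le_div_iff₀ hspos] at h1
  have h2 : 2 ^ p * s ≤ 2 ^ p / δ * (s / 2 - ‖(1 / 2 : ℝ) • (a + b)‖ ^ p) := by
    rw [div_mul_eq_mul_div, le_div_iff₀ hδ]
    nlinarith [Real.rpow_pos_of_pos (show (0 : ℝ) < 2 by norm_num) p]
  have h3 := norm_sub_rpow_le hp0 a b
  have : 0 ≤ ε * s := by positivity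
  linarith

end UniformConvexity

/-! ### Membership in `W_0^{1,p}` -/

theorem IsTestFunction.integral_smul_gradient {φ ψ : E N → ℝ} (hφ : IsTestFunction Ω φ)
    (hψ : IsTestFunction Ω ψ) :
    ∫ x in Ω, φ x • gradient ψ x = - ∫ x in Ω, ψ x • gradient φ x := by
  have hi : ∀ {φ ψ : E N → ℝ}, IsTestFunction Ω φ → IsTestFunction Ω ψ →
      Integrable fun x => φ x • gradient ψ x := fun {φ ψ} h1 h2 =>
    (h1.continuous.smul h2.continuous_gradient).integrable_of_hasCompactSupport
      h1.compact.smul_right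
  rw [setIntegral_eq_integral_of_forall_compl_eq_zero fun x hx => by
      rw [hφ.eq_zero_of_notMem hx, zero_smul],
    setIntegral_eq_integral_of_forall_compl_eq_zero fun x hx => by
      rw [hψ.eq_zero_of_notMem hx, zero_smul]]
  refine ext_inner_right ℝ fun v => ?_
  have hin : ∀ {φ ψ : E N → ℝ}, IsTestFunction Ω φ → IsTestFunction Ω ψ →
      inner ℝ (∫ x, φ x • gradient ψ x) v = ∫ x, φ x * fderiv ℝ ψ x v := by
    intro φ ψ h1 h2
    rw [real_inner_comm, ← integral_inner (hi h1 h2)]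
    refine integral_congr_ae (ae_of_all _ fun x => ?_)
    simp only
    rw [real_inner_comm, real_inner_smul_left, inner_gradient]
  have hi' : ∀ {φ ψ : E N → ℝ}, IsTestFunction Ω φ → IsTestFunction Ω ψ →
      Integrable fun x => φ x * fderiv ℝ ψ x v := by
    intro φ ψ h1 h2
    have := (hi h1 h2).inner_const (𝕜 := ℝ) v
    simpa only [real_inner_smul_left, inner_gradient] using this
  rw [inner_neg_left, hin hφ hψ, hin hψ hφ,
    integral_mul_fderiv_eq_neg_fderiv_mul_of_integrable
      (by simpa only [mul_comm] using hi' hψ hφ) (hi' hφ hψ) ?_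
      (fun x _ => hφ.differentiableAt x) (fun x _ => hψ.differentiableAt x)]
  · simp only [mul_comm]
  · exact (hφ.continuous.mul hψ.continuous).integrable_of_hasCompactSupport hφ.compact.mul_right

/-- On a finite measure space L^p convergence implies L¹ convergence, which suffices for a
superposition that is uniformly Lipschitz. It serves both sides of the integration by parts formula.
-/
theorem tendsto_integral_smul_of_tendsto_eLpNorm {α V W : Type*} [MeasurableSpace α]
    {μ : Measure α} [IsFiniteMeasure μ] [NormedAddCommGroup V] [NormedSpace ℝ V]
    [NormedAddCommGroup W] [NormedSpace ℝ W] {p : ENNReal}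
    (hp : 1 ≤ p) {g : ℕ → α → V} {G : α → V} (hg : ∀ n, MemLp (g n) p μ) (hG : MemLp G p μ)
    (hlim : Tendsto (fun n => eLpNorm (fun x => G x - g n x) p μ) atTop (𝓝 0))
    {B : α → V → W} {C : ℝ} (hBm : ∀ v : α → V, MemLp v p μ → AEStronglyMeasurable (fun x => B x (v x)) μ)
    (hB : ∀ x v w, ‖B x v - B x w‖ ≤ C * ‖v - w‖) (hB0 : ∀ x, B x 0 = 0) :
    Tendsto (fun n => ∫ x, B x (g n x) ∂μ) atTop (𝓝 (∫ x, B x (G x) ∂μ)) := by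
  have hint : ∀ v : α → V, MemLp v p μ → Integrable (fun x => B x (v x)) μ := fun v hv => by
    refine Integrable.mono' ((hv.integrable hp).norm.const_mul C) (hBm v hv)
      (ae_of_all _ fun x => ?_)
    simpa [hB0] using hB x (v x) 0
  have h1 : Tendsto (fun n => eLpNorm (fun x => G x - g n x) 1 μ) atTop (𝓝 0) := by
    have hb : ∀ n, eLpNorm (fun x => G x - g n x) 1 μ ≤
        eLpNorm (fun x => G x - g n x) p μ * μ univ ^ (1 / (1 : ENNReal).toReal - 1 / p.toReal) :=
      fun n => eLpNorm_le_eLpNorm_mul_rpow_measure_univ hp (hG.sub (hg n)).1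
    refine tendsto_of_tendsto_of_tendsto_of_le_of_le tendsto_const_nhds ?_ (fun _ => zero_le) hb
    have hfin : μ univ ^ (1 / (1 : ENNReal).toReal - 1 / p.toReal) ≠ ⊤ := by
      refine ENNReal.rpow_ne_top_of_nonneg ?_ (measure_ne_top _ _)
      simp only [ENNReal.toReal_one, div_one, sub_nonneg]
      rcases eq_or_ne p ⊤ with rfl | hpt
      · simp
      · have : 1 ≤ p.toReal := by
          simpa using (ENNReal.toReal_le_toReal ENNReal.one_ne_top hpt).2 hp
        exact div_le_one_of_le₀ this (by linarith)
    simpa using ENNReal.Tendsto.mul_const hlim (Or.inr hfin)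
  refine tendsto_integral_of_L1' _ (hint G hG).1 (Eventually.of_forall fun n => hint _ (hg n)) ?_
  have h2 := ENNReal.Tendsto.const_mul (a := ENNReal.ofReal C) h1 (Or.inr ENNReal.ofReal_ne_top)
  rw [mul_zero] at h2
  refine tendsto_of_tendsto_of_tendsto_of_le_of_le tendsto_const_nhds h2 (fun _ => zero_le)
    fun n => ?_
  have hC : ∀ᵐ x ∂μ, ‖((fun x => B x (g n x)) - fun x => B x (G x)) x‖ ≤ C * ‖G x - g n x‖ :=
    ae_of_all _ fun x => by
      rw [norm_sub_rev (G x)]; exact hB x _ _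
  exact eLpNorm_le_mul_eLpNorm_of_ae_le_mul hC 1

/-- Integration by parts survives the limit, so the approximating sequence alone provides the weak
gradient. -/
theorem memW01p_of_approx (hΩ : Bornology.IsBounded Ω) {p : ℝ} (hp : 1 ≤ p) {u : E N → ℝ}
    {G : E N → E N} (hu : MemLp u (ENNReal.ofReal p) (volume.restrict Ω))
    (hG : MemLp G (ENNReal.ofReal p) (volume.restrict Ω)) {φ : ℕ → E N → ℝ}
    (hφ : ∀ n, IsTestFunction Ω (φ n))
    (h1 : Tendsto (fun n => eLpNorm (fun x => u x - φ n x) (ENNReal.ofReal p)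
      (volume.restrict Ω)) atTop (𝓝 0))
    (h2 : Tendsto (fun n => eLpNorm (fun x => G x - gradient (φ n) x) (ENNReal.ofReal p)
      (volume.restrict Ω)) atTop (𝓝 0)) : MemW01p Ω p u G := by
  have : IsFiniteMeasure (volume.restrict Ω) :=
    ⟨by rw [Measure.restrict_apply_univ]; exact hΩ.measure_lt_top⟩
  have hp' : (1 : ENNReal) ≤ ENNReal.ofReal p := by simpa using hp
  refine ⟨⟨hu, hG, ⟨?_, ?_, fun ψ hψ => ?_⟩⟩, φ, hφ, h1, h2⟩
  · exact IntegrableOn.locallyIntegrableOn (hu.integrable hp')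
  · exact IntegrableOn.locallyIntegrableOn (hG.integrable hp')
  obtain ⟨A, hA⟩ := hψ.hasCompactSupport_gradient.exists_bound_of_continuous hψ.continuous_gradient
  obtain ⟨B, hB⟩ := hψ.compact.exists_bound_of_continuous hψ.continuous
  have t1 := tendsto_integral_smul_of_tendsto_eLpNorm hp' (fun n => (hφ n).memLp _) hu h1
    (B := fun x t => t • gradient ψ x) (C := A)
    (fun v hv => hv.1.smul hψ.continuous_gradient.aestronglyMeasurable)
    (fun x v w => by rw [← sub_smul, norm_smul, mul_comm]; gcongr; exact hA x) (by simp)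
  have t2 := tendsto_integral_smul_of_tendsto_eLpNorm hp' (fun n => (hφ n).memLp_gradient _) hG h2
    (B := fun x v => ψ x • v) (C := B)
    (fun v hv => hψ.continuous.aestronglyMeasurable.smul hv.1)
    (fun x v w => by rw [← smul_sub, norm_smul]; gcongr; exact hB x) (by simp)
  simp only [fun n => (hφ n).integral_smul_gradient hψ] at t1
  exact tendsto_nhds_unique t1 t2.neg

theorem IsTestFunction.memW01p (hΩ : Bornology.IsBounded Ω) {p : ℝ} (hp : 1 ≤ p) {φ : E N → ℝ}
    (hφ : IsTestFunction Ω φ) : MemW01p Ω p φ (gradient φ) :=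
  memW01p_of_approx hΩ hp (hφ.memLp _) (hφ.memLp_gradient _) (fun _ => hφ) (by simp) (by simp)

theorem exists_tendsto_eLpNorm_of_cauchy {α V : Type*} [MeasurableSpace α] {μ : Measure α}
    [NormedAddCommGroup V] [CompleteSpace V] {p : ℝ} (hp : 1 ≤ p) {g : ℕ → α → V}
    (hg : ∀ n, MemLp (g n) (ENNReal.ofReal p) μ)
    (hcau : ∀ ε > 0, ∃ n₀, ∀ k ≥ n₀, ∀ l ≥ k, ∫ x, ‖g k x - g l x‖ ^ p ∂μ ≤ ε) :
    ∃ G : α → V, MemLp G (ENNReal.ofReal p) μ ∧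
      Tendsto (fun n => eLpNorm (fun x => G x - g n x) (ENNReal.ofReal p) μ) atTop (𝓝 0) ∧
      Tendsto (fun n => ∫ x, ‖g n x‖ ^ p ∂μ) atTop (𝓝 (∫ x, ‖G x‖ ^ p ∂μ)) := by
  have hp0 : 0 < p := by linarith
  have : Fact ((1 : ENNReal) ≤ ENNReal.ofReal p) := ⟨by simpa using hp⟩
  have hnorm : ∀ {v : α → V} (hv : MemLp v (ENNReal.ofReal p) μ),
      ‖hv.toLp v‖ = (∫ x, ‖v x‖ ^ p ∂μ) ^ p⁻¹ := by
    intro v hv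
    rw [Lp.norm_toLp, eLpNorm_eq_ofReal_integral hp0 hv, ENNReal.toReal_ofReal]
    exact Real.rpow_nonneg (integral_nonneg fun x => by positivity) _
  have hcs : CauchySeq fun n => (hg n).toLp (g n) := by
    refine Metric.cauchySeq_iff'.2 fun ε hε => ?_
    obtain ⟨n₀, hn₀⟩ := hcau ((ε / 2) ^ p) (by positivity)
    refine ⟨n₀, fun n hn => ?_⟩
    rw [dist_comm, dist_eq_norm, ← MemLp.toLp_sub, hnorm]
    have h1 : 0 ≤ ∫ x, ‖(g n₀ - g n) x‖ ^ p ∂μ := integral_nonneg fun x => by positivity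
    calc (∫ x, ‖(g n₀ - g n) x‖ ^ p ∂μ) ^ p⁻¹ ≤ ((ε / 2) ^ p) ^ p⁻¹ :=
          Real.rpow_le_rpow h1 (hn₀ n₀ le_rfl n hn) (by positivity)
      _ = ε / 2 := Real.rpow_rpow_inv (by positivity) hp0.ne'
      _ < ε := by linarith
  obtain ⟨G, hG⟩ := cauchySeq_tendsto_of_complete hcs
  have hGm : MemLp G (ENNReal.ofReal p) μ := Lp.memLp G
  have hGG : hGm.toLp G = G := Lp.toLp_coeFn G hGm
  refine ⟨G, hGm, ?_, ?_⟩
  · rw [← hGG, Lp.tendsto_Lp_iff_tendsto_eLpNorm'' g hg] at hG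
    refine hG.congr fun n => ?_
    rw [← eLpNorm_neg, neg_sub]
    rfl
  · have h1 := hG.norm
    rw [← hGG, hnorm hGm] at h1
    simp only [hnorm (hg _)] at h1
    have h2 := h1.rpow_const (p := p) (Or.inr hp0.le)
    simpa only [Real.rpow_inv_rpow (integral_nonneg fun x => Real.rpow_nonneg (norm_nonneg _) _)
      hp0.ne'] using h2

/-- A limit in `L^p` of test functions with bounded energy belongs to `W_0^{1,p}`, and the energy
is lower semicontinuous. -/
theorem exists_memW01p_of_energy_le (hΩ : Bornology.IsBounded Ω) {p : ℝ} (hp : 1 < p)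
    {u : E N → ℝ} (hu : MemLp u (ENNReal.ofReal p) (volume.restrict Ω)) {Q : ℝ}
    (hQ : ∀ ε > 0, ∃ φ : E N → ℝ, IsTestFunction Ω φ ∧ ∫ x in Ω, ‖φ x - u x‖ ^ p < ε ∧
      ∫ x in Ω, ‖gradient φ x‖ ^ p ≤ Q + ε) :
    ∃ G : E N → E N, MemW01p Ω p u G ∧ ∫ x in Ω, ‖G x‖ ^ p ≤ Q := by
  have hp0 : 0 < p := by linarith
  -- `S k` holds the energies of test functions that are 1/(k+1)-close to u. Its infima `d k`
  -- increase and stay below Q. Uniform convexity makes the gradients of almost minimizers a Cauchy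
  -- sequence in L^p, so no weak compactness or Mazur lemma is needed.
  let S : ℕ → Set ℝ := fun k => {r | ∃ φ : E N → ℝ, IsTestFunction Ω φ ∧
    ∫ x in Ω, ‖φ x - u x‖ ^ p < 1 / (k + 1 : ℝ) ∧ r = ∫ x in Ω, ‖gradient φ x‖ ^ p}
  have hSbdd : ∀ k, BddBelow (S k) := fun k => ⟨0, by
    rintro _ ⟨φ, -, -, rfl⟩
    exact integral_nonneg fun x => by positivity⟩
  have hone : ∀ k : ℕ, 0 < 1 / (k + 1 : ℝ) := fun k => by positivity
  have hSne : ∀ k, (S k).Nonempty := fun k => by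
    obtain ⟨φ, h1, h2, -⟩ := hQ _ (hone k)
    exact ⟨_, φ, h1, h2, rfl⟩
  let d : ℕ → ℝ := fun k => sInf (S k)
  have hdQ : ∀ k, d k ≤ Q := fun k => le_of_forall_pos_le_add fun ε hε => by
    obtain ⟨φ, h1, h2, h3⟩ := hQ (min ε (1 / (k + 1 : ℝ))) (lt_min hε (hone k))
    exact (csInf_le (hSbdd k) ⟨φ, h1, h2.trans_le (min_le_right _ _), rfl⟩).trans
      (h3.trans (by linarith [min_le_left ε (1 / (k + 1 : ℝ))]))
  have hdmono : Monotone d := fun k l hkl => csInf_le_csInf (hSbdd k) (hSne l) (by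
    rintro _ ⟨φ, h1, h2, rfl⟩
    exact ⟨φ, h1, h2.trans_le (one_div_le_one_div_of_le (by positivity) (by gcongr)), rfl⟩)
  have hex : ∀ k : ℕ, ∃ φ : E N → ℝ, IsTestFunction Ω φ ∧
      ∫ x in Ω, ‖φ x - u x‖ ^ p < 1 / (k + 1 : ℝ) ∧
      ∫ x in Ω, ‖gradient φ x‖ ^ p < d k + 1 / (k + 1 : ℝ) := fun k => by
    obtain ⟨_, ⟨φ, h1, h2, rfl⟩, h3⟩ := exists_lt_of_csInf_lt (hSne k)
      (show sInf (S k) < d k + 1 / (k + 1 : ℝ) by linarith [hone k])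
    exact ⟨φ, h1, h2, h3⟩
  choose φ hφ hφu hφe using hex
  have hinv : ∀ k : ℕ, 1 / (k + 1 : ℝ) ≤ 1 := fun k => by
    rw [div_le_one (by positivity)]
    linarith [show (0 : ℝ) ≤ k by positivity]
  have hiu : ∀ {ψ : E N → ℝ}, IsTestFunction Ω ψ →
      Integrable (fun x => ‖ψ x - u x‖ ^ p) (volume.restrict Ω) := fun hψ =>
    integrable_norm_rpow_of_memLp hp0 ((hψ.memLp _).sub hu)
  have hig : ∀ {ψ : E N → ℝ}, IsTestFunction Ω ψ →
      Integrable (fun x => ‖gradient ψ x‖ ^ p) (volume.restrict Ω) := fun hψ =>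
    integrable_norm_rpow_of_memLp hp0 (hψ.memLp_gradient _)
  -- Closeness to u is a convex condition, so the midpoint of the k-th and l-th almost minimizers
  -- still competes in `S k`.
  have hmid : ∀ k l, k ≤ l →
      d k ≤ ∫ x in Ω, ‖(1 / 2 : ℝ) • (gradient (φ k) x + gradient (φ l) x)‖ ^ p := by
    intro k l hkl
    have ht : IsTestFunction Ω fun x => (1 / 2 : ℝ) * (φ k x + φ l x) :=
      ((hφ k).add (hφ l)).const_mul _
    refine csInf_le (hSbdd k) ⟨_, ht, ?_, ?_⟩
    · calc ∫ x in Ω, ‖(1 / 2 : ℝ) * (φ k x + φ l x) - u x‖ ^ p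
          ≤ ∫ x in Ω, (‖φ k x - u x‖ ^ p + ‖φ l x - u x‖ ^ p) / 2 := by
            refine integral_mono (hiu ht) (((hiu (hφ k)).add (hiu (hφ l))).div_const 2)
              fun x => ?_
            have := norm_midpoint_rpow_le hp.le (φ k x - u x) (φ l x - u x)
            rwa [smul_eq_mul, show (1 / 2 : ℝ) * (φ k x - u x + (φ l x - u x)) =
              (1 / 2 : ℝ) * (φ k x + φ l x) - u x by ring] at this
        _ = ((∫ x in Ω, ‖φ k x - u x‖ ^ p) + ∫ x in Ω, ‖φ l x - u x‖ ^ p) / 2 := by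
            rw [integral_div, integral_add (hiu (hφ k)) (hiu (hφ l))]
        _ < 1 / (k + 1 : ℝ) := by
            have h1 : 1 / (l + 1 : ℝ) ≤ 1 / (k + 1 : ℝ) :=
              one_div_le_one_div_of_le (by positivity) (by gcongr)
            linarith [hφu k, hφu l]
    · refine integral_congr_ae (ae_of_all _ fun x => ?_)
      simp only
      rw [gradient_const_mul (((hφ k).add (hφ l)).differentiableAt x),
        gradient_add ((hφ k).differentiableAt x) ((hφ l).differentiableAt x)]
  have hQ0 : 0 ≤ Q + 1 := by
    have : 0 ≤ ∫ x in Ω, ‖gradient (φ 0) x‖ ^ p := integral_nonneg fun x => by positivity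
    linarith [hφe 0, hinv 0, hdQ 0]
  have hcau : ∀ ε > 0, ∃ n₀, ∀ k ≥ n₀, ∀ l ≥ k,
      ∫ x in Ω, ‖gradient (φ k) x - gradient (φ l) x‖ ^ p ≤ ε := by
    intro ε hε
    -- Every energy is at most Q + 2, which is positive, so with this parameter the first term of
    -- the convexity bound integrates to at most ε/2.
    obtain ⟨C, hC, hUC⟩ := exists_norm_sub_rpow_le (V := E N) hp
      (show 0 < ε / (4 * (Q + 2)) by apply div_pos hε; linarith)
    have hdl : ∃ D, Tendsto d atTop (𝓝 D) :=
      ⟨_, tendsto_atTop_ciSup hdmono ⟨Q, by rintro _ ⟨k, rfl⟩; exact hdQ k⟩⟩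
    obtain ⟨D, hD⟩ := hdl
    have hlim : Tendsto (fun k : ℕ => C * (D - d k + 1 / (k + 1 : ℝ))) atTop (𝓝 0) := by
      simpa using ((hD.const_sub D).add tendsto_one_div_add_atTop_nhds_zero_nat).const_mul C
    obtain ⟨n₀, hn₀⟩ := eventually_atTop.1 (hlim.eventually (gt_mem_nhds (half_pos hε)))
    refine ⟨n₀, fun k hk l hkl => ?_⟩
    have hi1 := hig (hφ k)
    have hi2 := hig (hφ l)
    have hmm : MemLp (fun x => (1 / 2 : ℝ) • (gradient (φ k) x + gradient (φ l) x))
        (ENNReal.ofReal p) (volume.restrict Ω) :=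
      (((hφ k).memLp_gradient _).add ((hφ l).memLp_gradient _)).const_smul (1 / 2 : ℝ)
    have hi3 := integrable_norm_rpow_of_memLp hp0 hmm
    have hi4 := integrable_norm_rpow_of_memLp hp0
      (((hφ k).memLp_gradient (ENNReal.ofReal p)).sub ((hφ l).memLp_gradient _))
    have e12 := integral_add hi1 hi2
    have hi12 : Integrable (fun x => ‖gradient (φ k) x‖ ^ p + ‖gradient (φ l) x‖ ^ p)
      (volume.restrict Ω) := hi1.add hi2
    have hi5 : Integrable (fun x => C * ((‖gradient (φ k) x‖ ^ p + ‖gradient (φ l) x‖ ^ p) / 2 -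
        ‖(1 / 2 : ℝ) • (gradient (φ k) x + gradient (φ l) x)‖ ^ p)) (volume.restrict Ω) :=
      ((hi12.div_const 2).sub hi3).const_mul C
    have h1 : ∫ x in Ω, ‖gradient (φ k) x - gradient (φ l) x‖ ^ p ≤
        ∫ x in Ω, (ε / (4 * (Q + 2)) * (‖gradient (φ k) x‖ ^ p + ‖gradient (φ l) x‖ ^ p) +
          C * ((‖gradient (φ k) x‖ ^ p + ‖gradient (φ l) x‖ ^ p) / 2 -
            ‖(1 / 2 : ℝ) • (gradient (φ k) x + gradient (φ l) x)‖ ^ p)) :=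
      integral_mono hi4 ((hi12.const_mul _).add hi5) fun x => hUC _ _
    rw [integral_add (hi12.const_mul _) hi5, integral_const_mul,
      integral_const_mul, integral_sub (hi12.div_const 2) hi3, integral_div, e12] at h1
    have ek : ∫ x in Ω, ‖gradient (φ k) x‖ ^ p ≤ Q + 2 := by linarith [hφe k, hinv k, hdQ k]
    have el : ∫ x in Ω, ‖gradient (φ l) x‖ ^ p ≤ Q + 2 := by linarith [hφe l, hinv l, hdQ l]
    have h2 : ε / (4 * (Q + 2)) * ((∫ x in Ω, ‖gradient (φ k) x‖ ^ p) +
        ∫ x in Ω, ‖gradient (φ l) x‖ ^ p) ≤ ε / 2 := by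
      rw [div_mul_eq_mul_div, div_le_iff₀ (by linarith)]
      nlinarith
    have hdD : d l ≤ D := hdmono.ge_of_tendsto hD l
    have hkl' : 1 / (l + 1 : ℝ) ≤ 1 / (k + 1 : ℝ) :=
      one_div_le_one_div_of_le (by positivity) (by gcongr)
    have h3 : C * (((∫ x in Ω, ‖gradient (φ k) x‖ ^ p) +
        ∫ x in Ω, ‖gradient (φ l) x‖ ^ p) / 2 -
        ∫ x in Ω, ‖(1 / 2 : ℝ) • (gradient (φ k) x + gradient (φ l) x)‖ ^ p) ≤
        C * (D - d k + 1 / (k + 1 : ℝ)) := by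
      gcongr
      linarith [hmid k l hkl, hφe k, hφe l, hdmono hkl]
    linarith [hn₀ k hk]
  obtain ⟨G, hG, hGlim, hGe⟩ := exists_tendsto_eLpNorm_of_cauchy hp.le
    (fun n => (hφ n).memLp_gradient _) hcau
  refine ⟨G, memW01p_of_approx hΩ hp.le hu hG hφ ?_ hGlim, ?_⟩
  · refine (tendsto_eLpNorm_zero_iff hp0 fun n => hu.sub ((hφ n).memLp _)).2 ?_
    refine squeeze_zero (fun n => integral_nonneg fun x => by positivity) (fun n => ?_)
      tendsto_one_div_add_atTop_nhds_zero_nat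
    have : ∀ x, ‖(u - φ n) x‖ = ‖φ n x - u x‖ := fun x => norm_sub_rev _ _
    simp only [this]
    exact (hφu n).le
  · refine le_of_tendsto_of_tendsto' hGe
      (g := fun n : ℕ => Q + 1 / (n + 1 : ℝ)) ?_ fun n => by linarith [hφe n, hdQ n]
    simpa using tendsto_one_div_add_atTop_nhds_zero_nat.const_add Q

variable {p : ℝ} {f : E N → ℝ → ℝ}

/-! ### Growth of the nonlinearity -/

namespace L1

theorem continuous_right (h1 : L1 Ω f) {x : E N} (hx : x ∈ Ω) : Continuous (f x) := by
  have h : ContinuousOn ((fun q : E N × ℝ => f q.1 q.2) ∘ fun t : ℝ => (x, t)) univ :=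
    h1.cont.comp (by fun_prop) fun t _ => ⟨hx, mem_univ _⟩
  exact continuousOn_univ.1 h

theorem f_nonneg (h1 : L1 Ω f) {x : E N} (hx : x ∈ Ω) (t : ℝ) : 0 ≤ f x t := by
  rcases le_total 0 t with ht | ht
  · exact h1.nonneg x hx t ht
  · exact (h1.zero x hx t ht).ge

theorem hasDerivAt_primitiveF (h1 : L1 Ω f) {x : E N} (hx : x ∈ Ω) (t : ℝ) :
    HasDerivAt (primitiveF f x) (f x t) t :=
  intervalIntegral.integral_hasDerivAt_right ((h1.continuous_right hx).intervalIntegrable _ _)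
    ((h1.continuous_right hx).stronglyMeasurableAtFilter _ _) (h1.continuous_right hx).continuousAt

theorem continuousOn_primitiveF (h1 : L1 Ω f) :
    ContinuousOn (fun q : E N × ℝ => primitiveF f q.1 q.2) (Ω ×ˢ univ) := by
  have hc : Continuous (Function.uncurry fun (x : Ω) (t : ℝ) => f x t) := by
    have h : ContinuousOn ((fun q : E N × ℝ => f q.1 q.2) ∘ fun q : Ω × ℝ => ((q.1 : E N), q.2))
        univ := h1.cont.comp (by fun_prop) fun q _ => ⟨q.1.2, mem_univ _⟩
    exact continuousOn_univ.1 h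
  have hF := intervalIntegral.continuous_parametric_primitive_of_continuous (μ := volume)
    (a₀ := 0) hc
  rw [continuousOn_iff_continuous_domRestrict]
  exact hF.comp (f := fun q : (Ω ×ˢ (univ : Set ℝ) : Set (E N × ℝ)) =>
    ((⟨q.1.1, q.2.1⟩ : Ω), q.1.2)) (by fun_prop)

theorem primitiveF_mono (h1 : L1 Ω f) {x : E N} (hx : x ∈ Ω) : Monotone (primitiveF f x) :=
  monotone_of_hasDerivAt_nonneg (h1.hasDerivAt_primitiveF hx) fun t => h1.f_nonneg hx t

theorem primitiveF_zero (x : E N) : primitiveF f x 0 = 0 := intervalIntegral.integral_same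

theorem primitiveF_of_nonpos (h1 : L1 Ω f) {x : E N} (hx : x ∈ Ω) {t : ℝ} (ht : t ≤ 0) :
    primitiveF f x t = 0 := by
  rw [primitiveF, intervalIntegral.integral_symm, neg_eq_zero]
  refine intervalIntegral.integral_zero_ae (ae_of_all _ fun s hs => ?_)
  rw [uIoc_of_le ht] at hs
  exact h1.zero x hx s hs.2

theorem primitiveF_nonneg (h1 : L1 Ω f) {x : E N} (hx : x ∈ Ω) (t : ℝ) :
    0 ≤ primitiveF f x t := by
  rcases le_total 0 t with ht | ht
  · exact (primitiveF_zero x).symm.le.trans (h1.primitiveF_mono hx ht)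
  · exact (h1.primitiveF_of_nonpos hx ht).ge

theorem mul_f_nonneg (h1 : L1 Ω f) {x : E N} (hx : x ∈ Ω) (t : ℝ) : 0 ≤ t * f x t := by
  rcases le_total 0 t with ht | ht
  · exact mul_nonneg ht (h1.nonneg x hx t ht)
  · rw [h1.zero x hx t ht, mul_zero]

end L1

theorem SCPI.exists_le (hf : SCPI Ω p f) {ε : ℝ} (hε : 0 < ε) :
    ∃ S : ℝ, 1 ≤ S ∧ ∀ s ≥ S, ∀ x ∈ Ω, f x s ≤ ε * s ^ (pStar N p - 1) := by
  have h := (Metric.tendstoUniformlyOn_iff.1 hf ε hε)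
  obtain ⟨S, hS⟩ := eventually_atTop.1 h
  refine ⟨max S 1, le_max_right _ _, fun s hs x hx => ?_⟩
  have hs1 : 1 ≤ s := (le_max_right _ _).trans hs
  have h1 := hS s ((le_max_left _ _).trans hs) x hx
  rw [dist_zero_left, Real.norm_eq_abs, abs_of_pos (by linarith : 0 < s)] at h1
  have h2 := (le_abs_self _).trans h1.le
  rwa [div_le_iff₀ (Real.rpow_pos_of_pos (by linarith) _)] at h2

/-- F ≥ 0 at a point of Ω forces μ ≥ 0. Combined with μ < λ₁ this also yields λ₁ > 0, so Poincaré's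
inequality needs no separate proof. -/
theorem L4.exists_le (h4 : L4 Ω p f) (hΩ : Ω.Nonempty) (hp : 0 < p) (h1 : L1 Ω f) :
    ∃ μ δ : ℝ, 0 ≤ μ ∧ μ < lambda1 Ω p ∧ 0 < δ ∧
      ∀ u : ℝ, 0 < u → u < δ → ∀ x ∈ Ω, p * primitiveF f x u ≤ μ * u ^ p := by
  obtain ⟨μ, hμ, h⟩ := h4
  obtain ⟨δ, hδ, hsub⟩ := mem_nhdsGT_iff_exists_Ioo_subset.1 h
  have key : ∀ u : ℝ, 0 < u → u < δ → ∀ x ∈ Ω, p * primitiveF f x u ≤ μ * u ^ p := by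
    intro u hu hu' x hx
    have := hsub ⟨hu, hu'⟩ x hx
    rwa [abs_of_pos hu, div_le_iff₀ (Real.rpow_pos_of_pos hu p)] at this
  refine ⟨μ, δ, ?_, hμ, hδ, key⟩
  obtain ⟨x, hx⟩ := hΩ
  have hδ0 : (0 : ℝ) < δ := hδ
  have h2 := key (δ / 2) (by linarith) (by linarith) x hx
  have h3 := mul_nonneg hp.le (h1.primitiveF_nonneg hx (δ / 2))
  exact nonneg_of_mul_nonneg_left (h3.trans h2) (Real.rpow_pos_of_pos (by linarith) p)

/-- `F` and `t f` have subcritical growth, uniformly in `x`. -/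
theorem exists_growth (hΩ : Ω.Nonempty) (hp : 1 < p) (hpN : p < N) (hf : SCPI Ω p f)
    (h1 : L1 Ω f) (h3 : L3 Ω p f) (h4 : L4 Ω p f) {ε : ℝ} (hε : 0 < ε) :
    ∃ K : ℝ, 0 ≤ K ∧ ∀ x ∈ Ω, ∀ t : ℝ, primitiveF f x t ≤ K + ε * |t| ^ pStar N p ∧
      t * f x t ≤ K + ε * |t| ^ pStar N p := by
  have hp0 : 0 < p := by linarith
  have hq := pStar_pos hp hpN
  have hpq := lt_pStar hp hpN
  obtain ⟨S, hS1, hS⟩ := hf.exists_le hε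
  obtain ⟨μ, δ, hμ0, -, hδ, hμ⟩ := h4.exists_le hΩ hp0 h1
  obtain ⟨C, θ, hC, hθ, hH⟩ := h3
  have hpow : ∀ t : ℝ, 0 < t → t * t ^ (pStar N p - 1) = t ^ pStar N p := fun t ht => by
    rw [Real.rpow_sub_one ht.ne']
    field_simp
  -- For t < S, (L3) compares H(x,t) with H(x,S) ≤ S f(x,S) ≤ ε S^{p*}. This is uniform in x even
  -- though f may be unbounded near the boundary.
  set K₁ := θ * (ε * S ^ pStar N p) + C with hK₁
  have hK₁0 : 0 ≤ K₁ := by positivity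
  have hHle : ∀ x ∈ Ω, ∀ t : ℝ, 0 < t → t < S → funH p f x t ≤ K₁ := by
    intro x hx t ht htS
    refine (hH x hx t S ht htS).trans ?_
    rw [hK₁]
    gcongr
    have e1 := hS S le_rfl x hx
    have e2 := mul_nonneg hp0.le (h1.primitiveF_nonneg hx S)
    have e3 := mul_le_mul_of_nonneg_left e1 (by linarith : (0 : ℝ) ≤ S)
    rw [funH, ← hpow S (by linarith)]
    linarith
  -- A starting point below both δ and S: there (L4) bounds F(x,τ)/τ^p by μ/p.
  set τ := min δ S / 2 with hτ
  have hτ0 : 0 < τ := by have := lt_min hδ (by linarith : 0 < S); linarith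
  have hτδ : τ < δ := by have := min_le_left δ S; linarith
  have hτS : τ < S := by have := min_le_right δ S; linarith
  set K₂ := S ^ p * (μ / p + K₁ / τ ^ (p + 1) * (S - τ)) with hK₂
  have hK₂0 : 0 ≤ K₂ := by
    have : 0 ≤ S - τ := by linarith
    positivity
  have hFS : ∀ x ∈ Ω, primitiveF f x S ≤ K₂ := by
    intro x hx
    -- The derivative of F(x,t)/t^p is H(x,t)/t^{p+1}, so the mean value theorem on [τ, S] carries
    -- the bound at τ to a bound for F(x,S).
    have hd : ∀ t : ℝ, 0 < t → HasDerivAt (fun t => primitiveF f x t * t ^ (-p))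
        (funH p f x t / t ^ (p + 1)) t := by
      intro t ht
      refine ((h1.hasDerivAt_primitiveF hx t).mul
        (Real.hasDerivAt_rpow_const (p := -p) (Or.inl ht.ne'))).congr_deriv ?_
      rw [Real.rpow_sub_one ht.ne', Real.rpow_neg ht.le, Real.rpow_add_one ht.ne', funH]
      have := (Real.rpow_pos_of_pos ht p).ne'
      field_simp
      ring
    obtain ⟨ξ, hξ, hξe⟩ := exists_hasDerivAt_eq_slope (fun t => primitiveF f x t * t ^ (-p))
      (fun t => funH p f x t / t ^ (p + 1)) hτS
      (fun t ht => (hd t (hτ0.trans_le ht.1)).continuousAt.continuousWithinAt)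
      (fun t ht => hd t (hτ0.trans ht.1))
    have hξ0 : 0 < ξ := hτ0.trans hξ.1
    have h5 : funH p f x ξ / ξ ^ (p + 1) ≤ K₁ / τ ^ (p + 1) :=
      div_le_div₀ hK₁0 (hHle x hx ξ hξ0 hξ.2) (by positivity)
        (Real.rpow_le_rpow hτ0.le hξ.1.le (by linarith))
    rw [hξe, div_le_iff₀ (by linarith)] at h5
    have h6 : primitiveF f x τ * τ ^ (-p) ≤ μ / p := by
      have := hμ τ hτ0 hτδ x hx
      rw [Real.rpow_neg hτ0.le, ← div_eq_mul_inv, div_le_div_iff₀ (by positivity) hp0]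
      linarith
    have h7 : primitiveF f x S * S ^ (-p) ≤ μ / p + K₁ / τ ^ (p + 1) * (S - τ) := by linarith
    rw [Real.rpow_neg (by linarith), ← div_eq_mul_inv, div_le_iff₀ (by positivity)] at h7
    rw [hK₂]
    linarith
  -- Below S one has t f = H + pF ≤ K₁ + pK₂ and F ≤ K₂; the same K₂ is the contribution of [0,S] to
  -- F beyond S.
  refine ⟨K₁ + p * K₂ + K₂, by positivity, fun x hx t => ?_⟩
  have hpK : 0 ≤ p * K₂ := by positivity
  have habs : 0 ≤ ε * |t| ^ pStar N p := by positivity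
  rcases le_or_gt t 0 with ht | ht
  · rw [h1.primitiveF_of_nonpos hx ht, h1.zero x hx t ht]
    constructor <;> linarith
  rw [abs_of_pos ht] at habs ⊢
  rcases lt_or_ge t S with htS | htS
  · have hF : primitiveF f x t ≤ K₂ := (h1.primitiveF_mono hx htS.le).trans (hFS x hx)
    have hHt := hHle x hx t ht htS
    rw [funH] at hHt
    have := mul_le_mul_of_nonneg_left hF hp0.le
    constructor <;> linarith
  · constructor
    · have hint : primitiveF f x t - primitiveF f x S = ∫ s in S..t, f x s := by
        rw [primitiveF, primitiveF, intervalIntegral.integral_interval_sub_left] <;>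
          exact (h1.continuous_right hx).intervalIntegrable _ _
      have hle : ∫ s in S..t, f x s ≤ ∫ _ in S..t, ε * t ^ (pStar N p - 1) := by
        refine intervalIntegral.integral_mono_on htS
          ((h1.continuous_right hx).intervalIntegrable _ _) (by simp) fun s hs => ?_
        refine (hS s hs.1 x hx).trans ?_
        gcongr
        · linarith [hs.1]
        · linarith
        · exact hs.2
      rw [intervalIntegral.integral_const, smul_eq_mul] at hle
      have h8 : (t - S) * (ε * t ^ (pStar N p - 1)) ≤ ε * t ^ pStar N p := by
        rw [← hpow t ht]
        have : 0 ≤ ε * t ^ (pStar N p - 1) := by positivity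
        nlinarith
      linarith [hFS x hx]
    · have := mul_le_mul_of_nonneg_left (hS t htS x hx) ht.le
      have e : t * (ε * t ^ (pStar N p - 1)) = ε * t ^ pStar N p := by
        rw [← hpow t ht]; ring
      linarith

/-- Near `0` the primitive is controlled by the first eigenvalue. -/
theorem exists_growth_zero (hΩ : Ω.Nonempty) (hp : 1 < p) (hpN : p < N) (hf : SCPI Ω p f)
    (h1 : L1 Ω f) (h3 : L3 Ω p f) (h4 : L4 Ω p f) :
    ∃ μ C : ℝ, 0 ≤ μ ∧ μ < lambda1 Ω p ∧ 0 ≤ C ∧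
      ∀ x ∈ Ω, ∀ t : ℝ, p * primitiveF f x t ≤ μ * |t| ^ p + C * |t| ^ pStar N p := by
  have hp0 : 0 < p := by linarith
  have hq := pStar_pos hp hpN
  obtain ⟨μ, δ, hμ0, hμ, hδ, hle⟩ := h4.exists_le hΩ hp0 h1
  obtain ⟨K, hK, hgr⟩ := exists_growth hΩ hp hpN hf h1 h3 h4 one_pos
  -- For t ≥ δ the additive constant is absorbed through K ≤ K (t/δ)^{p*}.
  refine ⟨μ, p * (K / δ ^ pStar N p + 1), hμ0, hμ, by positivity, fun x hx t => ?_⟩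
  have a1 : 0 ≤ μ * |t| ^ p := by positivity
  have a2 : 0 ≤ p * (K / δ ^ pStar N p + 1) * |t| ^ pStar N p := by positivity
  rcases le_or_gt t 0 with ht | ht
  · rw [h1.primitiveF_of_nonpos hx ht]
    linarith
  rw [abs_of_pos ht] at a1 a2 ⊢
  rcases lt_or_ge t δ with htδ | htδ
  · linarith [hle t ht htδ x hx]
  · have h5 := (hgr x hx t).1
    rw [abs_of_pos ht] at h5
    have h6 : K ≤ K / δ ^ pStar N p * t ^ pStar N p := by
      rw [div_mul_eq_mul_div, le_div_iff₀ (by positivity)]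
      gcongr
    have : p * primitiveF f x t ≤ p * (K / δ ^ pStar N p * t ^ pStar N p + 1 * t ^ pStar N p) := by
      gcongr
      linarith
    linarith

/-- Unlike F and t f, the function f is controlled only over compact subsets of Ω. This is enough
against a test function. -/
theorem exists_growth_on_compact (hf : SCPI Ω p f)
    (h1 : L1 Ω f) {K : Set (E N)} (hK : IsCompact K) (hKΩ : K ⊆ Ω) {ε : ℝ} (hε : 0 < ε) :
    ∃ M : ℝ, 0 ≤ M ∧ ∀ x ∈ K, ∀ t : ℝ, f x t ≤ M + ε * |t| ^ pStar N p := by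
  obtain ⟨S, hS1, hS⟩ := hf.exists_le hε
  obtain ⟨M, hM⟩ := (hK.prod (isCompact_Icc (a := (0 : ℝ)) (b := S))).exists_bound_of_continuousOn
    (h1.cont.mono (prod_mono hKΩ (subset_univ _)))
  refine ⟨max M 0, le_max_right _ _, fun x hx t => ?_⟩
  have habs : 0 ≤ ε * |t| ^ pStar N p := by positivity
  have hM0 := le_max_right M 0
  rcases le_or_gt t 0 with ht | ht
  · rw [h1.zero x (hKΩ hx) t ht]
    linarith
  rcases lt_or_ge t S with htS | htS
  · have := hM (x, t) ⟨hx, ht.le, htS.le⟩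
    linarith [le_abs_self (f x t), Real.norm_eq_abs (f x t), le_max_left M 0]
  · refine (hS t htS x (hKΩ hx)).trans ?_
    rw [abs_of_pos ht]
    -- This uses t ≥ S ≥ 1.
    have : ε * t ^ (pStar N p - 1) ≤ ε * t ^ pStar N p := by
      gcongr
      · linarith
      · linarith
    linarith

/-! ### Convergence of superposition integrals -/

theorem aestronglyMeasurable_superposition (hΩ : IsOpen Ω) {h : E N → ℝ → ℝ}
    (hh : ContinuousOn (fun q : E N × ℝ => h q.1 q.2) (Ω ×ˢ univ)) {u : E N → ℝ}
    (hu : AEStronglyMeasurable u (volume.restrict Ω)) :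
    AEStronglyMeasurable (fun x => h x (u x)) (volume.restrict Ω) := by
  have hms : MeasurableSet (Ω ×ˢ (univ : Set ℝ)) := hΩ.measurableSet.prod MeasurableSet.univ
  have hm : Measurable ((Ω ×ˢ (univ : Set ℝ)).indicator fun q : E N × ℝ => h q.1 q.2) := by
    classical
    rw [← piecewise_eq_indicator]
    exact hh.measurable_piecewise continuousOn_const hms
  have h2 := (hm.comp_aemeasurable
    (aemeasurable_id.prodMk hu.aemeasurable)).aestronglyMeasurable
  refine h2.congr ?_
  filter_upwards [ae_restrict_mem hΩ.measurableSet] with x hx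
  simp [hx]

/-- Convergence of `∫ h(x, u_n)` when `h` is dominated, up to arbitrarily small multiples of
`|t| ^ q`, by constants. -/
theorem tendsto_integral_superposition (hΩ : IsOpen Ω) (hΩb : Bornology.IsBounded Ω)
    {h : E N → ℝ → ℝ} (hh : ContinuousOn (fun q : E N × ℝ => h q.1 q.2) (Ω ×ˢ univ)) {q : ℝ}
    (hgr : ∀ ε > 0, ∃ K : ℝ, 0 ≤ K ∧ ∀ x ∈ Ω, ∀ t : ℝ, |h x t| ≤ K + ε * |t| ^ q)
    {u : ℕ → E N → ℝ} {v : E N → ℝ} {A : ℝ}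
    (hum : ∀ n, AEStronglyMeasurable (u n) (volume.restrict Ω))
    (hvm : AEStronglyMeasurable v (volume.restrict Ω))
    (hui : ∀ n, IntegrableOn (fun x => |u n x| ^ q) Ω) (huA : ∀ n, ∫ x in Ω, |u n x| ^ q ≤ A)
    (hvi : IntegrableOn (fun x => |v x| ^ q) Ω) (hvA : ∫ x in Ω, |v x| ^ q ≤ A)
    (hlim : ∀ᵐ x ∂(volume.restrict Ω), Tendsto (fun n => u n x) atTop (𝓝 (v x))) :
    IntegrableOn (fun x => h x (v x)) Ω ∧
      Tendsto (fun n => ∫ x in Ω, h x (u n x)) atTop (𝓝 (∫ x in Ω, h x (v x))) := by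
  have : IsFiniteMeasure (volume.restrict Ω) :=
    ⟨by rw [Measure.restrict_apply_univ]; exact hΩb.measure_lt_top⟩
  have hA0 : 0 ≤ A := (integral_nonneg fun x => by positivity).trans hvA
  have hint : ∀ w : E N → ℝ, AEStronglyMeasurable w (volume.restrict Ω) →
      IntegrableOn (fun x => |w x| ^ q) Ω → IntegrableOn (fun x => h x (w x)) Ω := by
    intro w hw hwi
    obtain ⟨K, hK, hb⟩ := hgr 1 one_pos
    refine Integrable.mono' ((integrable_const K).add (hwi.const_mul 1))
      (aestronglyMeasurable_superposition hΩ hh hw) ?_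
    filter_upwards [ae_restrict_mem hΩ.measurableSet] with x hx
    exact hb x hx _
  refine ⟨hint v hvm hvi, Metric.tendsto_atTop.2 fun ε hε => ?_⟩
  obtain ⟨K, hK, hb⟩ := hgr (ε / (4 * (A + 1))) (by positivity)
  set η := ε / (4 * (A + 1)) with hη
  have hηA : η * A ≤ ε / 4 := by
    rw [hη, div_mul_eq_mul_div, div_le_iff₀ (by positivity)]
    nlinarith
  -- Truncation at the level K of the growth bound. The truncated integrals converge by dominated
  -- convergence, and the truncation error is at most η|t|^q, whose integral is at most ηA ≤ ε/4 for
  -- every member of the sequence and for the limit.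
  let T : ℝ → ℝ := fun r => max (-K) (min r K)
  have hTc : Continuous T := by fun_prop
  have hTb : ∀ r, |T r| ≤ K := fun r => by
    rw [abs_le]
    exact ⟨le_max_left _ _, max_le (by linarith) (min_le_right _ _)⟩
  have hTd : ∀ x ∈ Ω, ∀ t, |h x t - T (h x t)| ≤ η * |t| ^ q := by
    intro x hx t
    have h1 := abs_le.1 (hb x hx t)
    have h0 : 0 ≤ η * |t| ^ q := by positivity
    simp only [T]
    rcases le_total (h x t) K with h2 | h2
    · rw [min_eq_left h2]
      rcases le_total (-K) (h x t) with h3 | h3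
      · rw [max_eq_right h3, sub_self, abs_zero]; exact h0
      · rw [max_eq_left h3, abs_le]; constructor <;> linarith
    · rw [min_eq_right h2, max_eq_right (by linarith), abs_le]; constructor <;> linarith
  have hTi : ∀ w : E N → ℝ, AEStronglyMeasurable w (volume.restrict Ω) →
      IntegrableOn (fun x => T (h x (w x))) Ω := fun w hw =>
    Integrable.of_bound (hTc.comp_aestronglyMeasurable
      (aestronglyMeasurable_superposition hΩ hh hw)) K (ae_of_all _ fun x => hTb _)
  have hdiff : ∀ w : E N → ℝ, AEStronglyMeasurable w (volume.restrict Ω) →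
      IntegrableOn (fun x => |w x| ^ q) Ω → ∫ x in Ω, |w x| ^ q ≤ A →
      |(∫ x in Ω, h x (w x)) - ∫ x in Ω, T (h x (w x))| ≤ ε / 4 := by
    intro w hw hwi hwA
    rw [← integral_sub (hint w hw hwi) (hTi w hw)]
    refine (abs_integral_le_integral_abs).trans ?_
    calc ∫ x in Ω, |h x (w x) - T (h x (w x))| ≤ ∫ x in Ω, η * |w x| ^ q := by
          refine integral_mono_of_nonneg (ae_of_all _ fun x => abs_nonneg _) (hwi.const_mul η) ?_
          filter_upwards [ae_restrict_mem hΩ.measurableSet] with x hx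
          exact hTd x hx _
      _ ≤ ε / 4 := by
          rw [integral_const_mul]
          refine le_trans ?_ hηA
          gcongr
  have hTlim : Tendsto (fun n => ∫ x in Ω, T (h x (u n x))) atTop
      (𝓝 (∫ x in Ω, T (h x (v x)))) := by
    refine tendsto_integral_of_dominated_convergence (fun _ => K)
      (fun n => (hTi _ (hum n)).1) (integrable_const K)
      (fun n => ae_of_all _ fun x => hTb _) ?_
    filter_upwards [ae_restrict_mem hΩ.measurableSet, hlim] with x hx hxl
    have hcx : Continuous (h x) := by
      have h : ContinuousOn ((fun q : E N × ℝ => h q.1 q.2) ∘ fun t : ℝ => (x, t)) univ :=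
        hh.comp (by fun_prop) fun t _ => ⟨hx, mem_univ _⟩
      exact continuousOn_univ.1 h
    exact ((hTc.comp hcx).tendsto _).comp hxl
  obtain ⟨n₀, hn₀⟩ := Metric.tendsto_atTop.1 hTlim (ε / 4) (by positivity)
  refine ⟨n₀, fun n hn => ?_⟩
  have e1 := hn₀ n hn
  have e2 := hdiff _ (hum n) (hui n) (huA n)
  have e3 := hdiff _ hvm hvi hvA
  rw [Real.dist_eq, abs_lt] at e1 ⊢
  rw [abs_le] at e2 e3
  constructor <;> linarith

/-! ### The energy functional on finite-dimensional spaces of test functions -/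

/-- The energy functional `(1/p) ∫ |∇φ|^p - ∫ F(x,φ)`. -/
def functional (Ω : Set (E N)) (p : ℝ) (f : E N → ℝ → ℝ) (φ : E N → ℝ) : ℝ :=
  (1 / p) * (∫ x in Ω, ‖gradient φ x‖ ^ p) - ∫ x in Ω, primitiveF f x (φ x)

/-- The derivative of the energy functional at `φ` in the direction `ψ`. -/
def dFunctional (Ω : Set (E N)) (p : ℝ) (f : E N → ℝ → ℝ) (φ ψ : E N → ℝ) : ℝ :=
  (∫ x in Ω, ‖gradient φ x‖ ^ (p - 2) * inner ℝ (gradient φ x) (gradient ψ x)) -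
    ∫ x in Ω, f x (φ x) * ψ x

theorem isFiniteMeasure_restrict (hΩ : Bornology.IsBounded Ω) :
    IsFiniteMeasure (volume.restrict Ω) :=
  ⟨by rw [Measure.restrict_apply_univ]; exact hΩ.measure_lt_top⟩

/-! ### Calculus of the map v ↦ ‖v‖^p / p. -/

section PowerMap

variable {V : Type*} [NormedAddCommGroup V] [InnerProductSpace ℝ V]

/-- The derivative of `(1/p) ‖v‖ ^ p`. -/
def powerMap (p : ℝ) (v : V) : V →L[ℝ] ℝ := ‖v‖ ^ (p - 2) • innerSL ℝ v

theorem powerMap_apply (p : ℝ) (v w : V) : powerMap p v w = ‖v‖ ^ (p - 2) * inner ℝ v w := by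
  simp [powerMap]

theorem hasFDerivAt_norm_rpow_div (hp : 1 < p) (v : V) :
    HasFDerivAt (fun v : V => (1 / p) * ‖v‖ ^ p) (powerMap p v) v := by
  refine ((hasFDerivAt_norm_rpow v hp).const_mul (1 / p)).congr_fderiv ?_
  rw [powerMap, smul_smul]
  congr 1
  field_simp

theorem continuous_powerMap (hp : 1 < p) : Continuous (powerMap p : V → V →L[ℝ] ℝ) := by
  have h : ContDiff ℝ 1 fun v : V => (1 / p) * ‖v‖ ^ p :=
    contDiff_const.mul (contDiff_norm_rpow hp)
  have e : fderiv ℝ (fun v : V => (1 / p) * ‖v‖ ^ p) = powerMap p :=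
    funext fun v => (hasFDerivAt_norm_rpow_div hp v).fderiv
  rw [← e]
  exact h.continuous_fderiv one_ne_zero

theorem abs_powerMap_apply_le (v w : V) : |powerMap p v w| ≤ ‖v‖ ^ (p - 2) * (‖v‖ * ‖w‖) := by
  rw [powerMap_apply, abs_mul, abs_of_nonneg (by positivity)]
  gcongr
  exact abs_real_inner_le_norm v w

theorem powerMap_self (hp : 1 < p) (v : V) : powerMap p v v = ‖v‖ ^ p := by
  rw [powerMap_apply, real_inner_self_eq_norm_sq]
  rcases eq_or_ne v 0 with rfl | hv
  · simp [Real.zero_rpow (by linarith : p ≠ 0)]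
  · rw [← Real.rpow_two, ← Real.rpow_add (norm_pos_iff.2 hv)]
    congr 1
    ring

end PowerMap

/-- The derivative vanishes off a fixed compact set, and balls of the parameter space are compact,
so near each parameter it is bounded by a constant, which is an integrable majorant on the bounded
set Ω. -/
theorem hasFDerivAt_integral_of_continuousOn {Y : Type*} [NormedAddCommGroup Y] [NormedSpace ℝ Y]
    [FiniteDimensional ℝ Y] (hΩ : IsOpen Ω) (hΩb : Bornology.IsBounded Ω) {K : Set (E N)}
    (hK : IsCompact K) (hKΩ : K ⊆ Ω) {k : Y → E N → ℝ} {k' : Y → E N → Y →L[ℝ] ℝ}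
    (hkc : ∀ a, IntegrableOn (k a) Ω)
    (hk'c : ContinuousOn (fun q : Y × E N => k' q.1 q.2) (univ ×ˢ Ω))
    (hk' : ∀ a, ∀ x ∈ Ω, x ∉ K → k' a x = 0)
    (hd : ∀ a, ∀ x ∈ Ω, HasFDerivAt (fun a => k a x) (k' a x) a) :
    (∀ a, IntegrableOn (k' a) Ω) ∧
    (∀ a, HasFDerivAt (fun a => ∫ x in Ω, k a x) (∫ x in Ω, k' a x) a) ∧
      Continuous fun a => ∫ x in Ω, k' a x := by
  have : IsFiniteMeasure (volume.restrict Ω) := isFiniteMeasure_restrict hΩb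
  have : ProperSpace Y := FiniteDimensional.proper ℝ Y
  have hm : ∀ a, AEStronglyMeasurable (k' a) (volume.restrict Ω) := fun a =>
    (hk'c.comp (f := fun x => (a, x)) (by fun_prop)
      fun x hx => ⟨mem_univ _, hx⟩).aestronglyMeasurable hΩ.measurableSet
  have hbound : ∀ a₀ : Y, ∃ M : ℝ, ∀ᵐ x ∂(volume.restrict Ω), ∀ a ∈ Metric.closedBall a₀ 1,
      ‖k' a x‖ ≤ M := by
    intro a₀
    obtain ⟨M, hM⟩ := ((isCompact_closedBall a₀ 1).prod hK).exists_bound_of_continuousOn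
      (hk'c.mono (prod_mono (subset_univ _) hKΩ))
    refine ⟨max M 0, ?_⟩
    filter_upwards [ae_restrict_mem hΩ.measurableSet] with x hx a ha
    by_cases hxK : x ∈ K
    · exact (hM (a, x) ⟨ha, hxK⟩).trans (le_max_left _ _)
    · rw [hk' a x hx hxK, norm_zero]
      exact le_max_right _ _
  refine ⟨fun a => ?_, fun a => ?_, ?_⟩
  · obtain ⟨M, hM⟩ := hbound a
    exact Integrable.of_bound (hm a) M
      (hM.mono fun x hx => hx a (Metric.mem_closedBall_self zero_le_one))
  · obtain ⟨M, hM⟩ := hbound a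
    refine hasFDerivAt_integral_of_dominated_of_fderiv_le (bound := fun _ => M)
      (Metric.closedBall_mem_nhds a one_pos) (Eventually.of_forall fun b => (hkc b).1) (hkc a)
      (hm a) hM (integrable_const M) ?_
    filter_upwards [ae_restrict_mem hΩ.measurableSet] with x hx b _
    exact hd b x hx
  · refine continuous_iff_continuousAt.2 fun a => ?_
    obtain ⟨M, hM⟩ := hbound a
    refine continuousAt_of_dominated (bound := fun _ => M) (Eventually.of_forall hm) ?_
      (integrable_const M) ?_
    · filter_upwards [Metric.closedBall_mem_nhds a one_pos] with b hb
      exact hM.mono fun x hx => hx b hb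
    · filter_upwards [ae_restrict_mem hΩ.measurableSet] with x hx
      have h : ContinuousOn ((fun q : Y × E N => k' q.1 q.2) ∘ fun b : Y => (b, x)) univ :=
        hk'c.comp (by fun_prop) fun b _ => ⟨mem_univ _, hx⟩
      exact (continuousOn_univ.1 h).continuousAt

theorem integrableOn_superposition_of_test (hΩ : IsOpen Ω) (hΩb : Bornology.IsBounded Ω)
    {h : E N → ℝ → ℝ} (hh : ContinuousOn (fun q : E N × ℝ => h q.1 q.2) (Ω ×ˢ univ))
    {φ : E N → ℝ} (hφ : IsTestFunction Ω φ) (h0 : ∀ x ∈ Ω, x ∉ tsupport φ → h x (φ x) = 0) :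
    IntegrableOn (fun x => h x (φ x)) Ω := by
  have : IsFiniteMeasure (volume.restrict Ω) := isFiniteMeasure_restrict hΩb
  have hc : ContinuousOn (fun x => h x (φ x)) Ω :=
    hh.comp (f := fun x => (x, φ x)) (continuous_id.prodMk hφ.continuous).continuousOn
      fun x hx => ⟨hx, mem_univ _⟩
  obtain ⟨M, hM⟩ := IsCompact.exists_bound_of_continuousOn (s := tsupport φ) hφ.compact
    (hc.mono hφ.supp)
  refine Integrable.of_bound (hc.aestronglyMeasurable hΩ.measurableSet) (max M 0) ?_
  filter_upwards [ae_restrict_mem hΩ.measurableSet] with x hx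
  by_cases hxK : x ∈ tsupport φ
  · exact (hM x hxK).trans (le_max_left _ _)
  · rw [h0 x hx hxK, norm_zero]
    exact le_max_right _ _

/-! ### Integrability of the nonlinear terms at test functions. -/

namespace L1

variable {φ ψ : E N → ℝ}

theorem integrableOn_primitiveF (h1 : L1 Ω f) (hΩ : IsOpen Ω) (hΩb : Bornology.IsBounded Ω)
    (hφ : IsTestFunction Ω φ) : IntegrableOn (fun x => primitiveF f x (φ x)) Ω :=
  integrableOn_superposition_of_test hΩ hΩb h1.continuousOn_primitiveF hφ fun x _ hx' => by
    rw [image_eq_zero_of_notMem_tsupport hx', primitiveF_zero]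

theorem integrableOn_f_mul (h1 : L1 Ω f) (hΩ : IsOpen Ω) (hΩb : Bornology.IsBounded Ω)
    (hφ : IsTestFunction Ω φ) (hψ : IsTestFunction Ω ψ) :
    IntegrableOn (fun x => f x (φ x) * ψ x) Ω := by
  have : IsFiniteMeasure (volume.restrict Ω) := isFiniteMeasure_restrict hΩb
  refine integrableOn_superposition_of_test (h := fun x t => f x (φ x) * t) hΩ hΩb ?_ hψ
    fun x _ hx' => by rw [image_eq_zero_of_notMem_tsupport hx', mul_zero]
  refine ContinuousOn.mul ?_ continuousOn_snd
  exact h1.cont.comp (f := fun q : E N × ℝ => (q.1, φ q.1))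
    (continuous_fst.prodMk (hφ.continuous.comp continuous_fst)).continuousOn
    fun q hq => ⟨hq.1, mem_univ _⟩

end L1

theorem IsTestFunction.integrableOn_powerMap (hp : 1 < p) (hΩb : Bornology.IsBounded Ω)
    {φ ψ : E N → ℝ} (hφ : IsTestFunction Ω φ) (hψ : IsTestFunction Ω ψ) :
    IntegrableOn (fun x => powerMap p (gradient φ x) (gradient ψ x)) Ω := by
  have : IsFiniteMeasure (volume.restrict Ω) := isFiniteMeasure_restrict hΩb
  have hc : Continuous fun x => powerMap p (gradient φ x) (gradient ψ x) :=
    ((continuous_powerMap hp).comp hφ.continuous_gradient).clm_apply hψ.continuous_gradient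
  have hs : HasCompactSupport fun x => powerMap p (gradient φ x) (gradient ψ x) :=
    hψ.hasCompactSupport_gradient.mono fun x hx h => hx (by simp only; rw [h, map_zero])
  exact (hc.integrable_of_hasCompactSupport hs).integrableOn

/-- Linear combinations of test functions. -/
def comb {m : ℕ} (d : Fin m → E N → ℝ) (a : E m) : E N → ℝ := fun x => ∑ i, a i * d i x

section Comb

variable {m : ℕ} {d : Fin m → E N → ℝ}

theorem isTestFunction_comb (hd : ∀ i, IsTestFunction Ω (d i)) (a : E m) :
    IsTestFunction Ω (comb d a) :=
  IsTestFunction.sum _ fun i => (hd i).const_mul (a i)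

theorem gradient_comb (hd : ∀ i, IsTestFunction Ω (d i)) (a : E m) (x : E N) :
    gradient (comb d a) x = ∑ i, a i • gradient (d i) x := by
  unfold comb
  rw [gradient_sum fun i _ => ((hd i).const_mul (a i)).differentiableAt x]
  exact Finset.sum_congr rfl fun i _ => gradient_const_mul ((hd i).differentiableAt x) (a i)

theorem comb_smul (c : ℝ) (a : E m) : comb d (c • a) = fun x => c * comb d a x := by
  funext x
  simp [comb, Finset.mul_sum, mul_assoc]

theorem comb_single (i : Fin m) (c : ℝ) :
    comb d (EuclideanSpace.single i c) = fun x => c * d i x := by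
  funext x
  simp only [comb, EuclideanSpace.single, PiLp.single_apply]
  rw [Finset.sum_eq_single i (fun j _ hj => by simp [hj]) (by simp)]
  simp

/-- All functions in the span are supported in one compact subset of Ω, where f is under control.
This is why J is C¹ on such spans without any bound on f near the boundary. -/
theorem exists_hasFDerivAt_functional (hp : 1 < p) (hΩ : IsOpen Ω) (hΩb : Bornology.IsBounded Ω)
    (h1 : L1 Ω f) (hd : ∀ i, IsTestFunction Ω (d i)) :
    ∃ g' : E m → E m →L[ℝ] ℝ, Continuous g' ∧
      (∀ a, HasFDerivAt (fun a => functional Ω p f (comb d a)) (g' a) a) ∧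
      ∀ a b, g' a b = dFunctional Ω p f (comb d a) (comb d b) := by
  have hp0 : 0 < p := by linarith
  -- At each x the gradient and the value of a combination are the linear maps `T x` and `S x` of
  -- the coefficients.
  let T : E N → E m →L[ℝ] E N := fun x =>
    ∑ i, (EuclideanSpace.proj i : E m →L[ℝ] ℝ).smulRight (gradient (d i) x)
  let S : E N → E m →L[ℝ] ℝ := fun x =>
    ∑ i, (EuclideanSpace.proj i : E m →L[ℝ] ℝ).smulRight (d i x)
  have hT : ∀ x a, T x a = gradient (comb d a) x := fun x a => by
    rw [gradient_comb hd]; simp [T]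
  have hS : ∀ x a, S x a = comb d a x := fun x a => by simp [S, comb]
  have hTc : Continuous T := continuous_finsetSum _ fun i _ =>
    ((ContinuousLinearMap.smulRightL ℝ (E m) (E N)
      (EuclideanSpace.proj i : E m →L[ℝ] ℝ)).continuous.comp (hd i).continuous_gradient)
  have hSc : Continuous S := continuous_finsetSum _ fun i _ =>
    ((ContinuousLinearMap.smulRightL ℝ (E m) ℝ
      (EuclideanSpace.proj i : E m →L[ℝ] ℝ)).continuous.comp (hd i).continuous)
  let K : Set (E N) := ⋃ i, tsupport (d i)
  have hK : IsCompact K := isCompact_iUnion fun i => (hd i).compact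
  have hKΩ : K ⊆ Ω := iUnion_subset fun i => (hd i).supp
  let k : E m → E N → ℝ := fun a x => (1 / p) * ‖T x a‖ ^ p - primitiveF f x (S x a)
  let k' : E m → E N → E m →L[ℝ] ℝ := fun a x =>
    (powerMap p (T x a)).comp (T x) - f x (S x a) • S x
  have hi1 : ∀ a, IntegrableOn (fun x => (1 / p) * ‖T x a‖ ^ p) Ω := fun a => by
    simp only [hT]
    exact (integrable_norm_rpow_of_memLp hp0
      ((isTestFunction_comb hd a).memLp_gradient _)).const_mul _
  have hi2 : ∀ a, IntegrableOn (fun x => primitiveF f x (S x a)) Ω := fun a => by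
    simp only [hS]
    exact h1.integrableOn_primitiveF hΩ hΩb (isTestFunction_comb hd a)
  have hk'c : ContinuousOn (fun q : E m × E N => k' q.1 q.2) (univ ×ˢ Ω) := by
    have hTa : Continuous fun q : E m × E N => T q.2 q.1 :=
      (hTc.comp continuous_snd).clm_apply continuous_fst
    have hSa : Continuous fun q : E m × E N => S q.2 q.1 :=
      (hSc.comp continuous_snd).clm_apply continuous_fst
    have hfc : ContinuousOn (fun q : E m × E N => f q.2 (S q.2 q.1)) (univ ×ˢ Ω) :=
      h1.cont.comp (f := fun q : E m × E N => (q.2, S q.2 q.1))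
        (continuous_snd.prodMk hSa).continuousOn fun q hq => ⟨hq.2, mem_univ _⟩
    have hS2 : Continuous fun q : E m × E N => S q.2 := hSc.comp continuous_snd
    exact (((continuous_powerMap hp).comp hTa).clm_comp
      (hTc.comp continuous_snd)).continuousOn.sub (hfc.fun_smul hS2.continuousOn)
  have hk'0 : ∀ a, ∀ x ∈ Ω, x ∉ K → k' a x = 0 := by
    intro a x _ hxK
    have hx : ∀ i, x ∉ tsupport (d i) := fun i h => hxK (mem_iUnion.2 ⟨i, h⟩)
    have e1 : T x = 0 := by
      simp only [T, IsTestFunction.gradient_eq_zero_of_notMem (hx _)]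
      simp
    have e2 : S x = 0 := by
      simp only [S, image_eq_zero_of_notMem_tsupport (hx _)]
      simp
    simp [k', e1, e2]
  have hk'd : ∀ a, ∀ x ∈ Ω, HasFDerivAt (fun a => k a x) (k' a x) a := by
    intro a x hx
    refine HasFDerivAt.sub ?_ ?_
    · exact (hasFDerivAt_norm_rpow_div hp (T x a)).comp a (T x).hasFDerivAt
    · exact (h1.hasDerivAt_primitiveF hx (S x a)).comp_hasFDerivAt a (S x).hasFDerivAt
  obtain ⟨hki, hkd, hkc⟩ := hasFDerivAt_integral_of_continuousOn hΩ hΩb hK hKΩ (k := k) (k' := k')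
    (fun a => (hi1 a).sub (hi2 a)) hk'c hk'0 hk'd
  refine ⟨fun a => ∫ x in Ω, k' a x, hkc, fun a => ?_, fun a b => ?_⟩
  · refine (hkd a).congr_of_eventuallyEq (Eventually.of_forall fun a => ?_)
    simp only [k, functional]
    rw [integral_sub (hi1 a) (hi2 a), integral_const_mul]
    simp only [hT, hS]
  · simp only
    rw [ContinuousLinearMap.integral_apply (hki a), dFunctional,
      ← integral_sub _ (h1.integrableOn_f_mul hΩ hΩb (isTestFunction_comb hd a)
        (isTestFunction_comb hd b))]
    · refine integral_congr_ae (ae_of_all _ fun x => ?_)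
      simp [k', hT, hS, powerMap_apply]
    · have := (isTestFunction_comb hd a).integrableOn_powerMap hp hΩb (isTestFunction_comb hd b)
      simp only [powerMap_apply] at this
      exact this

end Comb

/-! ### Ekeland's principle and approximate critical points of mountain pass type -/

/-- **Ekeland's variational principle**. -/
theorem exists_ekeland {X : Type*} [MetricSpace X] [CompleteSpace X] {Φ : X → ℝ}
    (hΦ : Continuous Φ) {b : ℝ} (hb : ∀ x, b ≤ Φ x) {ε : ℝ} (hε : 0 < ε) (x₀ : X) :
    ∃ x, Φ x ≤ Φ x₀ ∧ ∀ y, Φ x ≤ Φ y + ε * dist x y := by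
  -- The sets of Ekeland's order. The sequence below takes at each step an almost minimizer of Φ on
  -- the current set; its limit lies in all of these sets, and no point can improve on it.
  let S : X → Set X := fun x => {y | Φ y + ε * dist x y ≤ Φ x}
  have hself : ∀ x, x ∈ S x := fun x => by simp [S]
  have htrans : ∀ x y z, y ∈ S x → z ∈ S y → z ∈ S x := fun x y z hy hz => by
    simp only [S, mem_ofPred_eq] at hy hz ⊢
    have := mul_le_mul_of_nonneg_left (dist_triangle x y z) hε.le
    linarith
  have hbdd : ∀ x, BddBelow (Φ '' S x) := fun x => ⟨b, by rintro _ ⟨y, -, rfl⟩; exact hb y⟩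
  have hstep : ∀ (n : ℕ) (x : X), ∃ y ∈ S x, ∀ z ∈ S x, Φ y ≤ Φ z + 1 / (n + 1 : ℝ) := by
    intro n x
    obtain ⟨_, ⟨y, hy, rfl⟩, hlt⟩ := exists_lt_of_csInf_lt
      (show (Φ '' S x).Nonempty from ⟨_, x, hself x, rfl⟩)
      (show sInf (Φ '' S x) < sInf (Φ '' S x) + 1 / (n + 1 : ℝ) by
        have : 0 < 1 / (n + 1 : ℝ) := by positivity
        linarith)
    exact ⟨y, hy, fun z hz => by linarith [csInf_le (hbdd x) ⟨z, hz, rfl⟩]⟩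
  choose next hnext hmin using hstep
  let x : ℕ → X := fun n => Nat.rec x₀ (fun k y => next k y) n
  have hx : ∀ n, x (n + 1) = next n (x n) := fun n => rfl
  have hmem : ∀ n k, x (n + k) ∈ S (x n) := by
    intro n k
    induction k with
    | zero => exact hself _
    | succ k ih => exact htrans _ _ _ ih (by rw [← add_assoc, hx]; exact hnext _ _)
  have hanti : Antitone fun n => Φ (x n) := antitone_nat_of_succ_le fun n => by
    have h : Φ (x (n + 1)) + ε * dist (x n) (x (n + 1)) ≤ Φ (x n) := hmem n 1
    have : 0 ≤ ε * dist (x n) (x (n + 1)) := by positivity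
    linarith
  have hlim := tendsto_atTop_ciInf hanti ⟨b, by rintro _ ⟨n, rfl⟩; exact hb _⟩
  have hcau : CauchySeq x := by
    refine Metric.cauchySeq_iff'.2 fun δ hδ => ?_
    obtain ⟨n₀, hn₀⟩ := Metric.cauchySeq_iff'.1 hlim.cauchySeq (ε * δ) (by positivity)
    refine ⟨n₀, fun n hn => ?_⟩
    obtain ⟨k, rfl⟩ := Nat.exists_eq_add_of_le hn
    have h1 : Φ (x (n₀ + k)) + ε * dist (x n₀) (x (n₀ + k)) ≤ Φ (x n₀) := hmem n₀ k
    have h2 := hn₀ (n₀ + k) hn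
    rw [Real.dist_eq, abs_lt] at h2
    rw [dist_comm]
    exact lt_of_mul_lt_mul_left (by linarith : ε * dist (x n₀) (x (n₀ + k)) < ε * δ) hε.le
  obtain ⟨xs, hxs⟩ := cauchySeq_tendsto_of_complete hcau
  have hxsS : ∀ n, xs ∈ S (x n) := by
    intro n
    have hcl : IsClosed (S (x n)) :=
      isClosed_le (hΦ.add (continuous_const.mul (continuous_const.dist continuous_id)))
        continuous_const
    refine hcl.mem_of_tendsto hxs (eventually_atTop.2 ⟨n, fun k hk => ?_⟩)
    obtain ⟨j, rfl⟩ := Nat.exists_eq_add_of_le hk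
    exact hmem n j
  refine ⟨xs, ?_, fun y => ?_⟩
  · have h : Φ xs + ε * dist (x 0) xs ≤ Φ (x 0) := hxsS 0
    have : 0 ≤ ε * dist (x 0) xs := by positivity
    exact (by linarith : Φ xs ≤ Φ (x 0))
  · by_contra hcon
    have hy : y ∈ S xs := (not_le.1 hcon).le
    have h1 : ∀ n : ℕ, Φ xs ≤ Φ y + 1 / (n + 1 : ℝ) := fun n => by
      have h2 : Φ (x (n + 1)) ≤ Φ y + 1 / (n + 1 : ℝ) := by
        rw [hx]; exact hmin n (x n) y (htrans _ _ _ (hxsS n) hy)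
      have h3 : Φ xs + ε * dist (x (n + 1)) xs ≤ Φ (x (n + 1)) := hxsS (n + 1)
      have : 0 ≤ ε * dist (x (n + 1)) xs := by positivity
      linarith
    have h4 : Φ xs ≤ Φ y + 0 := ge_of_tendsto'
      (tendsto_one_div_add_atTop_nhds_zero_nat.const_add (Φ y)) h1
    have : 0 ≤ ε * dist xs y := by positivity
    linarith

/-! ### The mountain pass principle on a Hilbert space. -/

section MountainPass

variable {Y : Type*} [NormedAddCommGroup Y] [InnerProductSpace ℝ Y]

/-- A diffeomorphism that expands radially, used to turn almost critical points into almost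
critical points with an additional control of the radial derivative. -/
def radialExp (w : Y) : Y := Real.exp (‖w‖ ^ 2) • w

theorem hasFDerivAt_radialExp (w : Y) : HasFDerivAt (radialExp : Y → Y)
    (Real.exp (‖w‖ ^ 2) • ContinuousLinearMap.id ℝ Y +
      (Real.exp (‖w‖ ^ 2) • (2 • innerSL ℝ w)).smulRight w) w :=
  (((hasStrictFDerivAt_norm_sq w).hasFDerivAt).exp).smul (hasFDerivAt_id w)

theorem contDiff_radialExp : ContDiff ℝ 1 (radialExp : Y → Y) :=
  (Real.contDiff_exp.comp (contDiff_norm_sq ℝ)).smul contDiff_id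

variable [CompleteSpace Y]

/-- A continuous field of directions, of norm at most `1`, along which a function with derivative
`L` decreases. -/
def descentDir (ε : ℝ) (L : Y →L[ℝ] ℝ) : Y :=
  -((max ‖L‖ ε)⁻¹ • (InnerProductSpace.toDual ℝ Y).symm L)

theorem continuous_descentDir {ε : ℝ} (hε : 0 < ε) :
    Continuous (descentDir ε : (Y →L[ℝ] ℝ) → Y) := by
  refine ((Continuous.inv₀ (by fun_prop) fun L => ?_).smul
    (InnerProductSpace.toDual ℝ Y).symm.continuous).neg
  exact (lt_max_of_lt_right hε).ne'

theorem norm_descentDir_le {ε : ℝ} (hε : 0 < ε) (L : Y →L[ℝ] ℝ) : ‖descentDir ε L‖ ≤ 1 := by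
  have h : 0 < max ‖L‖ ε := lt_max_of_lt_right hε
  rw [descentDir, norm_neg, norm_smul, LinearIsometryEquiv.norm_map, norm_inv,
    Real.norm_of_nonneg h.le, inv_mul_le_one₀ h]
  exact le_max_left _ _

theorem apply_descentDir (ε : ℝ) (L : Y →L[ℝ] ℝ) :
    L (descentDir ε L) = -((max ‖L‖ ε)⁻¹ * ‖L‖ ^ 2) := by
  rw [descentDir, map_neg, map_smul, smul_eq_mul]
  have h : L ((InnerProductSpace.toDual ℝ Y).symm L) = ‖L‖ ^ 2 := by
    rw [← InnerProductSpace.toDual_symm_apply (𝕜 := ℝ) (y := L), real_inner_self_eq_norm_sq,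
      LinearIsometryEquiv.norm_map]
  rw [h]

/-- Ekeland's principle is applied to γ ↦ max g∘γ on the complete space of paths from 0 to e. If the
derivative exceeded 2ε wherever the almost minimal path lies above α − δ, pushing the path along a
descent field would lower its maximum by more than Ekeland allows. -/
theorem exists_approx_critical {g : Y → ℝ} {g' : Y → Y →L[ℝ] ℝ} (hg' : Continuous g')
    (hg : ∀ w, HasFDerivAt g (g' w) w) {e : Y} {α δ c : ℝ} (hδ : 0 < δ) (h0 : g 0 ≤ α - δ)
    (he : g e ≤ α - δ)
    (hpath : ∀ γ : C(unitInterval, Y), γ 0 = 0 → γ 1 = e → ∃ t, α ≤ g (γ t))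
    (γ₀ : C(unitInterval, Y)) (h00 : γ₀ 0 = 0) (h01 : γ₀ 1 = e) (hc : ∀ t, g (γ₀ t) ≤ c)
    {ε : ℝ} (hε : 0 < ε) :
    ∃ w, α - δ ≤ g w ∧ g w ≤ c ∧ ‖g' w‖ ≤ 2 * ε := by
  have hgc : Continuous g := continuous_iff_continuousAt.2 fun w => (hg w).continuousAt
  let P : Set C(unitInterval, Y) := {γ | γ 0 = 0 ∧ γ 1 = e}
  have hP : IsClosed P := (isClosed_eq (by fun_prop) continuous_const).inter
    (isClosed_eq (by fun_prop) continuous_const)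
  have : CompleteSpace P := hP.completeSpace_coe
  let Φ : P → ℝ := fun γ => sSup ((fun t => g (γ.1 t)) '' univ)
  have hΦc : Continuous Φ := by
    refine isCompact_univ.continuous_sSup (f := fun (γ : P) t => g (γ.1 t)) ?_
    exact hgc.comp (by fun_prop : Continuous fun q : P × unitInterval => q.1.1 q.2)
  have hmax : ∀ γ : P, ∃ t, Φ γ = g (γ.1 t) := fun γ => by
    obtain ⟨t, -, ht⟩ := isCompact_univ.exists_sSup_image_eq (univ_nonempty)
      (hgc.comp γ.1.continuous).continuousOn
    exact ⟨t, ht⟩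
  have hle : ∀ (γ : P) t, g (γ.1 t) ≤ Φ γ := fun γ t =>
    le_csSup (isCompact_univ.image (hgc.comp γ.1.continuous)).bddAbove ⟨t, mem_univ _, rfl⟩
  have hΦα : ∀ γ : P, α ≤ Φ γ := fun γ => by
    obtain ⟨t, ht⟩ := hpath γ.1 γ.2.1 γ.2.2
    exact ht.trans (hle γ t)
  obtain ⟨γ, hγ, hek⟩ := exists_ekeland hΦc hΦα hε ⟨γ₀, h00, h01⟩
  have hγc : ∀ t, g (γ.1 t) ≤ c := fun t => by
    obtain ⟨s, hs⟩ := hmax ⟨γ₀, h00, h01⟩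
    exact (hle γ t).trans (hγ.trans (hs.le.trans (hc s)))
  by_contra hcon
  push Not at hcon
  have hlarge : ∀ t, α - δ ≤ g (γ.1 t) → 2 * ε < ‖g' (γ.1 t)‖ := fun t ht =>
    hcon _ ht (hγc t)
  obtain ⟨r, hr, hunif⟩ : ∃ r > 0, ∀ t, ∀ z : Y, ‖z - γ.1 t‖ < r →
      ‖g' z - g' (γ.1 t)‖ ≤ ε / 2 := by
    have hcomp : IsCompact (range γ.1) := isCompact_range γ.1.continuous
    have hu := hcomp.uniformContinuousAt_of_continuousAt g' (fun a _ => hg'.continuousAt)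
      (Metric.dist_mem_uniformity (half_pos hε))
    obtain ⟨r, hr, h⟩ := Metric.mem_uniformity_dist.1 hu
    refine ⟨r, hr, fun t z hz => ?_⟩
    have h1 := h (a := γ.1 t) (b := z) (by rwa [dist_comm, dist_eq_norm]) ⟨t, rfl⟩
    simp only [mem_ofPred_eq] at h1
    rw [dist_comm, dist_eq_norm] at h1
    exact h1.le
  -- The cut-off vanishes where g ≤ α − δ, in particular at the endpoints, and equals 1 where g ≥ α
  -- − δ/2.
  let χ : unitInterval → ℝ := fun t => max 0 (min 1 ((g (γ.1 t) - (α - δ)) / (δ / 2)))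
  have hχc : Continuous χ := by
    have := hgc.comp γ.1.continuous
    simp only [Function.comp_def] at this
    fun_prop
  have hχ0 : ∀ t, 0 ≤ χ t := fun t => le_max_left _ _
  have hχ1 : ∀ t, χ t ≤ 1 := fun t => max_le zero_le_one (min_le_left _ _)
  have hχz : ∀ t, g (γ.1 t) ≤ α - δ → χ t = 0 := fun t ht => by
    refine max_eq_left ((min_le_right _ _).trans ?_)
    exact div_nonpos_of_nonpos_of_nonneg (by linarith) (by positivity)
  have hχo : ∀ t, α - δ / 2 ≤ g (γ.1 t) → χ t = 1 := fun t ht => by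
    have : 1 ≤ (g (γ.1 t) - (α - δ)) / (δ / 2) := by
      rw [le_div_iff₀ (by positivity)]; linarith
    simp only [χ]
    rw [min_eq_left this, max_eq_right zero_le_one]
  let v : unitInterval → Y := fun t => χ t • descentDir ε (g' (γ.1 t))
  have hvc : Continuous v :=
    hχc.smul ((continuous_descentDir hε).comp (hg'.comp γ.1.continuous))
  have hv1 : ∀ t, ‖v t‖ ≤ 1 := fun t => by
    rw [norm_smul, Real.norm_of_nonneg (hχ0 t)]
    exact mul_le_one₀ (hχ1 t) (norm_nonneg _) (norm_descentDir_le hε _)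
  have hvneg : ∀ t, g' (γ.1 t) (v t) ≤ 0 := fun t => by
    simp only [v, map_smul, smul_eq_mul, apply_descentDir]
    have : 0 < max ‖g' (γ.1 t)‖ ε := lt_max_of_lt_right hε
    have h2 : 0 ≤ (max ‖g' (γ.1 t)‖ ε)⁻¹ * ‖g' (γ.1 t)‖ ^ 2 := by positivity
    nlinarith [hχ0 t]
  have hvdrop : ∀ t, α - δ / 2 ≤ g (γ.1 t) → g' (γ.1 t) (v t) ≤ -(2 * ε) := fun t ht => by
    have h2 := hlarge t (by linarith)
    simp only [v, map_smul, smul_eq_mul, apply_descentDir, hχo t ht]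
    rw [max_eq_left (by linarith), sq, ← mul_assoc, inv_mul_cancel₀ (by linarith)]
    linarith
  -- The bound r/2 keeps the deformed path where g' varies by at most ε/2. The bound δ/(2ε) ensures
  -- that a point reaching the level α after the deformation started above α − δ/2, where the
  -- cut-off is 1.
  set s := min (r / 2) (δ / (2 * ε)) with hs
  have hs0 : 0 < s := lt_min (by positivity) (by positivity)
  have hsr : s < r := (min_le_left _ _).trans_lt (by linarith)
  have hsδ : ε * s ≤ δ / 2 := by
    have h := mul_le_mul_of_nonneg_left (min_le_right (r / 2) (δ / (2 * ε))) hε.le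
    refine h.trans_eq ?_
    field_simp
  have hest : ∀ t, g (γ.1 t + s • v t) ≤ g (γ.1 t) + s * g' (γ.1 t) (v t) + ε / 2 * s := by
    intro t
    have hsv : ‖s • v t‖ ≤ s := by
      rw [norm_smul, Real.norm_of_nonneg hs0.le]
      exact mul_le_of_le_one_right hs0.le (hv1 t)
    have h := (convex_ball (γ.1 t) r).norm_image_sub_le_of_norm_hasFDerivWithin_le'
      (fun z _ => (hg z).hasFDerivWithinAt) (φ := g' (γ.1 t)) (C := ε / 2)
      (fun z hz => hunif t z (by rwa [← dist_eq_norm])) (Metric.mem_ball_self hr)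
      (show γ.1 t + s • v t ∈ Metric.ball (γ.1 t) r by
        rw [Metric.mem_ball, dist_eq_norm, add_sub_cancel_left]; linarith)
    rw [add_sub_cancel_left, map_smul, smul_eq_mul, Real.norm_eq_abs] at h
    have h2 := (le_abs_self _).trans h
    have h3 : ε / 2 * ‖s • v t‖ ≤ ε / 2 * s := by gcongr
    linarith
  let η : P := ⟨⟨fun t => γ.1 t + s • v t, by fun_prop⟩, by
    constructor
    · simp [v, γ.2.1, hχz 0 (by rw [γ.2.1]; exact h0)]
    · simp [v, γ.2.2, hχz 1 (by rw [γ.2.2]; exact he)]⟩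
  have hdist : dist γ η ≤ s := by
    rw [Subtype.dist_eq, ContinuousMap.dist_le hs0.le]
    intro t
    simp only [η, ContinuousMap.coe_mk]
    rw [dist_eq_norm, sub_add_cancel_left, norm_neg, norm_smul, Real.norm_of_nonneg hs0.le]
    exact mul_le_of_le_one_right hs0.le (hv1 t)
  obtain ⟨t, ht⟩ := hmax η
  have h4 : Φ η = g (γ.1 t + s • v t) := ht
  have htα : α ≤ g (γ.1 t + s • v t) := h4 ▸ hΦα η
  have hbig : α - δ / 2 ≤ g (γ.1 t) := by
    by_contra hlt
    have h1 := hest t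
    have h2 := mul_nonpos_of_nonneg_of_nonpos hs0.le (hvneg t)
    linarith
  -- At a maximum of the new path the deformation gained at least 2εs − εs/2 = 3εs/2, while
  -- Ekeland's inequality permits at most εs.
  have h1 := hest t
  have h2 := mul_le_mul_of_nonneg_left (hvdrop t hbig) hs0.le
  have h3 := hek η
  have h5 := hle γ t
  have h6 := mul_le_mul_of_nonneg_left hdist hε.le
  have h7 : 0 < ε * s := by positivity
  linarith

/-- Mountain pass principle with Cerami's control of the radial derivative. -/
theorem exists_approx_critical_radial {g : Y → ℝ} {g' : Y → Y →L[ℝ] ℝ} (hg' : Continuous g')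
    (hg : ∀ w, HasFDerivAt g (g' w) w) {e : Y} {α c : ℝ} (hα : 0 < α) (h0 : g 0 ≤ 0)
    (he : g e ≤ 0)
    (hpath : ∀ γ : C(unitInterval, Y), γ 0 = 0 → γ 1 = e → ∃ t, α ≤ g (γ t))
    (hc : ∀ s : ℝ, 0 ≤ s → s ≤ 1 → g (s • e) ≤ c) {ε : ℝ} (hε : 0 < ε) :
    ∃ u, α / 2 ≤ g u ∧ g u ≤ c ∧ |g' u u| ≤ ε ∧ ∀ z, |g' u z| ≤ ε * ‖z‖ := by
  -- Choose r so that `radialExp` sends r e to e; it then sends paths from 0 to r e to paths from 0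
  -- to e.
  obtain ⟨r, ⟨hr0, hr1⟩, hr⟩ : (1 : ℝ) ∈ (fun r : ℝ => Real.exp (‖r • e‖ ^ 2) * r) '' Icc 0 1 := by
    refine intermediate_value_Icc zero_le_one (by fun_prop) ⟨by simp, ?_⟩
    simp only [mul_one]
    exact Real.one_le_exp (by positivity)
  have hre : radialExp (r • e) = e := by
    simp only at hr
    rw [radialExp, smul_smul, hr, one_smul]
  have hr00 : radialExp (0 : Y) = 0 := by simp [radialExp]
  have hΨc : Continuous (radialExp : Y → Y) := contDiff_radialExp.continuous
  have hD : ∀ w : Y, HasFDerivAt (radialExp : Y → Y) (fderiv ℝ radialExp w) w := fun w =>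
    (hasFDerivAt_radialExp w).differentiableAt.hasFDerivAt
  have hDv : ∀ w z : Y, fderiv ℝ radialExp w z =
      Real.exp (‖w‖ ^ 2) • (z + (2 * inner ℝ w z) • w) := fun w z => by
    rw [(hasFDerivAt_radialExp w).fderiv]
    simp [smul_smul]
  have hline : ∀ t : unitInterval, g (radialExp ((t : ℝ) • r • e)) ≤ c := by
    intro t
    have ht0 := t.2.1
    have ht1 := t.2.2
    have e1 : radialExp ((t : ℝ) • r • e) =
        (Real.exp (‖(t : ℝ) • r • e‖ ^ 2) * (t * r)) • e := by
      rw [radialExp, smul_smul, smul_smul, mul_assoc]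
    rw [e1]
    refine hc _ (by positivity) ?_
    simp only at hr
    calc Real.exp (‖(t : ℝ) • r • e‖ ^ 2) * (t * r) ≤ Real.exp (‖r • e‖ ^ 2) * (1 * r) := by
          gcongr
          rw [norm_smul, Real.norm_of_nonneg ht0]
          exact mul_le_of_le_one_left (norm_nonneg _) ht1
      _ = 1 := by rw [one_mul, hr]
  obtain ⟨w, hw1, hw2, hw3⟩ := exists_approx_critical (g := fun w => g (radialExp w))
    (g' := fun w => (g' (radialExp w)).comp (fderiv ℝ radialExp w))
    ((hg'.comp hΨc).clm_comp (contDiff_radialExp.continuous_fderiv one_ne_zero))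
    (fun w => (hg _).comp w (hD w)) (e := r • e) (α := α) (δ := α / 2) (c := c) (half_pos hα)
    (by rw [hr00]; linarith) (by rw [hre]; linarith)
    (fun γ hγ0 hγ1 => hpath ⟨fun t => radialExp (γ t), hΨc.comp γ.continuous⟩
      (by simp [hγ0, hr00]) (by simp [hγ1, hre]))
    ⟨fun t => (t : ℝ) • r • e, by fun_prop⟩ (by simp) (by simp) hline
    (ε := ε / 4) (by positivity)
  have hbound : ∀ z, |g' (radialExp w) (fderiv ℝ radialExp w z)| ≤ ε / 2 * ‖z‖ := fun z => by
    have h := ((g' (radialExp w)).comp (fderiv ℝ radialExp w)).le_of_opNorm_le hw3 z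
    rw [Real.norm_eq_abs] at h
    refine h.trans_eq (by ring)
  have hpos : 0 < 1 + 2 * ‖w‖ ^ 2 := by positivity
  refine ⟨radialExp w, by linarith, hw2, ?_, fun z => ?_⟩
  · have h := hbound w
    -- The radial stretching produces the factor 1 + 2‖w‖², which dominates ‖w‖. A bound
    -- proportional to ‖w‖ for the pulled-back derivative thus becomes a uniform bound for g'(u)u.
    have e1 : fderiv ℝ radialExp w w = (1 + 2 * ‖w‖ ^ 2) • radialExp w := by
      rw [hDv, real_inner_self_eq_norm_sq, radialExp]
      module
    rw [e1, map_smul, smul_eq_mul, abs_mul, abs_of_pos hpos] at h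
    have h2 : ε / 2 * ‖w‖ ≤ (1 + 2 * ‖w‖ ^ 2) * ε := by
      nlinarith [sq_nonneg (‖w‖ - 1), norm_nonneg w]
    exact le_of_mul_le_mul_left (h.trans h2) hpos
  -- The preimage of e^{‖w‖²} z under the derivative of `radialExp`. Its norm is at most 2‖z‖ and
  -- the exponential is at least 1, so the bound on g' loses only a factor 2.
  · let z' := z - (2 * inner ℝ w z / (1 + 2 * ‖w‖ ^ 2)) • w
    have e1 : fderiv ℝ radialExp w z' = Real.exp (‖w‖ ^ 2) • z := by
      rw [hDv]
      congr 1
      simp only [z']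
      rw [inner_sub_right, real_inner_smul_right, real_inner_self_eq_norm_sq]
      have : 2 * (inner ℝ w z - 2 * inner ℝ w z / (1 + 2 * ‖w‖ ^ 2) * ‖w‖ ^ 2) =
          2 * inner ℝ w z / (1 + 2 * ‖w‖ ^ 2) := by
        field_simp
        ring
      rw [this, sub_add_cancel]
    have h := hbound z'
    have h1 : 1 ≤ Real.exp (‖w‖ ^ 2) := Real.one_le_exp (by positivity)
    rw [e1, map_smul, smul_eq_mul, abs_mul, abs_of_pos (Real.exp_pos _)] at h
    have hz' : ‖z'‖ ≤ 2 * ‖z‖ := by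
      have h2 : ‖(2 * inner ℝ w z / (1 + 2 * ‖w‖ ^ 2)) • w‖ ≤ ‖z‖ := by
        rw [norm_smul, Real.norm_eq_abs, abs_div, abs_of_pos hpos, abs_mul, abs_two,
          div_mul_eq_mul_div, div_le_iff₀ hpos]
        nlinarith [abs_real_inner_le_norm w z, norm_nonneg w, norm_nonneg z,
          mul_le_mul_of_nonneg_right (abs_real_inner_le_norm w z) (norm_nonneg w)]
      exact (norm_sub_le _ _).trans (by linarith)
    calc |g' (radialExp w) z| ≤ Real.exp (‖w‖ ^ 2) * |g' (radialExp w) z| :=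
          le_mul_of_one_le_left (abs_nonneg _) h1
      _ ≤ ε / 2 * ‖z'‖ := h
      _ ≤ ε / 2 * (2 * ‖z‖) := by gcongr
      _ = ε * ‖z‖ := by ring

end MountainPass

/-! ### Mountain pass geometry -/

theorem lambda1_mul_integral_le (hp : 1 < p) (hΩb : Bornology.IsBounded Ω) {φ : E N → ℝ}
    (hφ : IsTestFunction Ω φ) :
    lambda1 Ω p * ∫ x in Ω, |φ x| ^ p ≤ ∫ x in Ω, ‖gradient φ x‖ ^ p := by
  have hp0 : 0 < p := by linarith
  have hi : 0 ≤ ∫ x in Ω, |φ x| ^ p := integral_nonneg fun x => by positivity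
  rcases hi.eq_or_lt with h0 | hpos
  · rw [← h0, mul_zero]
    exact integral_nonneg fun x => by positivity
  · rw [← le_div_iff₀ hpos]
    refine csInf_le ⟨0, ?_⟩ ⟨φ, gradient φ, hφ.memW01p hΩb hp.le, fun hae => ?_, rfl⟩
    · rintro _ ⟨u, G, -, -, rfl⟩
      exact div_nonneg (integral_nonneg fun x => by positivity)
        (integral_nonneg fun x => by positivity)
    · refine hpos.ne' (integral_eq_zero_of_ae (hae.mono fun x hx => ?_))
      simp [hx, Real.zero_rpow hp0.ne']

theorem integral_norm_gradient_const_mul {φ : E N → ℝ} (hφ : IsTestFunction Ω φ) {c : ℝ}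
    (hc : 0 ≤ c) :
    ∫ x in Ω, ‖gradient (fun y => c * φ y) x‖ ^ p = c ^ p * ∫ x in Ω, ‖gradient φ x‖ ^ p := by
  rw [← integral_const_mul]
  refine integral_congr_ae (ae_of_all _ fun x => ?_)
  simp only
  rw [gradient_const_mul (hφ.differentiableAt x), norm_smul_rpow hc]

/-- On the level set of energy ρ, pJ ≥ (1 − μ/λ₁)ρ − C·C_S ρ^{p*/p}. Since p*/p > 1, the first term
wins for small ρ. -/
theorem exists_functional_ge (hp : 1 < p) (hpN : p < N) (hΩ : IsOpen Ω)
    (hΩb : Bornology.IsBounded Ω) (hne : Ω.Nonempty) (hf : SCPI Ω p f) (h1 : L1 Ω f)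
    (h3 : L3 Ω p f) (h4 : L4 Ω p f) :
    ∃ ρ α : ℝ, 0 < ρ ∧ 0 < α ∧ ∀ φ : E N → ℝ, IsTestFunction Ω φ →
      ∫ x in Ω, ‖gradient φ x‖ ^ p = ρ → α ≤ functional Ω p f φ := by
  have hp0 : 0 < p := by linarith
  have hq0 := pStar_pos hp hpN
  have hpq := lt_pStar hp hpN
  obtain ⟨μ, C, hμ0, hμ, hC, hgr⟩ := exists_growth_zero hne hp hpN hf h1 h3 h4
  obtain ⟨CS, hCS, hsob⟩ := exists_sobolev_const hp hpN
  have hl : 0 < lambda1 Ω p := hμ0.trans_lt hμ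
  set κ := 1 - μ / lambda1 Ω p with hκ
  have hκ0 : 0 < κ := by rw [hκ, sub_pos, div_lt_one hl]; exact hμ
  have hq1 : 0 < pStar N p / p - 1 := by rw [sub_pos, lt_div_iff₀ hp0]; linarith
  set B := C * CS + 1 with hB
  have hB0 : 0 < B := by positivity
  -- This ρ solves B ρ^{p*/p} = κρ/2, so half of the leading term survives; the `+ 1` in `B` avoids
  -- division by zero.
  set ρ := (κ / (2 * B)) ^ (pStar N p / p - 1)⁻¹ with hρ
  have hρ0 : 0 < ρ := by positivity
  have hρpow : ρ ^ (pStar N p / p) = κ / (2 * B) * ρ := by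
    have e : ρ ^ (pStar N p / p - 1) = κ / (2 * B) :=
      Real.rpow_inv_rpow (by positivity) hq1.ne'
    rw [← e, ← Real.rpow_add_one hρ0.ne', sub_add_cancel]
  refine ⟨ρ, κ * ρ / (2 * p), hρ0, by positivity, fun φ hφ hen => ?_⟩
  have i1 : IntegrableOn (fun x => |φ x| ^ p) Ω :=
    integrable_norm_rpow_of_memLp hp0 (hφ.memLp _)
  have i2 : IntegrableOn (fun x => |φ x| ^ pStar N p) Ω :=
    integrable_norm_rpow_of_memLp hq0 (hφ.memLp _)
  have hF : p * ∫ x in Ω, primitiveF f x (φ x) ≤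
      μ * (∫ x in Ω, |φ x| ^ p) + C * ∫ x in Ω, |φ x| ^ pStar N p := by
    rw [← integral_const_mul, ← integral_const_mul, ← integral_const_mul,
      ← integral_add (i1.const_mul μ) (i2.const_mul C)]
    refine integral_mono_ae ((h1.integrableOn_primitiveF hΩ hΩb hφ).const_mul p)
      ((i1.const_mul μ).add (i2.const_mul C)) ?_
    filter_upwards [ae_restrict_mem hΩ.measurableSet] with x hx
    exact hgr x hx _
  have hP := lambda1_mul_integral_le hp hΩb hφ
  have hS := hsob Ω φ hφ
  rw [hen] at hP hS
  rw [hρpow] at hS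
  have h5 : μ * ∫ x in Ω, |φ x| ^ p ≤ μ / lambda1 Ω p * ρ := by
    rw [div_mul_eq_mul_div, le_div_iff₀ hl]
    nlinarith
  have h6 : C * ∫ x in Ω, |φ x| ^ pStar N p ≤ κ / 2 * ρ := by
    calc C * ∫ x in Ω, |φ x| ^ pStar N p ≤ C * (CS * (κ / (2 * B) * ρ)) := by gcongr
      _ = (C * CS) * (κ / (2 * B) * ρ) := by ring
      _ ≤ B * (κ / (2 * B) * ρ) := by gcongr; linarith
      _ = κ / 2 * ρ := by field_simp
  rw [functional, hen, div_le_iff₀ (by positivity)]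
  have h7 : (1 / p * ρ - ∫ x in Ω, primitiveF f x (φ x)) * (2 * p) =
      2 * (ρ - p * ∫ x in Ω, primitiveF f x (φ x)) := by
    field_simp
  rw [h7]
  have h8 : μ / lambda1 Ω p = 1 - κ := by rw [hκ]; ring
  rw [h8] at h5
  linarith

theorem exists_bump (hΩ : IsOpen Ω) (hne : Ω.Nonempty) :
    ∃ φ : E N → ℝ, IsTestFunction Ω φ ∧ (∀ x, 0 ≤ φ x) ∧
      ∃ B ⊆ Ω, MeasurableSet B ∧ 0 < volume.real B ∧ ∀ x ∈ B, φ x = 1 := by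
  obtain ⟨x₀, hx₀⟩ := hne
  obtain ⟨r, hr, hrΩ⟩ := Metric.nhds_basis_closedBall.mem_iff.1 (hΩ.mem_nhds hx₀)
  let b : ContDiffBump x₀ := ⟨r / 2, r, by positivity, by linarith⟩
  refine ⟨b, ⟨b.contDiff, b.hasCompactSupport, by rw [b.tsupport_eq]; exact hrΩ⟩,
    fun x => b.nonneg, Metric.closedBall x₀ (r / 2),
    (Metric.closedBall_subset_closedBall (by linarith)).trans hrΩ,
    measurableSet_closedBall, ?_, fun x hx => b.one_of_mem_closedBall hx⟩
  rw [Measure.real, ENNReal.toReal_pos_iff]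
  exact ⟨Metric.measure_closedBall_pos volume x₀ (by positivity), measure_closedBall_lt_top⟩

theorem exists_functional_nonpos (hp : 1 < p) (hΩ : IsOpen Ω)
    (hΩb : Bornology.IsBounded Ω) (hne : Ω.Nonempty) (h1 : L1 Ω f)
    (h2 : L2 Ω p f) (hl : 0 < lambda1 Ω p) (ρ : ℝ) :
    ∃ e : E N → ℝ, IsTestFunction Ω e ∧ functional Ω p f e ≤ 0 ∧
      ρ < ∫ x in Ω, ‖gradient e x‖ ^ p := by
  have hp0 : 0 < p := by linarith
  obtain ⟨φ, hφ, hφ0, B, hBΩ, hBm, hB, hφB⟩ := exists_bump hΩ hne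
  have hfin : volume B ≠ ⊤ := (hΩb.subset hBΩ).measure_lt_top.ne
  set A := ∫ x in Ω, ‖gradient φ x‖ ^ p with hA
  have hA0 : 0 < A := by
    refine lt_of_lt_of_le (mul_pos hl ?_) (lambda1_mul_integral_le hp hΩb hφ)
    have i1 : IntegrableOn (fun x => |φ x| ^ p) Ω :=
      integrable_norm_rpow_of_memLp hp0 (hφ.memLp _)
    calc 0 < volume.real B := hB
      _ = ∫ x in B, (1 : ℝ) := by simp
      _ = ∫ x in B, |φ x| ^ p := setIntegral_congr_fun hBm fun x hx => by simp [hφB x hx]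
      _ ≤ ∫ x in Ω, |φ x| ^ p := setIntegral_mono_set i1
          (ae_of_all _ fun x => by positivity) hBΩ.eventuallyLE
  -- On B the multiple R φ equals R. With this constant in (L2), the integral of F over B alone
  -- offsets the gradient term R^p A/p.
  have ev1 := h2 (A / p / volume.real B)
  have ev2 : ∀ᶠ R : ℝ in atTop, ρ < R ^ p * A :=
    ((tendsto_rpow_atTop hp0).atTop_mul_const hA0).eventually_gt_atTop ρ
  obtain ⟨R, hR1, hR2, hR3⟩ := (ev1.and (ev2.and (eventually_gt_atTop 0))).exists
  refine ⟨fun x => R * φ x, hφ.const_mul R, ?_, ?_⟩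
  · rw [functional, integral_norm_gradient_const_mul hφ hR3.le, sub_nonpos]
    have hint := h1.integrableOn_primitiveF hΩ hΩb (hφ.const_mul R)
    have hRp : 0 < R ^ p := by positivity
    calc 1 / p * (R ^ p * A) = ∫ x in B, A / p / volume.real B * R ^ p := by
          rw [setIntegral_const, smul_eq_mul]
          field_simp
      _ ≤ ∫ x in B, primitiveF f x (R * φ x) := by
          refine setIntegral_mono_on (integrableOn_const hfin) (hint.mono_set hBΩ) hBm
            fun x hx => ?_
          have := hR1 x (hBΩ hx)
          rw [le_div_iff₀ hRp] at this
          rwa [hφB x hx, mul_one]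
      _ ≤ ∫ x in Ω, primitiveF f x (R * φ x) := by
          refine setIntegral_mono_set hint ?_ hBΩ.eventuallyLE
          filter_upwards [ae_restrict_mem hΩ.measurableSet] with x hx
          exact h1.primitiveF_nonneg hx _
  · rwa [integral_norm_gradient_const_mul hφ hR3.le]

/-- Since F ≥ 0, the energy of e bounds J on the segment from 0 to e. This upper level depends on e
alone, so it is common to all the finite-dimensional spaces. -/
theorem functional_le_of_smul (hp : 1 < p) (hΩ : IsOpen Ω) (h1 : L1 Ω f) {e : E N → ℝ}
    (he : IsTestFunction Ω e) {s : ℝ} (hs0 : 0 ≤ s) (hs1 : s ≤ 1) :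
    functional Ω p f (fun x => s * e x) ≤ 1 / p * ∫ x in Ω, ‖gradient e x‖ ^ p := by
  have hp0 : 0 < p := by linarith
  rw [functional, integral_norm_gradient_const_mul he hs0]
  have hF : 0 ≤ ∫ x in Ω, primitiveF f x (s * e x) :=
    setIntegral_nonneg hΩ.measurableSet fun x hx => h1.primitiveF_nonneg hx _
  have hE : 0 ≤ ∫ x in Ω, ‖gradient e x‖ ^ p := integral_nonneg fun x => by positivity
  have hsp : s ^ p * ∫ x in Ω, ‖gradient e x‖ ^ p ≤ ∫ x in Ω, ‖gradient e x‖ ^ p :=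
    mul_le_of_le_one_left hE (Real.rpow_le_one hs0 hs1 hp0.le)
  have := mul_le_mul_of_nonneg_left hsp (by positivity : 0 ≤ 1 / p)
  linarith

/-- The energy is p times the functional of the zero nonlinearity, whose differentiability is
already known. -/
theorem continuous_energy_comb {m : ℕ} {d : Fin m → E N → ℝ} (hp : 1 < p) (hΩ : IsOpen Ω)
    (hΩb : Bornology.IsBounded Ω) (hd : ∀ i, IsTestFunction Ω (d i)) :
    Continuous fun a : E m => ∫ x in Ω, ‖gradient (comb d a) x‖ ^ p := by
  have h1 : L1 Ω (fun (_ : E N) (_ : ℝ) => (0 : ℝ)) :=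
    ⟨continuousOn_const, fun _ _ _ _ => le_rfl, fun _ _ _ _ => rfl⟩
  obtain ⟨g', -, hg, -⟩ := exists_hasFDerivAt_functional hp hΩ hΩb h1 hd
  have hc : Continuous fun a : E m => functional Ω p (fun _ _ => 0) (comb d a) :=
    continuous_iff_continuousAt.2 fun a => (hg a).continuousAt
  have e : ∀ a : E m, ∫ x in Ω, ‖gradient (comb d a) x‖ ^ p =
      p * functional Ω p (fun _ _ => 0) (comb d a) := fun a => by
    simp only [functional, primitiveF, intervalIntegral.integral_zero, integral_zero, sub_zero]
    field_simp
  simp only [e]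
  fun_prop

/-- Almost critical points of the functional restricted to finite-dimensional spaces. -/
theorem exists_galerkin (hp : 1 < p) (hΩ : IsOpen Ω) (hΩb : Bornology.IsBounded Ω)
    (h1 : L1 Ω f) {ρ α : ℝ} (hρ : 0 < ρ) (hα : 0 < α)
    (hge : ∀ φ : E N → ℝ, IsTestFunction Ω φ →
      ∫ x in Ω, ‖gradient φ x‖ ^ p = ρ → α ≤ functional Ω p f φ)
    {e : E N → ℝ} (he : IsTestFunction Ω e) (he0 : functional Ω p f e ≤ 0)
    (heρ : ρ < ∫ x in Ω, ‖gradient e x‖ ^ p) {m : ℕ} {d : Fin m → E N → ℝ}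
    (hd : ∀ i, IsTestFunction Ω (d i)) {ε : ℝ} (hε : 0 < ε) :
    ∃ u : E N → ℝ, IsTestFunction Ω u ∧ α / 2 ≤ functional Ω p f u ∧
      functional Ω p f u ≤ 1 / p * ∫ x in Ω, ‖gradient e x‖ ^ p ∧
      |dFunctional Ω p f u u| ≤ ε ∧ ∀ i, |dFunctional Ω p f u (d i)| ≤ ε := by
  have hp0 : 0 < p := by linarith
  -- Adjoining e to the directions puts the end of the mountain pass paths into the span.
  let D : Fin (m + 1) → E N → ℝ := Fin.cons e d
  have hD : ∀ i, IsTestFunction Ω (D i) := fun i => Fin.cases he hd i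
  obtain ⟨g', hg'c, hg, hg'⟩ := exists_hasFDerivAt_functional (p := p) hp hΩ hΩb h1 hD
  have hcont := continuous_energy_comb (p := p) hp hΩ hΩb hD
  let a₀ : E (m + 1) := EuclideanSpace.single 0 1
  have ha₀ : ∀ s : ℝ, comb D (s • a₀) = fun x => s * e x := fun s => by
    rw [comb_smul, comb_single]
    simp [D]
  have ha₀' : comb D a₀ = e := by simpa using ha₀ 1
  have h00 : comb D 0 = fun _ => 0 := by simpa using ha₀ 0
  have hF0 : functional Ω p f (comb D 0) = 0 := by
    rw [h00, functional]
    have hgz : ∀ x : E N, gradient (fun _ : E N => (0 : ℝ)) x = 0 := fun x => by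
      simp [gradient_eq_toDual_symm]
    simp [hgz, L1.primitiveF_zero, Real.zero_rpow hp0.ne']
  have hE0 : ∫ x in Ω, ‖gradient (comb D 0) x‖ ^ p = 0 := by
    have hgz : ∀ x : E N, gradient (fun _ : E N => (0 : ℝ)) x = 0 := fun x => by
      simp [gradient_eq_toDual_symm]
    rw [h00]
    simp [hgz, Real.zero_rpow hp0.ne']
  obtain ⟨a, ha1, ha2, ha3, ha4⟩ := exists_approx_critical_radial hg'c hg (e := a₀)
    (c := 1 / p * ∫ x in Ω, ‖gradient e x‖ ^ p) hα hF0.le (by rw [ha₀']; exact he0)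
    (fun γ hγ0 hγ1 => by
      have hc : Continuous fun t => ∫ x in Ω, ‖gradient (comb D (γ t)) x‖ ^ p :=
        hcont.comp γ.continuous
      have hmem : ρ ∈ Icc (∫ x in Ω, ‖gradient (comb D (γ 0)) x‖ ^ p)
          (∫ x in Ω, ‖gradient (comb D (γ 1)) x‖ ^ p) := by
        rw [hγ0, hγ1, hE0, ha₀']
        exact ⟨hρ.le, heρ.le⟩
      -- The energy is continuous along the path and goes from 0 to above ρ, so it takes the value
      -- ρ.
      obtain ⟨t, ht⟩ := mem_range_of_exists_le_of_exists_ge hc ⟨0, hmem.1⟩ ⟨1, hmem.2⟩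
      exact ⟨t, hge _ (isTestFunction_comb hD _) ht⟩)
    (fun s hs0 hs1 => by rw [ha₀]; exact functional_le_of_smul hp hΩ h1 he hs0 hs1) hε
  refine ⟨comb D a, isTestFunction_comb hD a, ha1, ha2, by rwa [← hg'], fun i => ?_⟩
  have h := ha4 (EuclideanSpace.single i.succ 1)
  rw [hg', comb_single] at h
  simpa [D] using h

/-! ### Countable dense families of test functions -/

/-- Pairs (φ, ∇φ) live in a separable metric space of continuous functions on the compact closure of
Ω, and subsets of it are separable. Hence the dense sequence can be chosen inside the class `P`. -/
theorem exists_seq_dense_of_pred (hΩb : Bornology.IsBounded Ω) (P : (E N → ℝ) → Prop)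
    (hP : ∀ φ, P φ → IsTestFunction Ω φ) (hP0 : ∃ φ, P φ) :
    ∃ d : ℕ → E N → ℝ, (∀ n, P (d n)) ∧ ∀ φ, P φ → ∀ ε > 0, ∃ n, ∀ x ∈ Ω,
      |d n x - φ x| < ε ∧ ‖gradient (d n) x - gradient φ x‖ < ε := by
  let K : Set (E N) := closure Ω
  have : CompactSpace K := isCompact_iff_compactSpace.1 hΩb.isCompact_closure
  let ι : {φ // P φ} → C(K, ℝ) × C(K, E N) := fun φ =>
    (⟨fun x => φ.1 x, (hP φ.1 φ.2).continuous.comp continuous_subtype_val⟩,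
      ⟨fun x => gradient φ.1 x, (hP φ.1 φ.2).continuous_gradient.comp continuous_subtype_val⟩)
  have : Nonempty (range ι) := by
    obtain ⟨φ, hφ⟩ := hP0
    exact ⟨⟨_, ⟨φ, hφ⟩, rfl⟩⟩
  let q := TopologicalSpace.denseSeq (range ι)
  choose d hd using fun n => (q n).2
  refine ⟨fun n => (d n).1, fun n => (d n).2, fun φ hφ ε hε => ?_⟩
  obtain ⟨n, hn⟩ := (TopologicalSpace.denseRange_denseSeq (range ι)).exists_dist_lt
    ⟨ι ⟨φ, hφ⟩, ⟨φ, hφ⟩, rfl⟩ hε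
  refine ⟨n, fun x hx => ?_⟩
  have h1 : dist (ι ⟨φ, hφ⟩) (ι (d n)) < ε := by rw [hd n]; exact hn
  rw [Prod.dist_eq, max_lt_iff, ContinuousMap.dist_lt_iff hε, ContinuousMap.dist_lt_iff hε] at h1
  have h2 := h1.1 ⟨x, subset_closure hx⟩
  have h3 := h1.2 ⟨x, subset_closure hx⟩
  rw [dist_comm] at h2 h3
  rw [← dist_eq_norm]
  exact ⟨h2, h3⟩

/-- Two dense sequences are interleaved, one among all test functions and one among the nonnegative
ones. Nonnegative approximants make Fatou's lemma applicable against a nonnegative weight. -/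
theorem exists_seq_dense (hΩb : Bornology.IsBounded Ω) :
    ∃ d : ℕ → E N → ℝ, (∀ n, IsTestFunction Ω (d n)) ∧
      ∀ φ, IsTestFunction Ω φ → ∀ ε > 0, ∃ n,
        (∀ x ∈ Ω, |d n x - φ x| < ε ∧ ‖gradient (d n) x - gradient φ x‖ < ε) ∧
        ((∀ x, 0 ≤ φ x) → ∀ x, 0 ≤ d n x) := by
  obtain ⟨d₁, hd₁, hdense₁⟩ := exists_seq_dense_of_pred hΩb (IsTestFunction Ω) (fun _ h => h)
    ⟨_, IsTestFunction.zero⟩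
  obtain ⟨d₂, hd₂, hdense₂⟩ := exists_seq_dense_of_pred hΩb
    (fun φ => IsTestFunction Ω φ ∧ ∀ x, 0 ≤ φ x) (fun _ h => h.1)
    ⟨_, IsTestFunction.zero, fun _ => le_rfl⟩
  refine ⟨fun n => Sum.elim d₁ d₂ (Equiv.natSumNatEquivNat.symm n), fun n => ?_,
    fun φ hφ ε hε => ?_⟩
  · simp only
    rcases Equiv.natSumNatEquivNat.symm n with k | k
    · exact hd₁ k
    · exact (hd₂ k).1
  · by_cases h0 : ∀ x, 0 ≤ φ x
    · obtain ⟨n, hn⟩ := hdense₂ φ ⟨hφ, h0⟩ ε hε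
      refine ⟨Equiv.natSumNatEquivNat (Sum.inr n), ?_, fun _ => ?_⟩
      · simpa using hn
      · simpa using (hd₂ n).2
    · obtain ⟨n, hn⟩ := hdense₁ φ hφ ε hε
      refine ⟨Equiv.natSumNatEquivNat (Sum.inl n), ?_, fun h => absurd h h0⟩
      simpa using hn

/-! ### Compactness -/

/-- Fatou's lemma for real-valued integrals, with integrability of the limit included. -/
theorem integrable_of_tendsto_ae {α : Type*} [MeasurableSpace α] {μ : Measure α}
    {g : ℕ → α → ℝ} {G : α → ℝ} {A : ℝ} (hg : ∀ n, Integrable (g n) μ)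
    (hg0 : ∀ n, ∀ᵐ x ∂μ, 0 ≤ g n x) (hA : ∀ n, ∫ x, g n x ∂μ ≤ A)
    (hlim : ∀ᵐ x ∂μ, Tendsto (fun n => g n x) atTop (𝓝 (G x))) :
    Integrable G μ ∧ ∫ x, G x ∂μ ≤ A := by
  have hGm : AEStronglyMeasurable G μ :=
    aestronglyMeasurable_of_tendsto_ae atTop (fun n => (hg n).1) hlim
  have hG0 : ∀ᵐ x ∂μ, 0 ≤ G x := by
    filter_upwards [hlim, ae_all_iff.2 hg0] with x hx hx0
    exact ge_of_tendsto' hx hx0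
  have hA0 : 0 ≤ A := (integral_nonneg_of_ae (hg0 0)).trans (hA 0)
  have hle : ∫⁻ x, ENNReal.ofReal (G x) ∂μ ≤ ENNReal.ofReal A := by
    calc ∫⁻ x, ENNReal.ofReal (G x) ∂μ
        = ∫⁻ x, liminf (fun n => ENNReal.ofReal (g n x)) atTop ∂μ := by
          refine lintegral_congr_ae (hlim.mono fun x hx => ?_)
          exact ((ENNReal.continuous_ofReal.tendsto _).comp hx).liminf_eq.symm
      _ ≤ liminf (fun n => ∫⁻ x, ENNReal.ofReal (g n x) ∂μ) atTop :=
          lintegral_liminf_le' fun n => (hg n).1.aemeasurable.ennreal_ofReal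
      _ ≤ ENNReal.ofReal A := by
          refine liminf_le_of_le (by isBoundedDefault) fun b hb => ?_
          obtain ⟨n, hn⟩ := hb.exists
          refine hn.trans ?_
          rw [← ofReal_integral_eq_lintegral_ofReal (hg n) (hg0 n)]
          exact ENNReal.ofReal_le_ofReal (hA n)
  have hGi : Integrable G μ := (lintegral_ofReal_ne_top_iff_integrable hGm hG0).1
    (hle.trans_lt ENNReal.ofReal_lt_top).ne
  refine ⟨hGi, ?_⟩
  rw [← ofReal_integral_eq_lintegral_ofReal hGi hG0] at hle
  exact (ENNReal.ofReal_le_ofReal_iff hA0).1 hle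

theorem le_one_add_rpow {t q : ℝ} (ht : 0 ≤ t) (hq : 1 ≤ q) : t ≤ 1 + t ^ q := by
  rcases le_total t 1 with h | h
  · linarith [Real.rpow_nonneg ht q]
  · have := Real.rpow_le_rpow_of_exponent_le h hq
    rw [Real.rpow_one] at this
    linarith

/-- A sequence of test functions of bounded energy has a subsequence that converges almost
everywhere, and is bounded in `L^{p^*}`. -/
theorem exists_subseq_of_energy_le (hp : 1 < p) (hpN : p < N) (hΩb : Bornology.IsBounded Ω)
    {φ : ℕ → E N → ℝ} (hφ : ∀ n, IsTestFunction Ω (φ n)) {B : ℝ}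
    (hB : ∀ n, ∫ x in Ω, ‖gradient (φ n) x‖ ^ p ≤ B) :
    ∃ σ : ℕ → ℕ, StrictMono σ ∧ ∃ (u : E N → ℝ) (A : ℝ),
      AEStronglyMeasurable u (volume.restrict Ω) ∧
      (∀ᵐ x ∂(volume.restrict Ω), Tendsto (fun n => φ (σ n) x) atTop (𝓝 (u x))) ∧
      (∀ n, ∫ x in Ω, |φ n x| ^ pStar N p ≤ A) ∧
      IntegrableOn (fun x => |u x| ^ pStar N p) Ω ∧ ∫ x in Ω, |u x| ^ pStar N p ≤ A := by
  have : IsFiniteMeasure (volume.restrict Ω) := isFiniteMeasure_restrict hΩb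
  have hp0 : 0 < p := by linarith
  have hq0 := pStar_pos hp hpN
  have hpq := lt_pStar hp hpN
  obtain ⟨C, hC, hsob⟩ := exists_sobolev_const hp hpN
  have hA : ∀ n, ∫ x in Ω, |φ n x| ^ pStar N p ≤ C * B ^ (pStar N p / p) := fun n => by
    refine (hsob Ω _ (hφ n)).trans ?_
    gcongr
    exact hB n
  have hi : ∀ n, IntegrableOn (fun x => |φ n x| ^ pStar N p) Ω := fun n =>
    integrable_norm_rpow_of_memLp hq0 ((hφ n).memLp _)
  have hig : ∀ n, IntegrableOn (fun x => ‖gradient (φ n) x‖ ^ p) Ω := fun n =>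
    integrable_norm_rpow_of_memLp hp0 ((hφ n).memLp_gradient _)
  have hA1 : ∀ n, ∫ x in Ω, |φ n x| ≤ volume.real Ω + C * B ^ (pStar N p / p) := fun n => by
    calc ∫ x in Ω, |φ n x| ≤ ∫ x in Ω, (1 + |φ n x| ^ pStar N p) :=
          integral_mono_of_nonneg (ae_of_all _ fun x => abs_nonneg _)
            ((integrable_const 1).add (hi n)) (ae_of_all _ fun x =>
              le_one_add_rpow (abs_nonneg _) (by linarith))
      _ = volume.real Ω + ∫ x in Ω, |φ n x| ^ pStar N p := by
          rw [integral_add (integrable_const 1) (hi n)]; simp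
      _ ≤ _ := by gcongr; exact hA n
  have hB1 : ∀ n, ∫ x in Ω, ‖gradient (φ n) x‖ ≤ volume.real Ω + B := fun n => by
    calc ∫ x in Ω, ‖gradient (φ n) x‖ ≤ ∫ x in Ω, (1 + ‖gradient (φ n) x‖ ^ p) :=
          integral_mono_of_nonneg (ae_of_all _ fun x => norm_nonneg _)
            ((integrable_const 1).add (hig n)) (ae_of_all _ fun x =>
              le_one_add_rpow (norm_nonneg _) (by linarith))
      _ = volume.real Ω + ∫ x in Ω, ‖gradient (φ n) x‖ ^ p := by
          rw [integral_add (integrable_const 1) (hig n)]; simp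
      _ ≤ _ := by gcongr; exact hB n
  obtain ⟨σ, hσ, u, hum, hlim⟩ := exists_subseq_tendsto_ae hΩb hφ hA1 hB1
  obtain ⟨h1, h2⟩ := integrable_of_tendsto_ae (μ := volume.restrict Ω)
    (G := fun x => |u x| ^ pStar N p) (fun n => hi (σ n))
    (fun n => ae_of_all _ fun x => by positivity) (fun n => hA (σ n))
    (hlim.mono fun x hx => hx.abs.rpow_const (Or.inr hq0.le))
  exact ⟨σ, hσ, u, _, hum, hlim, hA, h1, h2⟩

/-! ### Boundedness of almost critical sequences -/

theorem dFunctional_const_mul {φ ψ : E N → ℝ} (hψ : IsTestFunction Ω ψ) (c : ℝ) :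
    dFunctional Ω p f φ (fun x => c * ψ x) = c * dFunctional Ω p f φ ψ := by
  rw [dFunctional, dFunctional, mul_sub, ← integral_const_mul, ← integral_const_mul]
  congr 1
  · refine integral_congr_ae (ae_of_all _ fun x => ?_)
    simp only
    rw [gradient_const_mul (hψ.differentiableAt x), real_inner_smul_right]
    ring
  · refine integral_congr_ae (ae_of_all _ fun x => ?_)
    simp only
    ring

theorem dFunctional_self (hp : 1 < p) (φ : E N → ℝ) :
    dFunctional Ω p f φ φ =
      (∫ x in Ω, ‖gradient φ x‖ ^ p) - ∫ x in Ω, φ x * f x (φ x) := by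
  simp only [dFunctional, ← powerMap_apply, powerMap_self hp]
  simp only [mul_comm]

/-- The gradient energy cancels in this combination of J and J', so (L3) can be read as a statement
about J. -/
theorem integral_funH_eq (hp : 1 < p) (hΩ : IsOpen Ω) (hΩb : Bornology.IsBounded Ω)
    (h1 : L1 Ω f) {φ : E N → ℝ} (hφ : IsTestFunction Ω φ) :
    IntegrableOn (fun x => funH p f x (φ x)) Ω ∧
    ∫ x in Ω, funH p f x (φ x) = p * functional Ω p f φ - dFunctional Ω p f φ φ := by
  have i1 : IntegrableOn (fun x => φ x * f x (φ x)) Ω := by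
    simpa only [mul_comm] using h1.integrableOn_f_mul hΩ hΩb hφ hφ
  have i2 := (h1.integrableOn_primitiveF hΩ hΩb hφ).const_mul p
  refine ⟨i1.sub i2, ?_⟩
  simp only [funH]
  rw [integral_sub i1 i2, integral_const_mul, dFunctional_self hp, functional]
  have : p ≠ 0 := by linarith
  field_simp
  ring

/-- Look at a maximum t of s ↦ J(sφ) on [0,1]. At an endpoint J is at most 0 or c. At an interior t,
J'(tφ)(tφ) = 0, so pJ(tφ) = ∫H(x,tφ), which (L3) bounds by θ∫H(x,φ) + C|Ω|, that is, by the data at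
φ. -/
theorem functional_smul_le (hp : 1 < p) (hΩ : IsOpen Ω) (hΩb : Bornology.IsBounded Ω)
    (h1 : L1 Ω f) {C θ : ℝ} (hC : 0 ≤ C) (hθ : 1 ≤ θ)
    (hH : ∀ x ∈ Ω, ∀ t s : ℝ, 0 < t → t < s → funH p f x t ≤ θ * funH p f x s + C)
    {φ : E N → ℝ} (hφ : IsTestFunction Ω φ) {c : ℝ} (h0 : 0 ≤ functional Ω p f φ)
    (hc : functional Ω p f φ ≤ c) (hd : |dFunctional Ω p f φ φ| ≤ 1) {s : ℝ} (hs0 : 0 ≤ s)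
    (hs1 : s ≤ 1) :
    p * functional Ω p f (fun x => s * φ x) ≤ p * c + θ * (p * c + 1) + C * volume.real Ω := by
  have : IsFiniteMeasure (volume.restrict Ω) := isFiniteMeasure_restrict hΩb
  have hp0 : 0 < p := by linarith
  have hc0 : 0 ≤ c := h0.trans hc
  have hv : 0 ≤ C * volume.real Ω := by positivity
  -- Differentiability of s ↦ J(sφ) is the case of a one-dimensional span.
  obtain ⟨g', -, hg, hg'⟩ := exists_hasFDerivAt_functional (p := p) (m := 1) (d := fun _ => φ)
    hp hΩ hΩb h1 fun _ => hφ
  let a₀ : E 1 := EuclideanSpace.single 0 1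
  have ha₀ : ∀ s : ℝ, comb (fun _ : Fin 1 => φ) (s • a₀) = fun x => s * φ x := fun s => by
    rw [comb_smul, comb_single]
    simp
  have ha₁ : comb (fun _ : Fin 1 => φ) a₀ = φ := by simpa using ha₀ 1
  let k : ℝ → ℝ := fun s => functional Ω p f (fun x => s * φ x)
  have hk : ∀ s, HasDerivAt k (dFunctional Ω p f (fun x => s * φ x) φ) s := fun s => by
    have h := (hg (s • a₀)).comp_hasDerivAt s ((hasDerivAt_id s).smul_const a₀)
    rw [one_smul, hg', ha₀, ha₁] at h
    refine h.congr_of_eventuallyEq (Eventually.of_forall fun t => ?_)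
    simp only [k, Function.comp_apply, id_eq, ha₀]
  have hkc : Continuous k := continuous_iff_continuousAt.2 fun s => (hk s).continuousAt
  obtain ⟨t, ht, hmax⟩ := isCompact_Icc.exists_isMaxOn (nonempty_Icc.2 zero_le_one)
    (hkc.continuousOn (s := Icc (0 : ℝ) 1))
  have hst : k s ≤ k t := hmax ⟨hs0, hs1⟩
  suffices hsuff : p * k t ≤ p * c + θ * (p * c + 1) + C * volume.real Ω from
    (mul_le_mul_of_nonneg_left hst hp0.le).trans hsuff
  have hpc : 0 ≤ p * c := by positivity
  have hθc : 0 ≤ θ * (p * c + 1) := by positivity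
  rcases ht.1.eq_or_lt with ht0 | ht0
  · have hk0 : k t ≤ 0 := by
      simp only [k, ← ht0, zero_mul]
      have hgz : ∀ x : E N, gradient (fun _ : E N => (0 : ℝ)) x = 0 := fun x => by
        simp [gradient_eq_toDual_symm]
      simp [functional, hgz, L1.primitiveF_zero, Real.zero_rpow hp0.ne']
    nlinarith
  rcases ht.2.eq_or_lt with ht1 | ht1
  · have hk1 : k t ≤ c := by
      simp only [k, ht1, one_mul]
      exact hc
    nlinarith
  have hloc : IsLocalMax k t := hmax.isLocalMax (Icc_mem_nhds ht0 ht1)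
  have hzero := hloc.hasDerivAt_eq_zero (hk t)
  have ht' : IsTestFunction Ω fun x => t * φ x := hφ.const_mul t
  have hzero' : dFunctional Ω p f (fun x => t * φ x) (fun x => t * φ x) = 0 := by
    rw [dFunctional_const_mul hφ, hzero, mul_zero]
  obtain ⟨hi1, he1⟩ := integral_funH_eq (f := f) hp hΩ hΩb h1 ht'
  obtain ⟨hi2, he2⟩ := integral_funH_eq (f := f) hp hΩ hΩb h1 hφ
  rw [hzero', sub_zero] at he1
  have hle : ∫ x in Ω, funH p f x (t * φ x) ≤ ∫ x in Ω, (θ * funH p f x (φ x) + C) := by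
    refine integral_mono_ae hi1 ((hi2.const_mul θ).add (integrable_const C)) ?_
    filter_upwards [ae_restrict_mem hΩ.measurableSet] with x hx
    rcases le_or_gt (φ x) 0 with hx0 | hx0
    · have e1 : funH p f x (φ x) = 0 := by
        rw [funH, h1.zero x hx _ hx0, h1.primitiveF_of_nonpos hx hx0]; ring
      have hx1 : t * φ x ≤ 0 := mul_nonpos_of_nonneg_of_nonpos ht0.le hx0
      have e2 : funH p f x (t * φ x) = 0 := by
        rw [funH, h1.zero x hx _ hx1, h1.primitiveF_of_nonpos hx hx1]; ring
      rw [e1, e2]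
      linarith
    · exact hH x hx _ _ (mul_pos ht0 hx0) (mul_lt_of_lt_one_left hx0 ht1)
  rw [integral_add (hi2.const_mul θ) (integrable_const C), integral_const_mul, he1, he2] at hle
  simp only [integral_const, smul_eq_mul, measureReal_restrict_apply_univ] at hle
  have h5 : p * functional Ω p f φ - dFunctional Ω p f φ φ ≤ p * c + 1 := by
    have := (abs_le.1 hd).1
    nlinarith
  have h6 := mul_le_mul_of_nonneg_left h5 (by linarith : 0 ≤ θ)
  simp only [k]
  linarith

theorem aemeasurable_liminf {α : Type*} [MeasurableSpace α] {μ : Measure α}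
    {g : ℕ → α → ENNReal} (hg : ∀ n, AEMeasurable (g n) μ) :
    AEMeasurable (fun x => liminf (fun n => g n x) atTop) μ := by
  refine ⟨fun x => liminf (fun n => (hg n).mk _ x) atTop,
    Measurable.liminf fun n => (hg n).measurable_mk, ?_⟩
  filter_upwards [ae_all_iff.2 fun n => (hg n).ae_eq_mk] with x hx
  simp only [hx]

/-- J(v_n) ≥ 0 gives ∫F(x,v_n)/R_n^p ≤ 1/p. Where w > 0, v_n → ∞ and F(x,v_n)/R_n^p =
(F(x,v_n)/v_n^p)(v_n/R_n)^p → ∞ by (L2), so Fatou makes this set null. -/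
theorem limit_nonpos_of_functional_nonneg (hp : 1 < p) (hΩ : IsOpen Ω)
    (hΩb : Bornology.IsBounded Ω) (h1 : L1 Ω f) (h2 : L2 Ω p f) {v : ℕ → E N → ℝ}
    (hv : ∀ n, IsTestFunction Ω (v n)) (h0 : ∀ n, 0 ≤ functional Ω p f (v n)) {R : ℕ → ℝ}
    (hR : ∀ n, 0 < R n) (hRlim : Tendsto R atTop atTop)
    (hvR : ∀ n, ∫ x in Ω, ‖gradient (v n) x‖ ^ p = R n ^ p) {w : E N → ℝ}
    (hlim : ∀ᵐ x ∂(volume.restrict Ω), Tendsto (fun n => (R n)⁻¹ * v n x) atTop (𝓝 (w x))) :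
    ∀ᵐ x ∂(volume.restrict Ω), w x ≤ 0 := by
  have hp0 : 0 < p := by linarith
  have hi : ∀ n, IntegrableOn (fun x => primitiveF f x (v n x) / R n ^ p) Ω := fun n =>
    (h1.integrableOn_primitiveF hΩ hΩb (hv n)).div_const _
  have hpos : ∀ n, ∀ᵐ x ∂(volume.restrict Ω), 0 ≤ primitiveF f x (v n x) / R n ^ p := fun n => by
    filter_upwards [ae_restrict_mem hΩ.measurableSet] with x hx
    exact div_nonneg (h1.primitiveF_nonneg hx _) (Real.rpow_nonneg (hR n).le _)
  have hle : ∀ n, ∫ x in Ω, primitiveF f x (v n x) / R n ^ p ≤ 1 / p := fun n => by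
    have h := h0 n
    have hRp : 0 < R n ^ p := Real.rpow_pos_of_pos (hR n) p
    rw [functional, hvR n] at h
    rw [integral_div, div_le_iff₀ hRp]
    linarith
  have hfatou : ∫⁻ x in Ω, liminf (fun n => ENNReal.ofReal (primitiveF f x (v n x) / R n ^ p))
      atTop ≤ ENNReal.ofReal (1 / p) := by
    refine (lintegral_liminf_le' fun n => (hi n).1.aemeasurable.ennreal_ofReal).trans ?_
    refine liminf_le_of_le (by isBoundedDefault) fun b hb => ?_
    obtain ⟨n, hn⟩ := hb.exists
    refine hn.trans ?_
    rw [← ofReal_integral_eq_lintegral_ofReal (hi n) (hpos n)]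
    exact ENNReal.ofReal_le_ofReal (hle n)
  have hfin := ae_lt_top' (aemeasurable_liminf fun n => (hi n).1.aemeasurable.ennreal_ofReal)
    (hfatou.trans_lt ENNReal.ofReal_lt_top).ne
  filter_upwards [hfin, hlim, ae_restrict_mem hΩ.measurableSet] with x hx hxl hxΩ
  by_contra hcon
  have hw : 0 < w x := not_le.1 hcon
  refine hx.ne ?_
  have hvlim : Tendsto (fun n => v n x) atTop atTop := by
    refine (hRlim.atTop_mul_pos hw hxl).congr fun n => ?_
    rw [← mul_assoc, mul_inv_cancel₀ (hR n).ne', one_mul]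
  have hquot : Tendsto (fun n => primitiveF f x (v n x) / v n x ^ p) atTop atTop := by
    refine tendsto_atTop.2 fun M => ?_
    exact (hvlim.eventually (h2 M)).mono fun n hn => hn x hxΩ
  have hprod : Tendsto (fun n => primitiveF f x (v n x) / R n ^ p) atTop atTop := by
    have hwp : 0 < w x ^ p := Real.rpow_pos_of_pos hw p
    refine (hquot.atTop_mul_pos hwp (hxl.rpow_const (p := p) (Or.inr hp0.le))).congr' ?_
    filter_upwards [hvlim.eventually_gt_atTop 0] with n hn
    rw [Real.mul_rpow (inv_nonneg.2 (hR n).le) hn.le, Real.inv_rpow (hR n).le]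
    have := (Real.rpow_pos_of_pos hn p).ne'
    field_simp
  exact (ENNReal.tendsto_ofReal_atTop.comp hprod).liminf_eq

/-- Almost critical sequences at a nonnegative level have bounded energy. -/
theorem exists_energy_le (hp : 1 < p) (hpN : p < N) (hΩ : IsOpen Ω)
    (hΩb : Bornology.IsBounded Ω) (hne : Ω.Nonempty) (hf : SCPI Ω p f) (h1 : L1 Ω f)
    (h2 : L2 Ω p f) (h3 : L3 Ω p f) (h4 : L4 Ω p f) {u : ℕ → E N → ℝ}
    (hu : ∀ n, IsTestFunction Ω (u n)) {c : ℝ} (h0 : ∀ n, 0 ≤ functional Ω p f (u n))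
    (hc : ∀ n, functional Ω p f (u n) ≤ c) (hd : ∀ n, |dFunctional Ω p f (u n) (u n)| ≤ 1) :
    ∃ B : ℝ, ∀ n, ∫ x in Ω, ‖gradient (u n) x‖ ^ p ≤ B := by
  have hp0 : 0 < p := by linarith
  have hq0 := pStar_pos hp hpN
  by_contra hcon
  push Not at hcon
  -- The indices need not increase; only the growth of the energies is used.
  choose τ hτ using fun k : ℕ => hcon (k + 1 : ℝ)
  let v : ℕ → E N → ℝ := fun k => u (τ k)
  let R : ℕ → ℝ := fun k => (∫ x in Ω, ‖gradient (v k) x‖ ^ p) ^ p⁻¹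
  have hEpos : ∀ k, 0 < ∫ x in Ω, ‖gradient (v k) x‖ ^ p := fun k =>
    lt_trans (by positivity) (hτ k)
  have hR : ∀ k, 0 < R k := fun k => Real.rpow_pos_of_pos (hEpos k) _
  have hvR : ∀ k, ∫ x in Ω, ‖gradient (v k) x‖ ^ p = R k ^ p := fun k =>
    (Real.rpow_inv_rpow (hEpos k).le hp0.ne').symm
  have hRlim : Tendsto R atTop atTop := by
    refine (tendsto_rpow_atTop (inv_pos.2 hp0)).comp ?_
    refine tendsto_atTop_mono (fun k => (hτ k).le) ?_
    exact tendsto_atTop_add_const_right _ 1 tendsto_natCast_atTop_atTop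
  have hw : ∀ k, IsTestFunction Ω fun x => (R k)⁻¹ * v k x := fun k => (hu _).const_mul _
  have hwE : ∀ k, ∫ x in Ω, ‖gradient (fun x => (R k)⁻¹ * v k x) x‖ ^ p = 1 := fun k => by
    rw [integral_norm_gradient_const_mul (hu _) (inv_nonneg.2 (hR k).le), hvR k,
      Real.inv_rpow (hR k).le, inv_mul_cancel₀ (Real.rpow_pos_of_pos (hR k) p).ne']
  obtain ⟨σ, hσ, w, A, hwm, hlim, hA, hwi, hwA⟩ := exists_subseq_of_energy_le hp hpN hΩb hw
    (fun k => (hwE k).le)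
  have hw0 := limit_nonpos_of_functional_nonneg hp hΩ hΩb h1 h2 (fun n => hu (τ (σ n)))
    (fun n => h0 _) (fun n => hR (σ n)) (hRlim.comp hσ.tendsto_atTop) (fun n => hvR (σ n)) hlim
  obtain ⟨C, θ, hC, hθ, hH⟩ := h3
  set Λ := p * c + θ * (p * c + 1) + C * volume.real Ω with hΛ
  -- For this M the quantity pJ(M w_n) tends to |Λ| + 2, whereas the bound along segments is Λ.
  set M := (|Λ| + 2) ^ p⁻¹ with hM
  have hM0 : 0 < M := by positivity
  have hMp : M ^ p = |Λ| + 2 := Real.rpow_inv_rpow (by positivity) hp0.ne'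
  have habs : ∀ t : ℝ, |M * t| ^ pStar N p = M ^ pStar N p * |t| ^ pStar N p := fun t => by
    rw [abs_mul, abs_of_pos hM0, Real.mul_rpow hM0.le (abs_nonneg t)]
  have hFlim := (tendsto_integral_superposition hΩ hΩb h1.continuousOn_primitiveF
    (q := pStar N p) (A := M ^ pStar N p * A)
    (fun ε hε => by
      obtain ⟨K, hK, hgr⟩ := exists_growth hne hp hpN hf h1 ⟨C, θ, hC, hθ, hH⟩ h4 hε
      refine ⟨K, hK, fun x hx t => ?_⟩
      rw [abs_of_nonneg (h1.primitiveF_nonneg hx t)]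
      exact (hgr x hx t).1)
    (u := fun n x => M * ((R (σ n))⁻¹ * v (σ n) x)) (v := fun x => M * w x)
    (fun n => ((hw (σ n)).const_mul M).continuous.aestronglyMeasurable) (hwm.const_mul M)
    (fun n => integrable_norm_rpow_of_memLp hq0 (((hw (σ n)).const_mul M).memLp _))
    (fun n => by
      simp only [habs, integral_const_mul]
      exact mul_le_mul_of_nonneg_left (hA (σ n)) (by positivity))
    (by simp only [habs]; exact hwi.const_mul (M ^ pStar N p))
    (by
      simp only [habs, integral_const_mul]
      exact mul_le_mul_of_nonneg_left hwA (by positivity))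
    (hlim.mono fun x hx => hx.const_mul M)).2
  have hzero : ∫ x in Ω, primitiveF f x (M * w x) = 0 := by
    refine integral_eq_zero_of_ae ?_
    filter_upwards [hw0, ae_restrict_mem hΩ.measurableSet] with x hx hxΩ
    exact h1.primitiveF_of_nonpos hxΩ (mul_nonpos_of_nonneg_of_nonpos hM0.le hx)
  rw [hzero] at hFlim
  have hev1 := hFlim.eventually (gt_mem_nhds (show (0 : ℝ) < 1 / p by positivity))
  have hev2 := (hRlim.comp hσ.tendsto_atTop).eventually_ge_atTop M
  obtain ⟨n, hn1, hn2⟩ := (hev1.and hev2).exists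
  have hRn := hR (σ n)
  -- Once R_n ≥ M, the function M w_n = (M/R_n) u_n lies on the segment from 0 to u_n.
  have hray := functional_smul_le hp hΩ hΩb h1 hC hθ hH (hu (τ (σ n))) (h0 _) (hc _) (hd _)
    (s := M * (R (σ n))⁻¹) (by positivity)
    (by rw [← div_eq_mul_inv]; exact div_le_one_of_le₀ hn2 hRn.le)
  have hfun : (fun x => M * (R (σ n))⁻¹ * u (τ (σ n)) x) =
      fun x => M * ((R (σ n))⁻¹ * v (σ n) x) := funext fun x => mul_assoc _ _ _
  rw [hfun, functional, integral_norm_gradient_const_mul (hw (σ n)) hM0.le, hwE, mul_one, hMp,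
    ← hΛ] at hray
  have h5 : p * (1 / p * (|Λ| + 2) - ∫ x in Ω, primitiveF f x (M * ((R (σ n))⁻¹ * v (σ n) x))) =
      |Λ| + 2 - p * ∫ x in Ω, primitiveF f x (M * ((R (σ n))⁻¹ * v (σ n) x)) := by
    field_simp
  rw [h5] at hray
  have h6 := mul_lt_mul_of_pos_left hn1 hp0
  rw [mul_one_div_cancel hp0.ne'] at h6
  linarith [le_abs_self Λ]

/-! ### Convexity of the Dirichlet energy -/

section PowerMap

variable {V : Type*} [NormedAddCommGroup V] [InnerProductSpace ℝ V]

theorem abs_powerMap_apply_le_rpow (hp : 1 < p) {v w : V} {s : ℝ} (hv : ‖v‖ ≤ s) (hw : ‖w‖ ≤ s) :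
    |powerMap p v w| ≤ s ^ p := by
  have hs : 0 ≤ s := (norm_nonneg v).trans hv
  rcases eq_or_ne v 0 with rfl | hv0
  · simp only [powerMap_apply, inner_zero_left, mul_zero, abs_zero]
    positivity
  have hvp : 0 < ‖v‖ := norm_pos_iff.2 hv0
  have hs0 : 0 < s := hvp.trans_le hv
  calc |powerMap p v w| ≤ ‖v‖ ^ (p - 2) * (‖v‖ * ‖w‖) := abs_powerMap_apply_le v w
    _ = ‖v‖ ^ (p - 1) * ‖w‖ := by
        rw [← mul_assoc, ← Real.rpow_add_one hvp.ne']
        congr 2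
        ring
    _ ≤ s ^ (p - 1) * s := by gcongr
    _ = s ^ p := by rw [← Real.rpow_add_one hs0.ne', sub_add_cancel]

/-- The tangent inequality for the convex function ‖·‖^p / p, derived from Cauchy-Schwarz and
Young's inequality. -/
theorem norm_rpow_add_powerMap_le (hp : 1 < p) (a b : V) :
    (1 / p) * ‖a‖ ^ p + powerMap p a (b - a) ≤ (1 / p) * ‖b‖ ^ p := by
  have hp0 : 0 < p := by linarith
  rw [map_sub, powerMap_self hp]
  have hq : p.HolderConjugate (p / (p - 1)) := Real.HolderConjugate.conjExponent hp
  have hab : powerMap p a b ≤ ‖b‖ * ‖a‖ ^ (p - 1) := by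
    rcases eq_or_ne a 0 with rfl | ha
    · rw [powerMap_apply, inner_zero_left, mul_zero]
      positivity
    · refine (le_abs_self _).trans ((abs_powerMap_apply_le a b).trans_eq ?_)
      rw [← mul_assoc, ← Real.rpow_add_one (norm_pos_iff.2 ha).ne', mul_comm]
      congr 2
      ring
  have hy := Real.young_inequality_of_nonneg (norm_nonneg b)
    (Real.rpow_nonneg (norm_nonneg a) (p - 1)) hq
  have hp1 : p - 1 ≠ 0 := by linarith
  rw [← Real.rpow_mul (norm_nonneg a), mul_div_cancel₀ _ hp1] at hy
  have e : ‖a‖ ^ p / (p / (p - 1)) = ‖a‖ ^ p - (1 / p) * ‖a‖ ^ p := by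
    field_simp
  rw [e] at hy
  have e2 : ‖b‖ ^ p / p = (1 / p) * ‖b‖ ^ p := by ring
  linarith

end PowerMap

/-! ### Linear structure and approximation in `W_0^{1,p}` -/

theorem tendsto_eLpNorm_add_smul {α V : Type*} [MeasurableSpace α] {μ : Measure α}
    [NormedAddCommGroup V] [NormedSpace ℝ V] {q : ENNReal} (hq : 1 ≤ q) (c : ℝ) {a b : α → V}
    {g h : ℕ → α → V} (ha : MemLp a q μ) (hb : MemLp b q μ) (hg : ∀ n, MemLp (g n) q μ)
    (hh : ∀ n, MemLp (h n) q μ)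
    (hag : Tendsto (fun n => eLpNorm (fun x => a x - g n x) q μ) atTop (𝓝 0))
    (hbh : Tendsto (fun n => eLpNorm (fun x => b x - h n x) q μ) atTop (𝓝 0)) :
    Tendsto (fun n => eLpNorm (fun x => (a x + c • b x) - (g n x + c • h n x)) q μ)
      atTop (𝓝 0) := by
  have hs := hag.add (ENNReal.Tendsto.const_mul (a := ‖c‖ₑ) hbh (Or.inr enorm_ne_top))
  rw [mul_zero, add_zero] at hs
  refine tendsto_of_tendsto_of_tendsto_of_le_of_le tendsto_const_nhds hs (fun _ => zero_le)
    fun n => ?_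
  have e : (fun x => (a x + c • b x) - (g n x + c • h n x)) =
      (fun x => a x - g n x) + c • fun x => b x - h n x := by
    funext x
    simp only [Pi.add_apply, Pi.smul_apply, smul_sub]
    abel
  rw [e]
  have h1 : AEStronglyMeasurable (fun x => a x - g n x) μ := (ha.sub (hg n)).1
  have h2 : AEStronglyMeasurable (fun x => b x - h n x) μ := (hb.sub (hh n)).1
  refine (eLpNorm_add_le h1 (h2.const_smul c) hq).trans ?_
  rw [eLpNorm_const_smul]

namespace MemW01p

variable {u v : E N → ℝ} {Du Dv : E N → E N}

theorem add_const_smul (hΩb : Bornology.IsBounded Ω) (hp : 1 ≤ p) (hu : MemW01p Ω p u Du)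
    (hv : MemW01p Ω p v Dv) (c : ℝ) :
    MemW01p Ω p (fun x => u x + c * v x) (fun x => Du x + c • Dv x) := by
  obtain ⟨φ, hφ, h1, h2⟩ := hu.approx
  obtain ⟨ψ, hψ, h3, h4⟩ := hv.approx
  have ht : ∀ n, IsTestFunction Ω fun x => φ n x + c * ψ n x := fun n =>
    (hφ n).add ((hψ n).const_mul c)
  have hq : 1 ≤ ENNReal.ofReal p := by simpa using hp
  have hm1 : MemLp (fun x => u x + c * v x) (ENNReal.ofReal p) (volume.restrict Ω) :=
    hu.memW1p.memLp.add (hv.memW1p.memLp.const_mul c)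
  have hm2 : MemLp (fun x => Du x + c • Dv x) (ENNReal.ofReal p) (volume.restrict Ω) :=
    hu.memW1p.memLp_grad.add (hv.memW1p.memLp_grad.const_smul c)
  have hl1 := tendsto_eLpNorm_add_smul hq c hu.memW1p.memLp hv.memW1p.memLp
    (fun n => (hφ n).memLp _) (fun n => (hψ n).memLp _) h1 h3
  have hl2 := tendsto_eLpNorm_add_smul hq c hu.memW1p.memLp_grad hv.memW1p.memLp_grad
    (fun n => (hφ n).memLp_gradient _) (fun n => (hψ n).memLp_gradient _) h2 h4
  have e : ∀ n x, gradient (fun x => φ n x + c * ψ n x) x =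
      gradient (φ n) x + c • gradient (ψ n) x := fun n x => by
    rw [gradient_add ((hφ n).differentiableAt x) (((hψ n).const_mul c).differentiableAt x),
      gradient_const_mul ((hψ n).differentiableAt x)]
  simp only [smul_eq_mul] at hl1
  simp only [← e] at hl2
  exact memW01p_of_approx hΩb hp hm1 hm2 ht hl1 hl2

end MemW01p

theorem tendsto_integral_norm_rpow {α V : Type*} [MeasurableSpace α] {μ : Measure α}
    [NormedAddCommGroup V] {p : ℝ} (hp : 1 ≤ p) {g : ℕ → α → V} {G : α → V}
    (hg : ∀ n, MemLp (g n) (ENNReal.ofReal p) μ) (hG : MemLp G (ENNReal.ofReal p) μ)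
    (hlim : Tendsto (fun n => eLpNorm (fun x => G x - g n x) (ENNReal.ofReal p) μ) atTop (𝓝 0)) :
    Tendsto (fun n => ∫ x, ‖g n x‖ ^ p ∂μ) atTop (𝓝 (∫ x, ‖G x‖ ^ p ∂μ)) := by
  have hp0 : 0 < p := by linarith
  have : Fact ((1 : ENNReal) ≤ ENNReal.ofReal p) := ⟨by simpa using hp⟩
  have hnorm : ∀ {v : α → V} (hv : MemLp v (ENNReal.ofReal p) μ),
      ‖hv.toLp v‖ ^ p = ∫ x, ‖v x‖ ^ p ∂μ := by
    intro v hv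
    have h0 : 0 ≤ ∫ x, ‖v x‖ ^ p ∂μ := integral_nonneg fun x => by positivity
    rw [Lp.norm_toLp, eLpNorm_eq_ofReal_integral hp0 hv, ENNReal.toReal_ofReal (by positivity),
      Real.rpow_inv_rpow h0 hp0.ne']
  have h : Tendsto (fun n => (hg n).toLp (g n)) atTop (𝓝 (hG.toLp G)) := by
    rw [Lp.tendsto_Lp_iff_tendsto_eLpNorm'' g hg]
    refine hlim.congr fun n => ?_
    rw [← eLpNorm_neg]
    congr 1
    funext x
    simp
  simpa only [hnorm] using h.norm.rpow_const (p := p) (Or.inr hp0.le)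

theorem integrable_of_tendsto_ae' {α : Type*} [MeasurableSpace α] {μ : Measure α}
    {g : ℕ → α → ℝ} {G : α → ℝ} {a : ℕ → ℝ} {A : ℝ} (hg : ∀ n, Integrable (g n) μ)
    (hg0 : ∀ n, ∀ᵐ x ∂μ, 0 ≤ g n x) (ha : ∀ n, ∫ x, g n x ∂μ ≤ a n)
    (haA : Tendsto a atTop (𝓝 A))
    (hlim : ∀ᵐ x ∂μ, Tendsto (fun n => g n x) atTop (𝓝 (G x))) :
    Integrable G μ ∧ ∫ x, G x ∂μ ≤ A := by
  have key : ∀ η > 0, Integrable G μ ∧ ∫ x, G x ∂μ ≤ A + η := by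
    intro η hη
    obtain ⟨n₀, hn₀⟩ := eventually_atTop.1 (haA.eventually (gt_mem_nhds (lt_add_of_pos_right A hη)))
    exact integrable_of_tendsto_ae (g := fun n => g (n + n₀)) (fun n => hg _) (fun n => hg0 _)
      (fun n => (ha _).trans (hn₀ _ (Nat.le_add_left _ _)).le)
      (hlim.mono fun x hx => hx.comp (tendsto_add_atTop_nat n₀))
  exact ⟨(key 1 one_pos).1, le_of_forall_pos_le_add fun η hη => (key η hη).2⟩

/-! ### Duality bounds for a nonnegative weight -/

theorem tendsto_energy_of_uniform (hp : 1 < p) (hΩ : IsOpen Ω) (hΩb : Bornology.IsBounded Ω)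
    {φ : E N → ℝ} {ψ : ℕ → E N → ℝ}
    (h : ∀ n : ℕ, ∀ x ∈ Ω, |ψ n x - φ x| < 1 / (n + 1 : ℝ) ∧
      ‖gradient (ψ n) x - gradient φ x‖ < 1 / (n + 1 : ℝ)) :
    Tendsto (fun n => eLpNorm (fun x => φ x - ψ n x) (ENNReal.ofReal p) (volume.restrict Ω))
      atTop (𝓝 0) ∧
    Tendsto (fun n => eLpNorm (fun x => gradient φ x - gradient (ψ n) x) (ENNReal.ofReal p)
      (volume.restrict Ω)) atTop (𝓝 0) := by
  have : IsFiniteMeasure (volume.restrict Ω) := isFiniteMeasure_restrict hΩb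
  have hp0 : 0 < p := by linarith
  have hgen : ∀ {V : Type} [NormedAddCommGroup V] {g : ℕ → E N → V},
      (∀ n : ℕ, ∀ x ∈ Ω, ‖g n x‖ ≤ 1 / (n + 1 : ℝ)) →
      Tendsto (fun n => eLpNorm (g n) (ENNReal.ofReal p) (volume.restrict Ω)) atTop (𝓝 0) := by
    intro V _ g hg
    have hb : ∀ n, eLpNorm (g n) (ENNReal.ofReal p) (volume.restrict Ω) ≤
        (volume.restrict Ω) univ ^ (ENNReal.ofReal p).toReal⁻¹ *
          ENNReal.ofReal (1 / (n + 1 : ℝ)) := fun n => by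
      refine eLpNorm_le_of_ae_bound ?_
      filter_upwards [ae_restrict_mem hΩ.measurableSet] with x hx
      exact hg n x hx
    have h0 : Tendsto (fun n : ℕ => ENNReal.ofReal (1 / (n + 1 : ℝ))) atTop (𝓝 0) := by
      simpa [Function.comp_def] using (ENNReal.continuous_ofReal.tendsto 0).comp
        (tendsto_one_div_add_atTop_nhds_zero_nat (𝕜 := ℝ))
    have h1 := ENNReal.Tendsto.const_mul
      (a := (volume.restrict Ω) univ ^ (ENNReal.ofReal p).toReal⁻¹) h0
      (Or.inr (ENNReal.rpow_ne_top_of_nonneg (by positivity) (measure_ne_top _ _)))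
    rw [mul_zero] at h1
    exact tendsto_of_tendsto_of_tendsto_of_le_of_le tendsto_const_nhds h1 (fun _ => zero_le) hb
  refine ⟨hgen fun n x hx => ?_, hgen fun n x hx => ?_⟩
  · rw [Real.norm_eq_abs, abs_sub_comm]
    exact (h n x hx).1.le
  · rw [norm_sub_rev]
    exact (h n x hx).2.le

section Weight

variable {a : E N → ℝ} {Q : ℝ} {d : ℕ → E N → ℝ}

/-- The weight may blow up at the boundary and C¹-close approximants need not share a compact
support, so there is no domination. Fatou along nonnegative approximants suffices for this one-sided
bound. -/
theorem integral_weight_mul_le (hp : 1 < p) (hΩ : IsOpen Ω) (hΩb : Bornology.IsBounded Ω)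
    (ha : ∀ x ∈ Ω, 0 ≤ a x)
    (hai : ∀ φ, IsTestFunction Ω φ → IntegrableOn (fun x => a x * φ x) Ω)
    (hd : ∀ n, IsTestFunction Ω (d n))
    (hdense : ∀ φ, IsTestFunction Ω φ → ∀ ε > 0, ∃ n,
      (∀ x ∈ Ω, |d n x - φ x| < ε ∧ ‖gradient (d n) x - gradient φ x‖ < ε) ∧
      ((∀ x, 0 ≤ φ x) → ∀ x, 0 ≤ d n x))
    (hQ : ∀ n, ∫ x in Ω, a x * d n x ≤ 1 / p * (∫ x in Ω, ‖gradient (d n) x‖ ^ p) + Q)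
    {φ : E N → ℝ} (hφ : IsTestFunction Ω φ) (hφ0 : ∀ x, 0 ≤ φ x) :
    ∫ x in Ω, a x * φ x ≤ 1 / p * (∫ x in Ω, ‖gradient φ x‖ ^ p) + Q := by
  choose k hk hk0 using fun n : ℕ => hdense φ hφ (1 / (n + 1 : ℝ)) (by positivity)
  have hE := tendsto_integral_norm_rpow hp.le (fun n => (hd (k n)).memLp_gradient _)
    (hφ.memLp_gradient _) (tendsto_energy_of_uniform hp hΩ hΩb hk).2
  refine (integrable_of_tendsto_ae' (μ := volume.restrict Ω) (fun n => hai _ (hd (k n)))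
    (fun n => ?_) (fun n => hQ (k n)) ((hE.const_mul (1 / p)).add_const Q) ?_).2
  · filter_upwards [ae_restrict_mem hΩ.measurableSet] with x hx
    exact mul_nonneg (ha x hx) (hk0 n hφ0 x)
  · filter_upwards [ae_restrict_mem hΩ.measurableSet] with x hx
    refine Tendsto.const_mul _ (tendsto_iff_norm_sub_tendsto_zero.2 ?_)
    exact squeeze_zero (fun _ => norm_nonneg _) (fun n => (hk n x hx).1.le)
      tendsto_one_div_add_atTop_nhds_zero_nat

/-- Apply the inhomogeneous bound to φ/r, with r the p-th root of the energy plus η. The shift η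
keeps r positive. -/
theorem integral_weight_mul_le_rpow (hp : 1 < p)
    (hQ : ∀ φ, IsTestFunction Ω φ → (∀ x, 0 ≤ φ x) →
      ∫ x in Ω, a x * φ x ≤ 1 / p * (∫ x in Ω, ‖gradient φ x‖ ^ p) + Q)
    {φ : E N → ℝ} (hφ : IsTestFunction Ω φ) (hφ0 : ∀ x, 0 ≤ φ x) {η : ℝ} (hη : 0 < η) :
    ∫ x in Ω, a x * φ x ≤ (1 / p + Q) * ((∫ x in Ω, ‖gradient φ x‖ ^ p) + η) ^ p⁻¹ := by
  have hp0 : 0 < p := by linarith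
  set e := ∫ x in Ω, ‖gradient φ x‖ ^ p with he
  have he0 : 0 ≤ e := integral_nonneg fun x => by positivity
  set r := (e + η) ^ p⁻¹ with hr
  have hr0 : 0 < r := by positivity
  have hrp : r ^ p = e + η := Real.rpow_inv_rpow (by positivity) hp0.ne'
  have h := hQ _ (hφ.const_mul r⁻¹) fun x => mul_nonneg (by positivity) (hφ0 x)
  rw [integral_norm_gradient_const_mul hφ (by positivity), Real.inv_rpow hr0.le, hrp, ← he] at h
  have e1 : ∫ x in Ω, a x * (r⁻¹ * φ x) = r⁻¹ * ∫ x in Ω, a x * φ x := by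
    rw [← integral_const_mul]
    exact integral_congr_ae (ae_of_all _ fun x => by simp only; ring)
  have h2 : (e + η)⁻¹ * e ≤ 1 := by
    rw [inv_mul_le_one₀ (by positivity)]; linarith
  have h3 : 1 / p * ((e + η)⁻¹ * e) ≤ 1 / p := mul_le_of_le_one_right (by positivity) h2
  rw [e1, inv_mul_eq_div, div_le_iff₀ hr0] at h
  refine h.trans ?_
  gcongr

theorem exists_ae_approx {v : E N → ℝ} {Dv : E N → E N} (hp : 1 < p)
    (hv : MemW01p Ω p v Dv) :
    ∃ φ : ℕ → E N → ℝ, (∀ n, IsTestFunction Ω (φ n)) ∧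
      Tendsto (fun n => ∫ x in Ω, ‖gradient (φ n) x‖ ^ p) atTop (𝓝 (∫ x in Ω, ‖Dv x‖ ^ p)) ∧
      ∀ᵐ x ∂(volume.restrict Ω), Tendsto (fun n => φ n x) atTop (𝓝 (v x)) := by
  obtain ⟨φ, hφ, h1, h2⟩ := hv.approx
  have hE := tendsto_integral_norm_rpow hp.le (fun n => (hφ n).memLp_gradient _)
    hv.memW1p.memLp_grad h2
  have hm : TendstoInMeasure (volume.restrict Ω) φ atTop v := by
    refine tendstoInMeasure_of_tendsto_eLpNorm (p := ENNReal.ofReal p) (by simp; linarith)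
      (fun n => ((hφ n).memLp 1).1) hv.memW1p.memLp.1 (h1.congr fun n => ?_)
    rw [← eLpNorm_neg]
    congr 1
    funext x
    simp
  obtain ⟨ns, hns, hae⟩ := hm.exists_seq_tendsto_ae
  exact ⟨fun n => φ (ns n), fun n => hφ _, hE.comp hns.tendsto_atTop, hae⟩

/-- Smoothed absolute values of approximating test functions are admissible in the nonnegative
bound, and Fatou then controls ∫ a|v|. Thus v ↦ ∫ a v is bounded on W_0^{1,p}. -/
theorem integrableOn_weight_mul (hp : 1 < p) (hΩ : IsOpen Ω) (hQ0 : 0 ≤ Q)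
    (ha : ∀ x ∈ Ω, 0 ≤ a x) (ham : AEStronglyMeasurable a (volume.restrict Ω))
    (hai : ∀ φ, IsTestFunction Ω φ → IntegrableOn (fun x => a x * φ x) Ω)
    (hQ : ∀ φ, IsTestFunction Ω φ → (∀ x, 0 ≤ φ x) →
      ∫ x in Ω, a x * φ x ≤ 1 / p * (∫ x in Ω, ‖gradient φ x‖ ^ p) + Q)
    {v : E N → ℝ} {Dv : E N → E N} (hv : MemW01p Ω p v Dv) :
    IntegrableOn (fun x => a x * v x) Ω ∧
      |∫ x in Ω, a x * v x| ≤ (1 / p + Q) * (∫ x in Ω, ‖Dv x‖ ^ p) ^ p⁻¹ := by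
  have hp0 : 0 < p := by linarith
  obtain ⟨φ, hφ, hE, hae⟩ := exists_ae_approx hp hv
  have hone : ∀ n : ℕ, 0 < 1 / (n + 1 : ℝ) := fun n => by positivity
  have hψ : ∀ n : ℕ, IsTestFunction Ω fun x => smoothAbs (1 / (n + 1 : ℝ)) (φ n x) := fun n =>
    (hφ n).smoothAbs (hone n)
  have hle : ∀ n : ℕ, ∫ x in Ω, ‖gradient (fun x => smoothAbs (1 / (n + 1 : ℝ)) (φ n x)) x‖ ^ p ≤
      ∫ x in Ω, ‖gradient (φ n) x‖ ^ p := fun n =>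
    integral_mono (integrable_norm_rpow_of_memLp hp0 ((hψ n).memLp_gradient _))
      (integrable_norm_rpow_of_memLp hp0 ((hφ n).memLp_gradient _)) fun x =>
      Real.rpow_le_rpow (norm_nonneg _) ((hφ n).norm_gradient_smoothAbs_le (hone n) x) hp0.le
  have hlim : ∀ᵐ x ∂(volume.restrict Ω),
      Tendsto (fun n : ℕ => a x * smoothAbs (1 / (n + 1 : ℝ)) (φ n x)) atTop
        (𝓝 (a x * |v x|)) := by
    filter_upwards [hae] with x hx
    refine Tendsto.const_mul _ ?_
    have h1 : Tendsto (fun n : ℕ => smoothAbs (1 / (n + 1 : ℝ)) (φ n x) - |φ n x|) atTop (𝓝 0) :=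
      squeeze_zero_norm (fun n => abs_smoothAbs_sub_le (hone n) (φ n x))
        tendsto_one_div_add_atTop_nhds_zero_nat
    simpa using h1.add hx.abs
  have hE0 : 0 ≤ ∫ x in Ω, ‖Dv x‖ ^ p := integral_nonneg fun x => by positivity
  have hb := integrable_of_tendsto_ae' (μ := volume.restrict Ω)
    (g := fun n x => a x * smoothAbs (1 / (n + 1 : ℝ)) (φ n x))
    (a := fun n => (1 / p + Q) * ((∫ x in Ω, ‖gradient (φ n) x‖ ^ p) + 1 / (n + 1 : ℝ)) ^ p⁻¹)
    (A := (1 / p + Q) * (∫ x in Ω, ‖Dv x‖ ^ p) ^ p⁻¹)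
    (fun n => hai _ (hψ n))
    (fun n => by
      filter_upwards [ae_restrict_mem hΩ.measurableSet] with x hx
      exact mul_nonneg (ha x hx) (smoothAbs_nonneg _ _))
    (fun n => by
      refine (integral_weight_mul_le_rpow hp hQ (hψ n) (fun x => smoothAbs_nonneg _ _)
        (hone n)).trans ?_
      have h1 : 0 ≤ ∫ x in Ω, ‖gradient (fun x => smoothAbs (1 / (n + 1 : ℝ)) (φ n x)) x‖ ^ p :=
        integral_nonneg fun x => by positivity
      have h2 := hle n
      have h3 := hone n
      exact mul_le_mul_of_nonneg_left (Real.rpow_le_rpow (by linarith) (by linarith)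
        (by positivity)) (by positivity))
    (by
      have h := ((hE.add tendsto_one_div_add_atTop_nhds_zero_nat).rpow_const (p := p⁻¹)
        (Or.inr (by positivity))).const_mul (1 / p + Q)
      rwa [add_zero] at h)
    hlim
  have hm : AEStronglyMeasurable (fun x => a x * v x) (volume.restrict Ω) :=
    ham.mul hv.memW1p.memLp.1
  have habs : ∀ᵐ x ∂(volume.restrict Ω), |a x * v x| = a x * |v x| := by
    filter_upwards [ae_restrict_mem hΩ.measurableSet] with x hx
    rw [abs_mul, abs_of_nonneg (ha x hx)]
  refine ⟨hb.1.mono' hm (habs.mono fun x hx => ?_), ?_⟩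
  · rw [Real.norm_eq_abs, hx]
  · refine (abs_integral_le_integral_abs).trans ?_
    rw [integral_congr_ae habs]
    exact hb.2

/-- Fatou fails for functions of changing sign. The nonnegative case first makes v ↦ ∫ a v
continuous; continuity then carries the bound from the dense family to test functions, and from
these to W_0^{1,p}. -/
theorem le_energy_sub_integral_weight (hp : 1 < p) (hΩ : IsOpen Ω)
    (hΩb : Bornology.IsBounded Ω) (hQ0 : 0 ≤ Q)
    (ha : ∀ x ∈ Ω, 0 ≤ a x) (ham : AEStronglyMeasurable a (volume.restrict Ω))
    (hai : ∀ φ, IsTestFunction Ω φ → IntegrableOn (fun x => a x * φ x) Ω)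
    (hd : ∀ n, IsTestFunction Ω (d n))
    (hdense : ∀ φ, IsTestFunction Ω φ → ∀ ε > 0, ∃ n,
      (∀ x ∈ Ω, |d n x - φ x| < ε ∧ ‖gradient (d n) x - gradient φ x‖ < ε) ∧
      ((∀ x, 0 ≤ φ x) → ∀ x, 0 ≤ d n x))
    (hQ : ∀ n, ∫ x in Ω, a x * d n x ≤ 1 / p * (∫ x in Ω, ‖gradient (d n) x‖ ^ p) + Q)
    {v : E N → ℝ} {Dv : E N → E N} (hv : MemW01p Ω p v Dv) :
    ∫ x in Ω, a x * v x ≤ 1 / p * (∫ x in Ω, ‖Dv x‖ ^ p) + Q := by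
  have hp0 : 0 < p := by linarith
  have hnn := fun φ hφ hφ0 => integral_weight_mul_le (φ := φ) hp hΩ hΩb ha hai hd hdense hQ hφ hφ0
  have hbound := fun (w : E N → ℝ) (Dw : E N → E N) (hw : MemW01p Ω p w Dw) =>
    integrableOn_weight_mul hp hΩ hQ0 ha ham hai hnn hw
  have hext : ∀ {w : E N → ℝ} {Dw : E N → E N} {φ : ℕ → E N → ℝ}, MemW01p Ω p w Dw →
      (∀ n, IsTestFunction Ω (φ n)) →
      Tendsto (fun n => eLpNorm (fun x => Dw x - gradient (φ n) x) (ENNReal.ofReal p)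
        (volume.restrict Ω)) atTop (𝓝 0) →
      (∀ n, ∫ x in Ω, a x * φ n x ≤ 1 / p * (∫ x in Ω, ‖gradient (φ n) x‖ ^ p) + Q) →
      ∫ x in Ω, a x * w x ≤ 1 / p * (∫ x in Ω, ‖Dw x‖ ^ p) + Q := by
    intro w Dw φ hw hφ hlim hle
    have hmem : ∀ n, MemW01p Ω p (fun x => w x + -1 * φ n x)
        (fun x => Dw x + (-1 : ℝ) • gradient (φ n) x) := fun n =>
      hw.add_const_smul hΩb hp.le ((hφ n).memW01p hΩb hp.le) (-1)
    have hE := tendsto_integral_norm_rpow hp.le (fun n => (hφ n).memLp_gradient _)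
      hw.memW1p.memLp_grad hlim
    have hdiff : Tendsto (fun n => ∫ x in Ω, ‖Dw x + (-1 : ℝ) • gradient (φ n) x‖ ^ p) atTop
        (𝓝 0) := by
      have := (tendsto_eLpNorm_zero_iff hp0 fun n =>
        hw.memW1p.memLp_grad.sub ((hφ n).memLp_gradient _)).1 hlim
      simpa [← sub_eq_add_neg] using this
    have hT : Tendsto (fun n => ∫ x in Ω, a x * φ n x) atTop (𝓝 (∫ x in Ω, a x * w x)) := by
      refine tendsto_iff_norm_sub_tendsto_zero.2 (squeeze_zero (fun _ => norm_nonneg _)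
        (fun n => ?_) (g := fun n => (1 / p + Q) *
          (∫ x in Ω, ‖Dw x + (-1 : ℝ) • gradient (φ n) x‖ ^ p) ^ p⁻¹) ?_)
      · have h1 := (hbound _ _ (hmem n)).2
        have e : ∫ x in Ω, a x * (w x + -1 * φ n x) =
            (∫ x in Ω, a x * w x) - ∫ x in Ω, a x * φ n x := by
          rw [← integral_sub (hbound _ _ hw).1 (hai _ (hφ n))]
          exact integral_congr_ae (ae_of_all _ fun x => by simp only; ring)
        rw [e] at h1
        rwa [norm_sub_rev, Real.norm_eq_abs]
      · have h := (hdiff.rpow_const (p := p⁻¹) (Or.inr (by positivity))).const_mul (1 / p + Q)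
        rwa [Real.zero_rpow (inv_ne_zero hp0.ne'), mul_zero] at h
    exact le_of_tendsto_of_tendsto' hT ((hE.const_mul (1 / p)).add_const Q) hle
  have htest : ∀ φ, IsTestFunction Ω φ →
      ∫ x in Ω, a x * φ x ≤ 1 / p * (∫ x in Ω, ‖gradient φ x‖ ^ p) + Q := by
    intro φ hφ
    choose k hk _ using fun n : ℕ => hdense φ hφ (1 / (n + 1 : ℝ)) (by positivity)
    exact hext (hφ.memW01p hΩb hp.le) (fun n => hd (k n))
      (tendsto_energy_of_uniform hp hΩ hΩb hk).2 fun n => hQ (k n)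
  obtain ⟨φ, hφ, -, h2⟩ := hv.approx
  exact hext hv hφ h2 fun n => htest _ (hφ n)

/-! ### The Euler-Lagrange equation for a fixed weight. -/

theorem integrable_add_norm_rpow {α V : Type*} [MeasurableSpace α] {μ : Measure α}
    [NormedAddCommGroup V] (hp : 0 < p) {g h : α → V} (hg : MemLp g (ENNReal.ofReal p) μ)
    (hh : MemLp h (ENNReal.ofReal p) μ) : Integrable (fun x => (‖g x‖ + ‖h x‖) ^ p) μ := by
  have hs : MemLp (fun x => ‖g x‖ + ‖h x‖) (ENNReal.ofReal p) μ := hg.norm.add hh.norm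
  have hi := integrable_norm_rpow_of_memLp hp hs
  have e : ∀ x, ‖‖g x‖ + ‖h x‖‖ = ‖g x‖ + ‖h x‖ := fun x =>
    Real.norm_of_nonneg (by positivity)
  simp only [e] at hi
  exact hi

theorem aestronglyMeasurable_powerMap {α V : Type*} [MeasurableSpace α] {μ : Measure α}
    [NormedAddCommGroup V] [InnerProductSpace ℝ V] (hp : 1 < p) {g h : α → V}
    (hg : AEStronglyMeasurable g μ) (hh : AEStronglyMeasurable h μ) :
    AEStronglyMeasurable (fun x => powerMap p (g x) (h x)) μ := by
  have h1 : AEStronglyMeasurable (fun x => powerMap p (g x)) μ :=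
    (continuous_powerMap hp).comp_aestronglyMeasurable hg
  have h2 : Continuous fun q : (V →L[ℝ] ℝ) × V => q.1 q.2 := by fun_prop
  exact h2.comp_aestronglyMeasurable (f := fun x => (powerMap p (g x), h x)) (h1.prodMk hh)

theorem norm_powerMap_add_smul_le {V : Type*} [NormedAddCommGroup V] [InnerProductSpace ℝ V]
    (hp : 1 < p) (a b : V) {t : ℝ} (ht0 : 0 ≤ t) (ht1 : t ≤ 1) :
    ‖powerMap p (a + t • b) b‖ ≤ (‖a‖ + ‖b‖) ^ p := by
  refine abs_powerMap_apply_le_rpow hp ((norm_add_le _ _).trans ?_) (by simp)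
  rw [norm_smul, Real.norm_of_nonneg ht0]
  gcongr
  exact mul_le_of_le_one_left (norm_nonneg _) ht1

/-- The Euler-Lagrange equation of a minimizer of `(1/p) ∫ |Dv|^p - ∫ a v`. -/
theorem euler_lagrange_of_minimizer (hp : 1 < p) (hΩb : Bornology.IsBounded Ω) {u : E N → ℝ}
    {G : E N → E N} (hu : MemW01p Ω p u G)
    (hai : ∀ v Dv, MemW01p Ω p v Dv → IntegrableOn (fun x => a x * v x) Ω)
    (hmin : ∀ v Dv, MemW01p Ω p v Dv →
      1 / p * (∫ x in Ω, ‖G x‖ ^ p) - ∫ x in Ω, a x * u x ≤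
        1 / p * (∫ x in Ω, ‖Dv x‖ ^ p) - ∫ x in Ω, a x * v x)
    {v : E N → ℝ} {Dv : E N → E N} (hv : MemW01p Ω p v Dv) :
    ∫ x in Ω, powerMap p (G x) (Dv x) = ∫ x in Ω, a x * v x := by
  have hp0 : 0 < p := by linarith
  have hG := hu.memW1p.memLp_grad
  -- Minimality against u + t v and the tangent inequality at G + t Dv give t∫ a v ≤ t∫ `powerMap p
  -- (G + t • Dv) Dv`. Divide by t and let t → 0. The reverse inequality comes from −v.
  have key : ∀ {v : E N → ℝ} {Dv : E N → E N}, MemW01p Ω p v Dv →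
      ∫ x in Ω, a x * v x ≤ ∫ x in Ω, powerMap p (G x) (Dv x) := by
    intro v Dv hv
    have hD := hv.memW1p.memLp_grad
    have hsi : IntegrableOn (fun x => (‖G x‖ + ‖Dv x‖) ^ p) Ω := integrable_add_norm_rpow hp0 hG hD
    have hmeas : ∀ t : ℝ, AEStronglyMeasurable (fun x => powerMap p (G x + t • Dv x) (Dv x))
        (volume.restrict Ω) := fun t =>
      aestronglyMeasurable_powerMap hp
        (hu.add_const_smul hΩb hp.le hv t).memW1p.memLp_grad.aestronglyMeasurable
        hD.aestronglyMeasurable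
    have hbd : ∀ t : ℝ, 0 ≤ t → t ≤ 1 → ∀ x,
        ‖powerMap p (G x + t • Dv x) (Dv x)‖ ≤ (‖G x‖ + ‖Dv x‖) ^ p := fun t ht0 ht1 x =>
      norm_powerMap_add_smul_le hp _ _ ht0 ht1
    have hone0 : ∀ n : ℕ, 0 < 1 / (n + 1 : ℝ) := fun n => by positivity
    have hone1 : ∀ n : ℕ, 1 / (n + 1 : ℝ) ≤ 1 := fun n => by
      rw [div_le_one (by positivity)]
      linarith [show (0 : ℝ) ≤ n by positivity]
    have hle : ∀ n : ℕ, ∫ x in Ω, a x * v x ≤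
        ∫ x in Ω, powerMap p (G x + (1 / (n + 1 : ℝ)) • Dv x) (Dv x) := by
      intro n
      set t := 1 / (n + 1 : ℝ) with ht
      have ht0 : 0 < t := hone0 n
      have hmem := hu.add_const_smul hΩb hp.le hv t
      have h1 := hmin _ _ hmem
      have e : ∫ x in Ω, a x * (u x + t * v x) =
          (∫ x in Ω, a x * u x) + t * ∫ x in Ω, a x * v x := by
        rw [← integral_const_mul, ← integral_add (hai _ _ hu) ((hai _ _ hv).const_mul t)]
        exact integral_congr_ae (ae_of_all _ fun x => by simp only; ring)
      rw [e] at h1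
      have hi1 := (integrable_norm_rpow_of_memLp hp0 hmem.memW1p.memLp_grad).const_mul (1 / p)
      have hi2 := (integrable_norm_rpow_of_memLp hp0 hG).const_mul (1 / p)
      have hi3 : IntegrableOn (fun x => powerMap p (G x + t • Dv x) (Dv x)) Ω :=
        hsi.mono' (hmeas t) (ae_of_all _ (hbd t ht0.le (hone1 n)))
      have h2 : ∫ x in Ω, (1 / p * ‖G x + t • Dv x‖ ^ p) ≤
          ∫ x in Ω, (1 / p * ‖G x‖ ^ p + t * powerMap p (G x + t • Dv x) (Dv x)) := by
        refine integral_mono hi1 (hi2.add (hi3.const_mul t)) fun x => ?_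
        have h := norm_rpow_add_powerMap_le hp (G x + t • Dv x) (G x)
        rw [sub_add_cancel_left, map_neg, map_smul, smul_eq_mul] at h
        simp only
        linarith
      rw [integral_add hi2 (hi3.const_mul t), integral_const_mul, integral_const_mul,
        integral_const_mul] at h2
      have h3 : t * ∫ x in Ω, a x * v x ≤ t * ∫ x in Ω, powerMap p (G x + t • Dv x) (Dv x) := by
        linarith
      exact le_of_mul_le_mul_left h3 ht0
    have hlim : Tendsto (fun n : ℕ => ∫ x in Ω, powerMap p (G x + (1 / (n + 1 : ℝ)) • Dv x) (Dv x))
        atTop (𝓝 (∫ x in Ω, powerMap p (G x) (Dv x))) := by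
      refine tendsto_integral_of_dominated_convergence (fun x => (‖G x‖ + ‖Dv x‖) ^ p)
        (fun n => hmeas _) hsi (fun n => ae_of_all _ (hbd _ (hone0 n).le (hone1 n)))
        (ae_of_all _ fun x => ?_)
      have h1 : Tendsto (fun n : ℕ => G x + (1 / (n + 1 : ℝ)) • Dv x) atTop (𝓝 (G x)) := by
        simpa using ((tendsto_one_div_add_atTop_nhds_zero_nat (𝕜 := ℝ)).smul_const
          (Dv x)).const_add (G x)
      have h2 : Tendsto (fun n : ℕ => powerMap p (G x + (1 / (n + 1 : ℝ)) • Dv x)) atTop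
          (𝓝 (powerMap p (G x))) := ((continuous_powerMap hp).tendsto _).comp h1
      exact ((ContinuousLinearMap.apply ℝ ℝ (Dv x)).continuous.tendsto _).comp h2
    exact ge_of_tendsto' hlim hle
  refine le_antisymm ?_ (key hv)
  -- The function −v, written as v − 2v to fit `add_const_smul`.
  have hneg : MemW01p Ω p (fun x => v x + -2 * v x) (fun x => Dv x + (-2 : ℝ) • Dv x) :=
    hv.add_const_smul hΩb hp.le hv (-2)
  have h := key hneg
  have e1 : ∫ x in Ω, a x * (v x + -2 * v x) = -∫ x in Ω, a x * v x := by
    rw [← integral_neg]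
    exact integral_congr_ae (ae_of_all _ fun x => by simp only; ring)
  have e2 : ∫ x in Ω, powerMap p (G x) (Dv x + (-2 : ℝ) • Dv x) =
      -∫ x in Ω, powerMap p (G x) (Dv x) := by
    rw [← integral_neg]
    refine integral_congr_ae (ae_of_all _ fun x => ?_)
    simp only [map_add, map_smul, smul_eq_mul]
    ring
  rw [e1, e2] at h
  linarith

end Weight

/-! ### Passage to the limit -/

theorem exists_rpow_le_add_mul_rpow {q : ℝ} (hp : 0 < p) (hpq : p < q) {ε : ℝ} (hε : 0 < ε) :
    ∃ K : ℝ, 0 ≤ K ∧ ∀ t : ℝ, |t| ^ p ≤ K + ε * |t| ^ q := by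
  have h := (tendsto_rpow_neg_atTop (sub_pos.2 hpq)).eventually (gt_mem_nhds hε)
  obtain ⟨T, hT⟩ := eventually_atTop.1 h
  set S := max T 1 with hS
  have hS1 : 1 ≤ S := le_max_right _ _
  refine ⟨S ^ p, by positivity, fun t => ?_⟩
  have hεt : 0 ≤ ε * |t| ^ q := by positivity
  have hSp : 0 ≤ S ^ p := by positivity
  rcases le_total |t| S with ht | ht
  · have := Real.rpow_le_rpow (abs_nonneg t) ht hp.le
    linarith
  · have ht0 : 0 < |t| := by linarith
    have h1 := (hT |t| ((le_max_left _ _).trans ht)).le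
    have h2 : |t| ^ p = |t| ^ (-(q - p)) * |t| ^ q := by
      rw [← Real.rpow_add ht0]
      congr 1
      ring
    rw [h2]
    have := mul_le_mul_of_nonneg_right h1 (Real.rpow_nonneg (abs_nonneg t) q)
    linarith

theorem abs_smoothPosPart_le {ε : ℝ} (hε : 0 < ε) (t : ℝ) :
    |(1 / 2) * (smoothAbs ε t + t)| ≤ |t| := by
  have h1 : √(t ^ 2 + ε ^ 2) ≤ |t| + ε :=
    Real.sqrt_le_iff.2 ⟨by positivity, by nlinarith [sq_abs t, abs_nonneg t]⟩
  have h2 : smoothAbs ε t ≤ |t| := by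
    unfold smoothAbs
    linarith
  have h3 := smoothAbs_nonneg ε t
  rw [abs_le]
  constructor <;> linarith [neg_abs_le t, le_abs_self t]

theorem memLp_of_integrableOn_rpow (hΩb : Bornology.IsBounded Ω) {q : ℝ} (hp : 0 < p)
    (hpq : p ≤ q) {u : E N → ℝ} (hum : AEStronglyMeasurable u (volume.restrict Ω))
    (hui : IntegrableOn (fun x => |u x| ^ q) Ω) :
    MemLp u (ENNReal.ofReal p) (volume.restrict Ω) := by
  have : IsFiniteMeasure (volume.restrict Ω) := isFiniteMeasure_restrict hΩb
  have hq0 : 0 < q := hp.trans_le hpq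
  have h : MemLp u (ENNReal.ofReal q) (volume.restrict Ω) := by
    rw [← integrable_norm_rpow_iff hum (by simpa using hq0) ENNReal.ofReal_ne_top,
      ENNReal.toReal_ofReal hq0.le]
    exact hui
  exact h.mono_exponent (ENNReal.ofReal_le_ofReal hpq)

/-- Smoothed positive parts of φ_n have no more energy, converge almost everywhere to u⁺ and are
bounded in L^{p*}. As p < p*, they converge in L^p, and lower semicontinuity of the energy applies.
-/
theorem exists_memW01p_posPart (hp : 1 < p) (hpN : p < N) (hΩ : IsOpen Ω)
    (hΩb : Bornology.IsBounded Ω) {φ : ℕ → E N → ℝ} (hφ : ∀ n, IsTestFunction Ω (φ n))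
    {u : E N → ℝ} {A Q : ℝ} (hum : AEStronglyMeasurable u (volume.restrict Ω))
    (hlim : ∀ᵐ x ∂(volume.restrict Ω), Tendsto (fun n => φ n x) atTop (𝓝 (u x)))
    (hA : ∀ n, ∫ x in Ω, |φ n x| ^ pStar N p ≤ A)
    (hui : IntegrableOn (fun x => |u x| ^ pStar N p) Ω)
    (huA : ∫ x in Ω, |u x| ^ pStar N p ≤ A)
    (hQ : Tendsto (fun n => ∫ x in Ω, ‖gradient (φ n) x‖ ^ p) atTop (𝓝 Q)) :
    ∃ G : E N → E N, MemW01p Ω p (fun x => max (u x) 0) G ∧ ∫ x in Ω, ‖G x‖ ^ p ≤ Q := by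
  have hp0 : 0 < p := by linarith
  have hq0 := pStar_pos hp hpN
  have hpq := lt_pStar hp hpN
  have hone : ∀ n : ℕ, 0 < 1 / (n + 1 : ℝ) := fun n => by positivity
  set ψ : ℕ → E N → ℝ := fun n x => (1 / 2) * (smoothAbs (1 / (n + 1 : ℝ)) (φ n x) + φ n x) with hψd
  have hψ : ∀ n, IsTestFunction Ω (ψ n) := fun n => (hφ n).smoothPosPart (hone n)
  have hle : ∀ n : ℕ, ∫ x in Ω, ‖gradient (ψ n) x‖ ^ p ≤ ∫ x in Ω, ‖gradient (φ n) x‖ ^ p :=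
    fun n => integral_mono (integrable_norm_rpow_of_memLp hp0 ((hψ n).memLp_gradient _))
      (integrable_norm_rpow_of_memLp hp0 ((hφ n).memLp_gradient _)) fun x =>
      Real.rpow_le_rpow (norm_nonneg _) ((hφ n).norm_gradient_smoothPosPart_le (hone n) x) hp0.le
  have hu : MemLp (fun x => max (u x) 0) (ENNReal.ofReal p) (volume.restrict Ω) :=
    (memLp_of_integrableOn_rpow hΩb hp0 hpq.le hum hui).pos_part
  have hφi : ∀ n, IntegrableOn (fun x => |φ n x| ^ pStar N p) Ω := fun n =>
    integrable_norm_rpow_of_memLp hq0 ((hφ n).memLp _)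
  have hmax : ∀ t : ℝ, |max t 0| ≤ |t| := fun t => by
    rw [abs_of_nonneg (le_max_right _ _)]
    exact max_le (le_abs_self t) (abs_nonneg t)
  have hb : ∀ n x, |ψ n x - max (u x) 0| ^ pStar N p ≤
      2 ^ pStar N p * (|φ n x| ^ pStar N p + |u x| ^ pStar N p) := fun n x => by
    refine (norm_sub_rpow_le hq0 (ψ n x) (max (u x) 0)).trans ?_
    have h1 : ‖ψ n x‖ ≤ |φ n x| := abs_smoothPosPart_le (hone n) (φ n x)
    have h2 : ‖max (u x) 0‖ ≤ |u x| := hmax (u x)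
    gcongr
  have hwm : ∀ n, AEStronglyMeasurable (fun x => ψ n x - max (u x) 0) (volume.restrict Ω) :=
    fun n => ((hψ n).memLp 1).aestronglyMeasurable.sub hu.aestronglyMeasurable
  have hbi : ∀ n, IntegrableOn (fun x => 2 ^ pStar N p *
      (|φ n x| ^ pStar N p + |u x| ^ pStar N p)) Ω := fun n => ((hφi n).add hui).const_mul _
  have hwi : ∀ n, IntegrableOn (fun x => |ψ n x - max (u x) 0| ^ pStar N p) Ω := fun n => by
    refine (hbi n).mono' ?_ (ae_of_all _ fun x => ?_)
    · exact ((hwm n).aemeasurable.norm.pow_const _).aestronglyMeasurable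
    · rw [Real.norm_of_nonneg (by positivity)]
      exact hb n x
  have hwA : ∀ n, ∫ x in Ω, |ψ n x - max (u x) 0| ^ pStar N p ≤ 2 ^ pStar N p * (A + A) :=
    fun n => by
    refine (integral_mono (hwi n) (hbi n) (hb n)).trans ?_
    rw [integral_const_mul, integral_add (hφi n) hui]
    have := hA n
    gcongr
  have hwl : ∀ᵐ x ∂(volume.restrict Ω),
      Tendsto (fun n => ψ n x - max (u x) 0) atTop (𝓝 0) := by
    filter_upwards [hlim] with x hx
    have h1 : Tendsto (fun n => ψ n x - max (φ n x) 0) atTop (𝓝 0) :=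
      squeeze_zero_norm (fun n => abs_smoothPosPart_sub_le (hone n) (φ n x))
        tendsto_one_div_add_atTop_nhds_zero_nat
    have h2 : Tendsto (fun n => max (φ n x) 0 - max (u x) 0) atTop (𝓝 0) := by
      simpa using (hx.max (tendsto_const_nhds (x := (0 : ℝ)))).sub_const (max (u x) 0)
    simpa using h1.add h2
  have hA0 : 0 ≤ A := (integral_nonneg fun x => by positivity).trans huA
  -- The differences are treated as a sequence with limit 0, with |t|^p as the superposed function.
  have hT := (tendsto_integral_superposition hΩ hΩb (h := fun _ t => |t| ^ p) (q := pStar N p)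
    (v := fun _ => 0)
    ((continuous_snd.abs.rpow_const fun _ => Or.inr hp0.le).continuousOn)
    (fun ε hε => by
      obtain ⟨K, hK, h⟩ := exists_rpow_le_add_mul_rpow hp0 hpq hε
      refine ⟨K, hK, fun x _ t => ?_⟩
      rw [abs_of_nonneg (by positivity)]
      exact h t)
    hwm aestronglyMeasurable_const hwi hwA
    (by simp only [abs_zero, Real.zero_rpow hq0.ne']; exact integrable_zero _ _ _)
    (by simp only [abs_zero, Real.zero_rpow hq0.ne', integral_zero]; positivity) hwl).2
  simp only [abs_zero, Real.zero_rpow hp0.ne', integral_zero] at hT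
  refine exists_memW01p_of_energy_le hΩb hp hu fun ε hε => ?_
  obtain ⟨n, hn1, hn2⟩ := ((hT.eventually (gt_mem_nhds hε)).and
    (hQ.eventually (gt_mem_nhds (lt_add_of_pos_right Q hε)))).exists
  exact ⟨ψ n, hψ n, hn1, (hle n).trans hn2.le⟩

/-- The tangent inequality at ∇φ, with the pairing of gradients replaced by J'(φ)ψ + ∫ f(x,φ)ψ.
Every term on the left now has a limit along the almost critical sequence without convergence of its
gradients. -/
theorem energy_add_dFunctional_le (hp : 1 < p) (hΩb : Bornology.IsBounded Ω) {φ ψ : E N → ℝ}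
    (hφ : IsTestFunction Ω φ) (hψ : IsTestFunction Ω ψ) :
    1 / p * (∫ x in Ω, ‖gradient φ x‖ ^ p) +
        (dFunctional Ω p f φ ψ + ∫ x in Ω, f x (φ x) * ψ x) - (∫ x in Ω, ‖gradient φ x‖ ^ p) ≤
      1 / p * ∫ x in Ω, ‖gradient ψ x‖ ^ p := by
  have hp0 : 0 < p := by linarith
  have i1 : IntegrableOn (fun x => ‖gradient φ x‖ ^ p) Ω :=
    integrable_norm_rpow_of_memLp hp0 (hφ.memLp_gradient _)
  have i2 : IntegrableOn (fun x => ‖gradient ψ x‖ ^ p) Ω :=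
    integrable_norm_rpow_of_memLp hp0 (hψ.memLp_gradient _)
  have i3 := hφ.integrableOn_powerMap hp hΩb hψ
  have i4 : IntegrableOn (fun x => 1 / p * ‖gradient φ x‖ ^ p +
      powerMap p (gradient φ x) (gradient ψ x)) Ω := (i1.const_mul _).add i3
  have h : ∫ x in Ω, (1 / p * ‖gradient φ x‖ ^ p + powerMap p (gradient φ x) (gradient ψ x) -
      ‖gradient φ x‖ ^ p) ≤ ∫ x in Ω, 1 / p * ‖gradient ψ x‖ ^ p := by
    refine integral_mono (i4.sub i1) (i2.const_mul _) fun x => ?_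
    have := norm_rpow_add_powerMap_le hp (gradient φ x) (gradient ψ x)
    rw [map_sub, powerMap_self hp] at this
    simp only
    linarith
  rw [integral_sub i4 i1, integral_add (i1.const_mul _) i3,
    integral_const_mul, integral_const_mul] at h
  simp only [dFunctional, ← powerMap_apply]
  linarith

/-- Palais-Smale sequences of test functions, along a countable family of directions. -/
theorem exists_palaisSmale (hp : 1 < p) (hpN : p < N) (hΩ : IsOpen Ω)
    (hΩb : Bornology.IsBounded Ω) (hne : Ω.Nonempty) (hf : SCPI Ω p f) (h1 : L1 Ω f)
    (h2 : L2 Ω p f) (h3 : L3 Ω p f) (h4 : L4 Ω p f) {d : ℕ → E N → ℝ}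
    (hd : ∀ n, IsTestFunction Ω (d n)) :
    ∃ (u : ℕ → E N → ℝ) (α B : ℝ), 0 < α ∧ (∀ n, IsTestFunction Ω (u n)) ∧
      (∀ n, α ≤ functional Ω p f (u n)) ∧ (∀ n, ∫ x in Ω, ‖gradient (u n) x‖ ^ p ≤ B) ∧
      Tendsto (fun n => dFunctional Ω p f (u n) (u n)) atTop (𝓝 0) ∧
      ∀ k, Tendsto (fun n => dFunctional Ω p f (u n) (d k)) atTop (𝓝 0) := by
  obtain ⟨μ, -, hμ0, hμ, -⟩ := exists_growth_zero hne hp hpN hf h1 h3 h4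
  obtain ⟨ρ, α, hρ, hα, hge⟩ := exists_functional_ge hp hpN hΩ hΩb hne hf h1 h3 h4
  obtain ⟨e, he, he0, heρ⟩ := exists_functional_nonpos hp hΩ hΩb hne h1 h2 (hμ0.trans_lt hμ) ρ
  have hone : ∀ n : ℕ, 0 < 1 / (n + 1 : ℝ) := fun n => by positivity
  choose u hu hu1 hu2 hu3 hu4 using fun n : ℕ => exists_galerkin hp hΩ hΩb h1 hρ hα hge he he0 heρ
    (d := fun i : Fin (n + 1) => d i) (fun i => hd i) (hone n)
  obtain ⟨B, hB⟩ := exists_energy_le hp hpN hΩ hΩb hne hf h1 h2 h3 h4 hu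
    (fun n => (half_pos hα).le.trans (hu1 n)) hu2 fun n => (hu3 n).trans <| by
      rw [div_le_one (by positivity)]
      linarith [show (0 : ℝ) ≤ n by positivity]
  have hlim := tendsto_one_div_add_atTop_nhds_zero_nat (𝕜 := ℝ)
  refine ⟨u, α / 2, B, half_pos hα, hu, hu1, hB, squeeze_zero_norm hu3 hlim, fun k => ?_⟩
  refine squeeze_zero_norm' ?_ hlim
  filter_upwards [eventually_ge_atTop k] with n hn
  exact hu4 n ⟨k, Nat.lt_succ_of_le hn⟩

theorem exists_growth_f_mul (hf : SCPI Ω p f) (h1 : L1 Ω f) {v : E N → ℝ}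
    (hv : IsTestFunction Ω v) {ε : ℝ} (hε : 0 < ε) :
    ∃ K : ℝ, 0 ≤ K ∧ ∀ x ∈ Ω, ∀ t : ℝ, |f x t * v x| ≤ K + ε * |t| ^ pStar N p := by
  obtain ⟨C, hC⟩ := hv.continuous.bounded_above_of_compact_support hv.compact
  have hC0 : 0 ≤ C := (norm_nonneg _).trans (hC 0)
  obtain ⟨M, hM0, hM⟩ := exists_growth_on_compact hf h1 hv.compact hv.supp
    (show 0 < ε / (C + 1) by positivity)
  refine ⟨M * C, by positivity, fun x hx t => ?_⟩
  by_cases hxv : x ∈ tsupport v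
  · rw [abs_mul, abs_of_nonneg (h1.f_nonneg hx t)]
    calc f x t * |v x| ≤ (M + ε / (C + 1) * |t| ^ pStar N p) * C :=
          mul_le_mul (hM x hxv t) (hC x) (abs_nonneg _) (by positivity)
      _ = M * C + ε * |t| ^ pStar N p * (C / (C + 1)) := by ring
      _ ≤ M * C + ε * |t| ^ pStar N p := by
          refine add_le_add_right (mul_le_of_le_one_right (by positivity) ?_) _
          rw [div_le_one (by positivity)]
          linarith
  · rw [image_eq_zero_of_notMem_tsupport hxv, mul_zero, abs_zero]
    positivity

theorem exists_isWeakSolution (hp : 1 < p) (hpN : p < N) (hΩ : IsOpen Ω)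
    (hΩb : Bornology.IsBounded Ω) (hne : Ω.Nonempty) (hf : SCPI Ω p f) (h1 : L1 Ω f)
    (h2 : L2 Ω p f) (h3 : L3 Ω p f) (h4 : L4 Ω p f) :
    ∃ (u : E N → ℝ) (Du : E N → E N), IsWeakSolution Ω p f u Du ∧ Nontrivial Ω u ∧
      ∀ᵐ x ∂(volume.restrict Ω), 0 ≤ u x := by
  have hp0 : 0 < p := by linarith
  have hq0 := pStar_pos hp hpN
  obtain ⟨d, hd, hdense⟩ := exists_seq_dense hΩb
  obtain ⟨w, α, B, hα, hw, hwα, hwB, hwd, hwdk⟩ :=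
    exists_palaisSmale hp hpN hΩ hΩb hne hf h1 h2 h3 h4 hd
  obtain ⟨σ, hσ, u, A, hum, hlim, hA, hui, huA⟩ := exists_subseq_of_energy_le hp hpN hΩb hw hwB
  have hσt := hσ.tendsto_atTop
  have hsup : ∀ {h : E N → ℝ → ℝ}, ContinuousOn (fun q : E N × ℝ => h q.1 q.2) (Ω ×ˢ univ) →
      (∀ ε > 0, ∃ K : ℝ, 0 ≤ K ∧ ∀ x ∈ Ω, ∀ t : ℝ, |h x t| ≤ K + ε * |t| ^ pStar N p) →
      IntegrableOn (fun x => h x (u x)) Ω ∧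
      Tendsto (fun n => ∫ x in Ω, h x (w (σ n) x)) atTop (𝓝 (∫ x in Ω, h x (u x))) :=
    fun hh hgr => tendsto_integral_superposition hΩ hΩb hh hgr
      (fun n => ((hw (σ n)).memLp 1).aestronglyMeasurable) hum
      (fun n => integrable_norm_rpow_of_memLp hq0 ((hw (σ n)).memLp _)) (fun n => hA (σ n))
      hui huA hlim
  have hTF := (hsup h1.continuousOn_primitiveF fun ε hε => by
    obtain ⟨K, hK, h⟩ := exists_growth hne hp hpN hf h1 h3 h4 hε
    refine ⟨K, hK, fun x hx t => ?_⟩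
    rw [abs_of_nonneg (h1.primitiveF_nonneg hx t)]
    exact (h x hx t).1).2
  have hTf := (hsup (h := fun x t => t * f x t) (continuous_snd.continuousOn.mul h1.cont)
    fun ε hε => by
      obtain ⟨K, hK, h⟩ := exists_growth hne hp hpN hf h1 h3 h4 hε
      refine ⟨K, hK, fun x hx t => ?_⟩
      rw [abs_of_nonneg (h1.mul_f_nonneg hx t)]
      exact (h x hx t).2).2
  have hTv : ∀ v, IsTestFunction Ω v → IntegrableOn (fun x => f x (u x) * v x) Ω ∧
      Tendsto (fun n => ∫ x in Ω, f x (w (σ n) x) * v x) atTop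
        (𝓝 (∫ x in Ω, f x (u x) * v x)) := fun v hv =>
    hsup (h := fun x t => f x t * v x)
      (h1.cont.mul (hv.continuous.comp continuous_fst).continuousOn)
      fun ε hε => exists_growth_f_mul hf h1 hv hε
  set Q := ∫ x in Ω, u x * f x (u x) with hQ
  -- J'(w_n)w_n → 0 identifies the limit of the energies with that of ∫ w_n f(x,w_n).
  have hTe : Tendsto (fun n => ∫ x in Ω, ‖gradient (w (σ n)) x‖ ^ p) atTop (𝓝 Q) := by
    have h := (hwd.comp hσt).add hTf
    rw [zero_add] at h
    refine h.congr fun n => ?_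
    simp only [Function.comp_apply]
    rw [dFunctional_self hp, sub_add_cancel]
  have hQα : α ≤ 1 / p * Q - ∫ x in Ω, primitiveF f x (u x) :=
    ge_of_tendsto' ((hTe.const_mul (1 / p)).sub hTF) fun n => hwα (σ n)
  have hF0 : 0 ≤ ∫ x in Ω, primitiveF f x (u x) :=
    setIntegral_nonneg hΩ.measurableSet fun x hx => h1.primitiveF_nonneg hx _
  have hQ0 : 0 < Q := by
    have : 0 < 1 / p * Q := by linarith
    exact pos_of_mul_pos_right this (by positivity)
  obtain ⟨G, hG, hGQ⟩ := exists_memW01p_posPart hp hpN hΩ hΩb (fun n => hw (σ n)) hum hlim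
    (fun n => hA (σ n)) hui huA hTe
  have hfu : ∀ x ∈ Ω, f x (max (u x) 0) = f x (u x) := fun x hx => by
    rcases le_total (u x) 0 with h | h
    · rw [max_eq_right h, h1.zero x hx _ le_rfl, h1.zero x hx _ h]
    · rw [max_eq_left h]
  have hfuu : ∀ x ∈ Ω, f x (u x) * max (u x) 0 = u x * f x (u x) := fun x hx => by
    rcases le_total (u x) 0 with h | h
    · rw [h1.zero x hx _ h, zero_mul, mul_zero]
    · rw [max_eq_left h, mul_comm]
  have hau : ∫ x in Ω, f x (u x) * max (u x) 0 = Q :=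
    setIntegral_congr_fun hΩ.measurableSet hfuu
  -- Limit of the tangent inequality at ∇w_n in the direction d_k, using J'(w_n)d_k → 0.
  have hk : ∀ k, ∫ x in Ω, f x (u x) * d k x ≤
      1 / p * (∫ x in Ω, ‖gradient (d k) x‖ ^ p) + (Q - 1 / p * Q) := fun k => by
    have hT := ((hTe.const_mul (1 / p)).add (((hwdk k).comp hσt).add (hTv _ (hd k)).2)).sub hTe
    have := le_of_tendsto' hT fun n =>
      energy_add_dFunctional_le (f := f) hp hΩb (hw (σ n)) (hd k)
    linarith
  have hQ1 : 0 ≤ Q - 1 / p * Q := by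
    have : 1 / p ≤ 1 := by rw [div_le_one hp0]; exact hp.le
    nlinarith
  have ha : ∀ x ∈ Ω, 0 ≤ f x (u x) := fun x hx => h1.f_nonneg hx _
  have ham := aestronglyMeasurable_superposition hΩ h1.cont hum
  have hai := fun φ hφ => (hTv φ hφ).1
  have hint : ∀ v Dv, MemW01p Ω p v Dv → IntegrableOn (fun x => f x (u x) * v x) Ω :=
    fun v Dv hv => (integrableOn_weight_mul hp hΩ hQ1 ha ham hai
      (fun φ hφ hφ0 => integral_weight_mul_le hp hΩ hΩb ha hai hd hdense hk hφ hφ0) hv).1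
  -- The value at u⁺ is at most Q/p − Q, and the weighted bound says that no v goes below Q/p − Q.
  have hmin : ∀ v Dv, MemW01p Ω p v Dv →
      1 / p * (∫ x in Ω, ‖G x‖ ^ p) - ∫ x in Ω, f x (u x) * max (u x) 0 ≤
        1 / p * (∫ x in Ω, ‖Dv x‖ ^ p) - ∫ x in Ω, f x (u x) * v x := fun v Dv hv => by
    have h := le_energy_sub_integral_weight hp hΩ hΩb hQ1 ha ham hai hd hdense hk hv
    have hG' : 1 / p * (∫ x in Ω, ‖G x‖ ^ p) ≤ 1 / p * Q := by gcongr
    rw [hau]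
    linarith
  refine ⟨fun x => max (u x) 0, G, ⟨hG, fun v Dv hv => ?_, fun v Dv hv => ?_⟩, fun h0 => ?_,
    ae_of_all _ fun x => le_max_right _ _⟩
  · exact (hint v Dv hv).congr_fun (fun x hx => by simp only [hfu x hx]) hΩ.measurableSet
  · have h := euler_lagrange_of_minimizer hp hΩb hG hint hmin hv
    simp only [powerMap_apply] at h
    rw [h]
    exact setIntegral_congr_fun hΩ.measurableSet fun x hx => by simp only [hfu x hx]
  -- If u⁺ vanished almost everywhere, this integral, which equals Q > 0, would be zero.
  · have : ∫ x in Ω, f x (u x) * max (u x) 0 = 0 := by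
      rw [integral_congr_ae (g := fun _ => (0 : ℝ)) (h0.mono fun x hx => by simp only [hx, mul_zero]),
        integral_zero]
    linarith

end PLaplace

end

theorem theorem1 (N : ℕ) (p : ℝ) (hp : 1 < p) (hpN : p < N)
    (Ω : Set (PLaplace.E N)) (hΩ_open : IsOpen Ω) (hΩ_bdd : Bornology.IsBounded Ω)
    (hΩ_ne : Ω.Nonempty)
    (f : PLaplace.E N → ℝ → ℝ)
    (hf : PLaplace.SCPI Ω p f) (h1 : PLaplace.L1 Ω f) (h2 : PLaplace.L2 Ω p f)
    (h3 : PLaplace.L3 Ω p f) (h4 : PLaplace.L4 Ω p f) :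
    ∃ (u : PLaplace.E N → ℝ) (Du : PLaplace.E N → PLaplace.E N),
      PLaplace.IsWeakSolution Ω p f u Du ∧ PLaplace.Nontrivial Ω u ∧
        ∀ᵐ x ∂(MeasureTheory.volume.restrict Ω), 0 ≤ u x :=
  PLaplace.exists_isWeakSolution hp hpN hΩ_open hΩ_bdd hΩ_ne hf h1 h2 h3 h4
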